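/- Let $q$ be an indeterminate. Write $(a;q)_k=\prod_{i=0}^{k-1}(1-aq^i)$ for the $q$-shifted factorial, $[m]=(1-q^m)/(1-q)$ for the $q$-integer and $\Phi_n(q)$ for the $n$-th cyclotomic polynomial. For rational functions $A,B\in\mathbb{Q}(q)$ and a polynomial $P\in\mathbb{Q}[q]$, $A\equiv B\pmod P$ means that $P$ divides the numerator of $A-B$ written in lowest terms. Let $n\equiv 1\pmod 4$ be a positive integer and put $$B(n,q)=\frac{(n^2-1)(1-q)^2}{24}+\sum_{k=1}^{(n-1)/4}\frac{q^{4k-2}}{[4k-2]^2},\qquad C_n(q)=\frac{(q^2;q^4)_{(n-1)/4}}{(q^4;q^4)_{(n-1)/4}}\,[n]\,q^{(1-n)/4}\bigl\{1+[n]^2B(n,q)\bigr\}.$$ Then, for $M=(n-1)/4$ and also for $M=n-1$, the following five congruences hold modulo $[n]\Phi_n(q)^3$: $$\sum_{k=0}^{M}[8k+1]\frac{(q;q^4)_k^2(q^2;q^8)_k^2}{(q^4;q^4)_k^2(q^8;q^8)_k^2}q^{5k}\equiv C_n(q)\sum_{k=0}^{(n-1)/4}\frac{(q^3;q^4)_k(q;q^4)_k^3}{(q^4;q^4)_k(-q^4;q^4)_k^2(q^2;q^4)_k}q^{4k};$$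 $$\sum_{k=0}^{M}[8k+1]\frac{(q;q^4)_k^3(q^2;q^8)_k}{(q^4;q^4)_k^3(q^8;q^8)_k}q^{2k^2+4k}\equiv C_n(q)\sum_{k=0}^{(n-1)/4}\frac{(q;q^4)_k^3}{(q^4;q^4)_k(-q^4;q^4)_k(q^2;q^4)_k}q^{4k};$$ $$\sum_{k=0}^{M}[8k+1]\frac{(q;q^4)_k^3(q^2;q^8)_k}{(q^4;q^4)_k^3(q^8;q^8)_k}q^{3k-2k^2}\equiv C_n(q)\sum_{k=0}^{(n-1)/4}\frac{(q;q^4)_k^3}{(q^4;q^4)_k(-q^4;q^4)_k(q^2;q^4)_k}(-q)^{3k};$$ $$\sum_{k=0}^{M}[8k+1]\frac{(q;q^4)_k^4}{(q^4;q^4)_k^4}q^{4k^2+3k}\equiv C_n(q)\sum_{k=0}^{(n-1)/4}\frac{(q;q^4)_k^3}{(q^4;q^4)_k(q^2;q^4)_k}q^{4k};$$ $$\sum_{k=0}^{M}[8k+1]\frac{(q;q^4)_k^4}{(q^4;q^4)_k^4}q^{k-4k^2}\equiv C_n(q)\sum_{k=0}^{(n-1)/4}\frac{(q;q^4)_k^3}{(q^4;q^4)_k(q^2;q^4)_k}(-q)^{k-2k^2}.$$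 -/

import Mathlib

open Polynomial

/-- The `q`-shifted factorial `(a; q)_k = (1 - a)(1 - a q) ⋯ (1 - a q ^ (k - 1))`. -/
def qPoch {K : Type*} [Field K] (a q : K) (k : ℕ) : K :=
  ∏ i ∈ Finset.range k, (1 - a * q ^ i)

/-- The `q`-integer `[n]_q = (1 - q ^ n) / (1 - q)`. -/
def qInt {K : Type*} [Field K] (q : K) (n : ℕ) : K :=
  (1 - q ^ n) / (1 - q)

/-- The `q`-integer `[n]` as a polynomial in the indeterminate. -/
noncomputable def qIntPoly (n : ℕ) : ℚ[X] :=
  ∑ i ∈ Finset.range n, (X : ℚ[X]) ^ i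

/-- `qIntPoly n` and `qInt n` are the same rational function of the indeterminate. -/
theorem algebraMap_qIntPoly (n : ℕ) :
    algebraMap ℚ[X] (RatFunc ℚ) (qIntPoly n) = qInt (RatFunc.X : RatFunc ℚ) n := by
  have hX : (RatFunc.X : RatFunc ℚ) ≠ 1 := by
    intro h
    rw [← RatFunc.algebraMap_X, ← map_one (algebraMap ℚ[X] (RatFunc ℚ))] at h
    exact Polynomial.X_ne_C (1 : ℚ) (by simpa using RatFunc.algebraMap_injective ℚ h)
  unfold qIntPoly qInt
  rw [map_sum, eq_div_iff (sub_ne_zero.mpr hX.symm)]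
  simp only [map_pow, RatFunc.algebraMap_X]
  exact geom_sum_mul_neg _ _

/-- Congruence of rational functions modulo a polynomial: `P` divides the numerator of `A - B`,
written in lowest terms. -/
def RatCongr (P : ℚ[X]) (A B : RatFunc ℚ) : Prop :=
  P ∣ (A - B).num

/-- `B(n,q) = (n² - 1)(1 - q)² / 24 + ∑_{k=1}^{(n-1)/4} q^(4k-2) / [4k-2]²`. -/
def swisherB {K : Type*} [Field K] (q : K) (n : ℕ) : K :=
  ((n : K) ^ 2 - 1) * (1 - q) ^ 2 / 24 +
    ∑ k ∈ Finset.Icc 1 ((n - 1) / 4), q ^ (4 * k - 2) / qInt q (4 * k - 2) ^ 2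

/-- The closed form
`(q²;q⁴)_{(n-1)/4} / (q⁴;q⁴)_{(n-1)/4} · [n] q^((1-n)/4) {1 + [n]² B(n,q)}`. -/
def swisherClosed {K : Type*} [Field K] (q : K) (n : ℕ) : K :=
  qPoch (q ^ 2) (q ^ 4) ((n - 1) / 4) / qPoch (q ^ 4) (q ^ 4) ((n - 1) / 4) *
    qInt q n * q ^ ((1 - (n : ℤ)) / 4) * (1 + qInt q n ^ 2 * swisherB q n)

/-! Since $[n]$ is the product of $\Phi_d$ over the divisors $d\ne1$ of $n$, the modulus
$[n]\Phi_n^3$ splits into coprime pieces: one factor $\Phi_d$ for each divisor $1<d<n$, and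
$\Phi_n^4$. Everything is checked at the corresponding valuations of $\mathbb{Q}(q)$. All five sums
are one very-well-poised series in base $p=q^4$ with parameters $q;b,c,uq,vq,wq$ at $u=v=w=1$, where
$b,c\in\{-q,0,\infty\}$. Writing $b=b_1/b_0$ projectively treats the limits $0$ and $\infty$ on the
same footing.

At $\Phi_n$, with $n=4m+1$: put $s=q^{-n}$, so that $sq=p^{-m}$ and $s-1$ vanishes to order one.
Whenever one of $u,v,w$ equals $s$, Watson's transformation (`sum_wpTerm`, from `q_saalschutz`,
`baileyPair` and `bailey_lemma`) evaluates the sum as $N\cdot R\cdot X$, where $N=[n]q^{-m}$,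
$R=(ps;p)_m(p/s;p)_m$ and $X$ is a balanced sum. The wanted point $(1,1,1)$ is reached by a third
difference through $(s,s,s)$, $(s,s,1)$, $(s,1,1)$. On the series side this difference is termwise a
cube of $O(s-1)$, and a fourth order is gained because the leading coefficients are antisymmetric
under $k\mapsto m-k$ modulo $\Phi_n$ and sum to zero (`val_third_diff_wpTerm`). On the balanced side
the third difference of $X$ has order three (`DiffIntegral.balSeq`), and $N$ supplies the fourth.
Finally $R\equiv(p;p)_m^2(1+[n]^2B(n,q))$ to third order (`val_prefactor`); the rational constant in
$B$ comes from $\sum_{j\ne0}\zeta^j/(1-\zeta^j)^2=-(n^2-1)/12$.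

At $\Phi_d$ for a divisor $d>1$ only divisibility of each side is needed. The series falls into
blocks of length $d$ whose residues are proportional to one antisymmetric block, hence cancel
(`val_sum_wpTerm_lt`). The closed form carries the factor $[n]$, and the rest is integral
(`val_closed_lt`). For $M=n-1$ the extra terms contain $(1-q^n)^4$ (`val_wpTerm_tail`). -/

section Identities

variable {K : Type*} [Field K]

/-! ### Shifted factorials, the $q$-Saalschütz sum and a Bailey pair. -/

theorem qPoch_zero (a p : K) : qPoch a p 0 = 1 := by simp [qPoch]

theorem qPoch_succ (a p : K) (k : ℕ) : qPoch a p (k + 1) = qPoch a p k * (1 - a * p ^ k) := by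
  simp [qPoch, Finset.prod_range_succ]

theorem qPoch_add (a p : K) (k l : ℕ) :
    qPoch a p (k + l) = qPoch a p k * qPoch (a * p ^ k) p l := by
  simp only [qPoch, Finset.prod_range_add]
  congr 1
  exact Finset.prod_congr rfl fun i _ => by ring

theorem qPoch_ne_zero {a p : K} {k : ℕ} (h : ∀ i < k, 1 - a * p ^ i ≠ 0) : qPoch a p k ≠ 0 :=
  Finset.prod_ne_zero_iff.mpr fun i hi => h i (Finset.mem_range.mp hi)

theorem qPoch_reflect (a p : K) {m r : ℕ} (h : r ≤ m) :
    qPoch a p m = qPoch a p (m - r) * ∏ i ∈ Finset.range r, (1 - a * p ^ (m - 1 - i)) := by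
  obtain ⟨l, rfl⟩ := Nat.exists_eq_add_of_le' h
  rw [qPoch_add, Nat.add_sub_cancel,
    ← Finset.prod_range_reflect (fun i => 1 - a * p ^ (l + r - 1 - i)), qPoch, qPoch]
  congr 1
  refine Finset.prod_congr rfl fun i hi => ?_
  have := Finset.mem_range.mp hi
  rw [mul_assoc, ← pow_add, show l + r - 1 - (r - 1 - i) = l + i by omega]

/-- The summand of the `q`-Saalschütz sum. -/
def saalTerm (p A B C z : K) (j l : ℕ) : K :=
  qPoch A p j * qPoch B p j * qPoch z p l * z ^ j / (qPoch p p j * qPoch p p l * qPoch C p j)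

/-- A Zeilberger-style certificate for the first-order recurrence of the Saalschütz sum. With
$N=J+l$ the combination of the summands at $N+1$ and $N$ telescopes in $j$. Keeping $l$ free lets
$J$ grow at fixed $N$ during the induction. -/
theorem saalTerm_partial {p : K} (hp : ∀ i, 1 - p * p ^ i ≠ 0) {A B C z : K}
    (hABC : C = A * B * z) (hC : ∀ i, 1 - C * p ^ i ≠ 0) (J l : ℕ) :
    ∑ j ∈ Finset.range (J + 1),
      ((1 - p * p ^ (J + l)) * (1 - C * p ^ (J + l)) * saalTerm p A B C z j (J + l + 1 - j) -
        (1 - A * z * p ^ (J + l)) * (1 - B * z * p ^ (J + l)) * saalTerm p A B C z j (J + l - j)) =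
      -(p ^ l * z * (1 - A * p ^ J) * (1 - B * p ^ J) * saalTerm p A B C z J l) := by
  have hP : ∀ k, qPoch p p k ≠ 0 := fun k => qPoch_ne_zero fun i _ => hp i
  have hQ : ∀ k, qPoch C p k ≠ 0 := fun k => qPoch_ne_zero fun i _ => hC i
  induction J generalizing l with
  | zero =>
    have h1 := hP l
    have h2 := hp l
    simp only [zero_add, Finset.sum_range_one, saalTerm, qPoch_zero, Nat.sub_zero, qPoch_succ,
      pow_zero]
    generalize qPoch p p l = P at *
    generalize p ^ l = y at *
    field_simp
    rw [hABC]
    ring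
  | succ J ih =>
    have e : J + 1 + l = J + (l + 1) := by ring
    rw [Finset.sum_range_succ, e, ih (l + 1)]
    have e1 : J + (l + 1) + 1 - (J + 1) = l + 1 := by omega
    have e2 : J + (l + 1) - (J + 1) = l := by omega
    rw [e1, e2]
    have h1 := hP l
    have h2 := hp l
    have h3 := hP J
    have h4 := hp J
    have h5 := hQ J
    have h6 := hC J
    simp only [saalTerm, qPoch_succ, pow_add, pow_one]
    generalize qPoch p p l = P at *
    generalize qPoch p p J = P' at *
    generalize qPoch C p J = Q at *
    generalize p ^ l = y at *
    generalize p ^ J = x at *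
    generalize hD₂ : 1 - p * y = D₂ at *
    generalize hD₄ : 1 - p * x = D₄ at *
    generalize hD₆ : 1 - C * x = D₆ at *
    field_simp
    rw [← hD₂, ← hD₄, ← hD₆, hABC]
    ring

theorem q_saalschutz {p : K} (hp : ∀ i, 1 - p * p ^ i ≠ 0) {A B C z : K}
    (hABC : C = A * B * z) (hC : ∀ i, 1 - C * p ^ i ≠ 0) (n : ℕ) :
    ∑ j ∈ Finset.range (n + 1), saalTerm p A B C z j (n - j) =
      qPoch (A * z) p n * qPoch (B * z) p n / (qPoch p p n * qPoch C p n) := by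
  have hP : ∀ k, qPoch p p k ≠ 0 := fun k => qPoch_ne_zero fun i _ => hp i
  have hQ : ∀ k, qPoch C p k ≠ 0 := fun k => qPoch_ne_zero fun i _ => hC i
  induction n with
  | zero => simp [saalTerm, qPoch_zero]
  | succ n ih =>
    -- At $l=0$ the sum covers all $j\le n$; the only missing term of the longer sum is $j=n+1$, and
    -- it absorbs the remainder.
    have h := saalTerm_partial hp hABC hC n 0
    simp only [add_zero, pow_zero, one_mul] at h
    rw [Finset.sum_sub_distrib, ← Finset.mul_sum, ← Finset.mul_sum, ih] at h
    rw [Finset.sum_range_succ, Nat.sub_self]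
    have h1 := hp n
    have h2 := hC n
    have h3 := hP n
    have h4 := hQ n
    have hS := eq_add_of_sub_eq h
    generalize ∑ j ∈ Finset.range (n + 1), saalTerm p A B C z j (n + 1 - j) = S at hS ⊢
    have hD := mul_ne_zero h1 h2
    rw [mul_comm, ← eq_div_iff hD] at hS
    rw [hS]
    simp only [saalTerm, qPoch_succ, qPoch_zero, pow_succ]
    generalize qPoch p p n = P at *
    generalize qPoch C p n = Q at *
    generalize p ^ n = x at *
    generalize hD₁ : 1 - p * x = D₁ at *
    generalize hD₂ : 1 - C * x = D₂ at *
    field_simp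
    ring

/-- `(b)_k (c)_k / ((a p / b)_k (a p / c)_k) · (b c)^{-k}` for `b = b₁ / b₀` and `c = c₁ / c₀`. -/
def wpWeight (a p b₀ b₁ c₀ c₁ : K) (k : ℕ) : K :=
  ∏ i ∈ Finset.range k, (b₀ - b₁ * p ^ i) * (c₀ - c₁ * p ^ i) /
    ((b₁ - a * b₀ * p ^ (i + 1)) * (c₁ - a * c₀ * p ^ (i + 1)))

/-- `(a p / b c)_k / ((a p / b)_k (a p / c)_k)` for `b = b₁ / b₀` and `c = c₁ / c₀`. -/
def balWeight (a p b₀ b₁ c₀ c₁ : K) (k : ℕ) : K :=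
  ∏ i ∈ Finset.range k, (b₁ * c₁ - a * b₀ * c₀ * p ^ (i + 1)) /
    ((b₁ - a * b₀ * p ^ (i + 1)) * (c₁ - a * c₀ * p ^ (i + 1)))

/-- The `α`-component of the Bailey pair relative to `a` with parameters `b`, `c`. -/
def baileyAlpha (a p b₀ b₁ c₀ c₁ : K) (r : ℕ) : K :=
  (1 - a * p ^ (2 * r)) / (1 - a) * (qPoch a p r / qPoch p p r) *
    (∏ i ∈ Finset.range r, -(a * p ^ (i + 1))) * wpWeight a p b₀ b₁ c₀ c₁ r

theorem wpWeight_succ (a p b₀ b₁ c₀ c₁ : K) (k : ℕ) :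
    wpWeight a p b₀ b₁ c₀ c₁ (k + 1) = wpWeight a p b₀ b₁ c₀ c₁ k *
      ((b₀ - b₁ * p ^ k) * (c₀ - c₁ * p ^ k) /
        ((b₁ - a * b₀ * p ^ (k + 1)) * (c₁ - a * c₀ * p ^ (k + 1)))) :=
  Finset.prod_range_succ _ _

theorem balWeight_succ (a p b₀ b₁ c₀ c₁ : K) (k : ℕ) :
    balWeight a p b₀ b₁ c₀ c₁ (k + 1) = balWeight a p b₀ b₁ c₀ c₁ k *
      ((b₁ * c₁ - a * b₀ * c₀ * p ^ (k + 1)) /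
        ((b₁ - a * b₀ * p ^ (k + 1)) * (c₁ - a * c₀ * p ^ (k + 1)))) :=
  Finset.prod_range_succ _ _

theorem baileyAlpha_succ {a p : K} (b₀ b₁ c₀ c₁ : K) (r : ℕ) (ha : 1 - a * p ^ (2 * r) ≠ 0) :
    baileyAlpha a p b₀ b₁ c₀ c₁ (r + 1) = baileyAlpha a p b₀ b₁ c₀ c₁ r *
      ((1 - a * p ^ (2 * r + 2)) / (1 - a * p ^ (2 * r)) *
        ((1 - a * p ^ r) / (1 - p * p ^ r)) * -(a * p ^ (r + 1)) *
      ((b₀ - b₁ * p ^ r) * (c₀ - c₁ * p ^ r) /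
        ((b₁ - a * b₀ * p ^ (r + 1)) * (c₁ - a * c₀ * p ^ (r + 1))))) := by
  simp only [baileyAlpha, wpWeight_succ, qPoch_succ, Finset.prod_range_succ,
    show 2 * (r + 1) = 2 * r + 2 by ring]
  generalize wpWeight a p b₀ b₁ c₀ c₁ r = W
  generalize (∏ i ∈ Finset.range r, -(a * p ^ (i + 1))) = V
  generalize ((b₀ - b₁ * p ^ r) * (c₀ - c₁ * p ^ r) /
        ((b₁ - a * b₀ * p ^ (r + 1)) * (c₁ - a * c₀ * p ^ (r + 1)))) = Y
  rw [mul_div_mul_comm]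
  generalize (1 - a * p ^ r) / (1 - p * p ^ r) = Z
  generalize qPoch a p r / qPoch p p r = Q
  field_simp

/-- Telescoping certificate for the recurrence in $N=R+l$ satisfied by the Bailey transform of
`baileyAlpha`; the scheme is that of `saalTerm_partial`. -/
theorem baileyAlpha_partial {a p : K} (hp : ∀ i, 1 - p * p ^ i ≠ 0) (ha : ∀ i, 1 - a * p ^ i ≠ 0)
    {b₀ b₁ c₀ c₁ : K} (hb : ∀ i, b₁ - a * b₀ * p ^ (i + 1) ≠ 0)
    (hc : ∀ i, c₁ - a * c₀ * p ^ (i + 1) ≠ 0) (R l : ℕ) :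
    ∑ r ∈ Finset.range (R + 1),
      ((1 - p * p ^ (R + l)) * (b₁ - a * b₀ * p ^ (R + l + 1)) * (c₁ - a * c₀ * p ^ (R + l + 1)) *
        (baileyAlpha a p b₀ b₁ c₀ c₁ r /
          (qPoch p p (R + l + 1 - r) * qPoch (a * p) p (R + l + 1 + r))) -
        (b₁ * c₁ - a * b₀ * c₀ * p ^ (R + l + 1)) * (baileyAlpha a p b₀ b₁ c₀ c₁ r /
          (qPoch p p (R + l - r) * qPoch (a * p) p (R + l + r)))) =
      baileyAlpha a p b₀ b₁ c₀ c₁ R / (qPoch p p l * qPoch (a * p) p (R + l + R)) *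
        (a * p ^ (R + l + 1) * (1 - a * p ^ R) * (b₀ - b₁ * p ^ R) * (c₀ - c₁ * p ^ R)) /
          ((1 - a * p ^ (2 * R)) * (1 - a * p * p ^ (R + l + R))) := by
  have hP : ∀ k, qPoch p p k ≠ 0 := fun k => qPoch_ne_zero fun i _ => hp i
  have ha' : ∀ i, 1 - a * p * p ^ i ≠ 0 := fun i => by
    have := ha (i + 1); rwa [pow_succ', ← mul_assoc] at this
  have hQ : ∀ k, qPoch (a * p) p k ≠ 0 := fun k => qPoch_ne_zero fun i _ => ha' i
  induction R generalizing l with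
  | zero =>
    have h1 := hP l
    have h2 := hp l
    have h3 := hQ l
    have h4 := ha' l
    have h5 : 1 - a ≠ 0 := by simpa using ha 0
    simp only [zero_add, Finset.sum_range_one, baileyAlpha, wpWeight, qPoch_zero, Nat.sub_zero,
      qPoch_succ, pow_zero, Finset.prod_range_zero, mul_zero, add_zero, pow_add, pow_one]
    generalize qPoch p p l = P at *
    generalize qPoch (a * p) p l = Q at *
    generalize p ^ l = y at *
    generalize hD₂ : 1 - p * y = D₂ at *
    generalize hD₄ : 1 - a * p * y = D₄ at *
    field_simp
    rw [← hD₄]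
    ring
  | succ R ih =>
    have e : R + 1 + l = R + (l + 1) := by ring
    rw [Finset.sum_range_succ, e, ih (l + 1)]
    have e1 : R + (l + 1) + 1 - (R + 1) = l + 1 := by omega
    have e2 : R + (l + 1) - (R + 1) = l := by omega
    have e3 : R + (l + 1) + 1 + (R + 1) = (R + l + R) + 1 + 1 + 1 := by ring
    have e4 : R + (l + 1) + (R + 1) = (R + l + R) + 1 + 1 := by ring
    have e5 : R + (l + 1) + R = (R + l + R) + 1 := by ring
    have e6 : 2 * (R + 1) = 2 * R + 2 := by ring
    rw [e1, e2, e3, e4, e5, e6]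
    have h1 := hP l
    have h2 := hp l
    have h3 := hp R
    have h4 := hQ (R + l + R)
    have h5 := ha' (R + l + R)
    have h6 := ha' (R + l + R + 1)
    have h7 := ha' (R + l + R + 1 + 1)
    have h8 := hb R
    have h9 := hc R
    have h10 := ha (2 * R)
    have h11 := ha (2 * R + 2)
    rw [baileyAlpha_succ _ _ _ _ _ h10]
    simp only [qPoch_succ]
    clear ih hb hc hQ hP ha hp ha' e e1 e2 e3 e4 e5 e6
    generalize baileyAlpha a p b₀ b₁ c₀ c₁ R = α
    generalize qPoch p p l = P at *
    generalize qPoch (a * p) p (R + l + R) = Q at *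
    generalize hD₂ : 1 - p * p ^ l = D₂ at *
    generalize hD₃ : 1 - p * p ^ R = D₃ at *
    generalize hD₅ : 1 - a * p * p ^ (R + l + R) = D₅ at *
    generalize hD₆ : 1 - a * p * p ^ (R + l + R + 1) = D₆ at *
    generalize hD₇ : 1 - a * p * p ^ (R + l + R + 1 + 1) = D₇ at *
    generalize hD₈ : b₁ - a * b₀ * p ^ (R + 1) = D₈ at *
    generalize hD₉ : c₁ - a * c₀ * p ^ (R + 1) = D₉ at *
    generalize hD₁₀ : 1 - a * p ^ (2 * R) = D₁₀ at *
    generalize hD₁₁ : 1 - a * p ^ (2 * R + 2) = D₁₁ at *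
    simp only [pow_add, pow_mul', pow_one] at *
    generalize p ^ R = x at *
    generalize p ^ l = y at *
    field_simp
    simp only [← hD₂, ← hD₃, ← hD₇, ← hD₈, ← hD₉, ← hD₁₁]
    ring

theorem baileyPair {a p : K} (hp : ∀ i, 1 - p * p ^ i ≠ 0) (ha : ∀ i, 1 - a * p ^ i ≠ 0)
    {b₀ b₁ c₀ c₁ : K} (hb : ∀ i, b₁ - a * b₀ * p ^ (i + 1) ≠ 0)
    (hc : ∀ i, c₁ - a * c₀ * p ^ (i + 1) ≠ 0) (n : ℕ) :
    ∑ r ∈ Finset.range (n + 1), baileyAlpha a p b₀ b₁ c₀ c₁ r /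
      (qPoch p p (n - r) * qPoch (a * p) p (n + r)) =
      balWeight a p b₀ b₁ c₀ c₁ n / qPoch p p n := by
  have hP : ∀ k, qPoch p p k ≠ 0 := fun k => qPoch_ne_zero fun i _ => hp i
  have ha' : ∀ i, 1 - a * p * p ^ i ≠ 0 := fun i => by
    have := ha (i + 1); rwa [pow_succ', ← mul_assoc] at this
  have hQ : ∀ k, qPoch (a * p) p k ≠ 0 := fun k => qPoch_ne_zero fun i _ => ha' i
  induction n with
  | zero =>
    have h5 : 1 - a ≠ 0 := by simpa using ha 0
    simp [baileyAlpha, wpWeight, balWeight, qPoch_zero, h5]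
  | succ n ih =>
    have h := baileyAlpha_partial hp ha hb hc n 0
    simp only [add_zero] at h
    rw [Finset.sum_sub_distrib, ← Finset.mul_sum, ← Finset.mul_sum, ih] at h
    rw [Finset.sum_range_succ, Nat.sub_self]
    have h1 := hp n
    have h2 := hb n
    have h3 := hc n
    have h4 := hP n
    have h5 := hQ (n + n)
    have h6 := ha' (n + n)
    have h7 := ha' (n + n + 1)
    have h8 := ha (2 * n)
    have hS := eq_add_of_sub_eq h
    generalize ∑ r ∈ Finset.range (n + 1), baileyAlpha a p b₀ b₁ c₀ c₁ r /
      (qPoch p p (n + 1 - r) * qPoch (a * p) p (n + 1 + r)) = S at hS ⊢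
    have hD := mul_ne_zero (mul_ne_zero h1 h2) h3
    rw [mul_comm, ← eq_div_iff hD] at hS
    rw [hS, baileyAlpha_succ _ _ _ _ _ h8, balWeight_succ,
      show n + 1 + (n + 1) = n + n + 1 + 1 by ring]
    simp only [qPoch_succ, qPoch_zero]
    clear ih hb hc hQ hP ha hp ha' h hS
    generalize baileyAlpha a p b₀ b₁ c₀ c₁ n = α
    generalize balWeight a p b₀ b₁ c₀ c₁ n = β
    generalize qPoch p p n = P at *
    generalize qPoch (a * p) p (n + n) = Q at *
    generalize hD₁ : 1 - p * p ^ n = D₁ at *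
    generalize hD₂ : b₁ - a * b₀ * p ^ (n + 1) = D₂ at *
    generalize hD₃ : c₁ - a * c₀ * p ^ (n + 1) = D₃ at *
    generalize hD₆ : 1 - a * p * p ^ (n + n) = D₆ at *
    generalize hD₇ : 1 - a * p * p ^ (n + n + 1) = D₇ at *
    generalize hD₈ : 1 - a * p ^ (2 * n) = D₈ at *
    simp only [pow_add, pow_mul', pow_one] at *
    generalize p ^ n = x at *
    field_simp
    simp only [← hD₆, ← hD₇, ← hD₈]
    ring

end Identities

/-! ### Bailey's lemma and Watson's transformation. -/

section Watson

variable {K : Type*} [Field K]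

/-- After interchanging the two sums, the inner one is a $q$-Saalschütz sum with parameters shifted
by $p^r$; the condition on $z$ is exactly its balancing condition. -/
theorem bailey_lemma {a p d e z : K} (hp : ∀ i, 1 - p * p ^ i ≠ 0) (ha : ∀ i, 1 - a * p ^ i ≠ 0)
    (hz : d * e * z = a * p) {α β : ℕ → K} (hβ : ∀ k, ∑ r ∈ Finset.range (k + 1),
      α r / (qPoch p p (k - r) * qPoch (a * p) p (k + r)) = β k) (m : ℕ) :
    ∑ k ∈ Finset.range (m + 1), qPoch d p k * qPoch e p k * qPoch z p (m - k) * z ^ k /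
        qPoch p p (m - k) * β k =
      ∑ r ∈ Finset.range (m + 1), α r * (qPoch d p r * qPoch e p r * z ^ r *
        (qPoch (d * p ^ r * z) p (m - r) * qPoch (e * p ^ r * z) p (m - r)) /
          (qPoch p p (m - r) * qPoch (a * p) p (m + r))) := by
  have ha' : ∀ i, 1 - a * p * p ^ i ≠ 0 := fun i => by
    have := ha (i + 1); rwa [pow_succ', ← mul_assoc] at this
  have hQ : ∀ k, qPoch (a * p) p k ≠ 0 := fun k => qPoch_ne_zero fun i _ => ha' i
  simp only [← hβ, Finset.mul_sum]
  rw [Finset.sum_comm' (t' := Finset.range (m + 1)) (s' := fun r => Finset.Ico r (m + 1))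
    (by intro x y; simp only [Finset.mem_range, Finset.mem_Ico]; omega)]
  refine Finset.sum_congr rfl fun r hr => ?_
  have hrm : r ≤ m := by have := Finset.mem_range.mp hr; omega
  rw [Finset.sum_Ico_eq_sum_range, show m + 1 - r = (m - r) + 1 by omega]
  have hABC : a * p * p ^ (2 * r) = d * p ^ r * (e * p ^ r) * z := by rw [← hz]; ring
  have hC : ∀ i, 1 - a * p * p ^ (2 * r) * p ^ i ≠ 0 := fun i => by
    rw [mul_assoc, ← pow_add]; exact ha' _
  have hS := q_saalschutz hp hABC hC (m - r)
  have h2 : qPoch (a * p) p (m + r) =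
      qPoch (a * p) p (2 * r) * qPoch (a * p * p ^ (2 * r)) p (m - r) := by
    rw [← qPoch_add]; congr 1; omega
  calc _ = α r * (qPoch d p r * qPoch e p r * z ^ r) / qPoch (a * p) p (2 * r) *
        ∑ j ∈ Finset.range (m - r + 1),
          saalTerm p (d * p ^ r) (e * p ^ r) (a * p * p ^ (2 * r)) z j (m - r - j) := by
        rw [Finset.mul_sum]
        refine Finset.sum_congr rfl fun j hj => ?_
        rw [show r + j + r = 2 * r + j by ring, show m - (r + j) = m - r - j by omega,
          show r + j - r = j by omega, qPoch_add d, qPoch_add e, qPoch_add (a * p), pow_add z]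
        unfold saalTerm
        ring
    _ = _ := by
        rw [hS, h2]
        ring

/-- `(u q; p)_k / (p / u; p)_k · u^{-k}`. -/
def wpRatio (q p u : K) (k : ℕ) : K :=
  ∏ i ∈ Finset.range k, (1 - u * q * p ^ i) / (u - p ^ (i + 1))

/-- The summand of a very-well-poised series with parameters `q; b, c, u q, v q, w q`. -/
def wpTerm (q p b₀ b₁ c₀ c₁ u v w : K) (k : ℕ) : K :=
  (1 - q * p ^ (2 * k)) / (1 - q) * ((p ^ 2 / q) ^ k * wpWeight q p b₀ b₁ c₀ c₁ k) *
    wpRatio q p 1 k * (wpRatio q p u k * wpRatio q p v k * wpRatio q p w k)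

/-- The balanced sum corresponding to `wpTerm` under Watson's transformation. -/
def balSum (q p b₀ b₁ c₀ c₁ : K) (m : ℕ) (u v w : K) : K :=
  ∑ k ∈ Finset.range (m + 1), p ^ k * balWeight q p b₀ b₁ c₀ c₁ k / qPoch p p k *
    (qPoch (u * q) p k * qPoch (v * q) p k * qPoch (w * q) p k) *
    (∏ i ∈ Finset.Ico k m, (1 - q ^ 2 * (u * v * w) * p ^ i)) /
    ((∏ i ∈ Finset.range m, (u - p ^ (i + 1))) * (∏ i ∈ Finset.range m, (v - p ^ (i + 1))) *
      (∏ i ∈ Finset.range m, (w - p ^ (i + 1))))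

theorem qPoch_div_eq {p u : K} (hu : u ≠ 0) (k : ℕ) :
    qPoch (p / u) p k = (∏ i ∈ Finset.range k, (u - p ^ (i + 1))) / u ^ k := by
  rw [qPoch, eq_div_iff (pow_ne_zero _ hu), ← Finset.card_range k, ← Finset.prod_const,
    Finset.card_range, ← Finset.prod_mul_distrib]
  refine Finset.prod_congr rfl fun i _ => ?_
  field_simp
  ring

/-- Since $sq=p^{-m}$, the last $k$ factors of $(p;p)_m$ are, up to monomials, the factors of
$(sq;p)_k$. The two reversals that follow likewise pair factors $1-x$ and $1-x^{-1}$. -/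
theorem qPoch_sub_mul {q p s : K} {m k : ℕ} (hs : q * s * p ^ m = 1) (hk : k ≤ m) :
    qPoch p p m * ((-(s * q)) ^ k * ∏ i ∈ Finset.range k, p ^ i) =
      qPoch p p (m - k) * qPoch (s * q) p k := by
  have h : (-(s * q)) ^ k * ∏ i ∈ Finset.range k, p ^ i =
      ∏ i ∈ Finset.range k, (-(s * q) * p ^ i) := by
    rw [Finset.prod_mul_distrib, Finset.prod_const, Finset.card_range]
  rw [qPoch_reflect p p hk, mul_assoc, h, ← Finset.prod_mul_distrib]
  refine congrArg _ (Finset.prod_congr rfl fun i hi => ?_)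
  have him := Finset.mem_range.mp hi
  have h1 : s * q * p ^ i * (p * p ^ (m - 1 - i)) = 1 := by
    rw [← hs, show m = i + 1 + (m - 1 - i) by omega]
    simp only [show i + 1 + (m - 1 - i) - 1 - i = m - 1 - i by omega]
    ring
  linear_combination h1

theorem qPoch_reverse {q p s y z : K} {m k : ℕ} (hs : q * s * p ^ m = 1) (hk : k ≤ m)
    (hz : q * y * z = p) (hp : p ≠ 0) :
    qPoch z p (m - k) * ((-(q ^ 2 * (s * y))) ^ m * ∏ i ∈ Finset.range m, p ^ i) =
      (∏ i ∈ Finset.Ico k m, (1 - q ^ 2 * (s * y) * p ^ i)) *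
        ((-(q ^ 2 * (s * y))) ^ k * ∏ i ∈ Finset.range k, p ^ i) := by
  have h : ∀ j, (-(q ^ 2 * (s * y))) ^ j * ∏ i ∈ Finset.range j, p ^ i =
      ∏ i ∈ Finset.range j, (-(q ^ 2 * (s * y)) * p ^ i) := fun j => by
    rw [Finset.prod_mul_distrib, Finset.prod_const, Finset.card_range]
  rw [h, h, ← Finset.prod_range_mul_prod_Ico _ hk, mul_left_comm, mul_comm (∏ i ∈ Finset.Ico k m, _)]
  refine congrArg _ ?_
  rw [qPoch, ← Finset.prod_range_reflect, Finset.prod_Ico_eq_prod_range,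
    Finset.prod_Ico_eq_prod_range, ← Finset.prod_mul_distrib]
  refine Finset.prod_congr rfl fun i hi => ?_
  have him := Finset.mem_range.mp hi
  have h1 : q ^ 2 * (s * y) * p ^ (k + i) * (z * p ^ (m - k - 1 - i)) = 1 := by
    apply mul_right_cancel₀ hp
    calc _ = (q * s * (p ^ (k + i) * p ^ (m - k - 1 - i) * p)) * (q * y * z) := by ring
      _ = _ := by
        rw [← pow_add, ← pow_succ, show k + i + (m - k - 1 - i) + 1 = m by omega, hs, hz]
  linear_combination h1

theorem qPoch_self_shift {q p s : K} {m : ℕ} (hs : q * s * p ^ m = 1) :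
    qPoch q p m * ((-(p * s)) ^ m * ∏ i ∈ Finset.range m, p ^ i) = qPoch (p * s) p m := by
  have h : (-(p * s)) ^ m * ∏ i ∈ Finset.range m, p ^ i =
      ∏ i ∈ Finset.range m, (-(p * s) * p ^ i) := by
    rw [Finset.prod_mul_distrib, Finset.prod_const, Finset.card_range]
  rw [h, qPoch, qPoch, ← Finset.prod_range_reflect, ← Finset.prod_mul_distrib]
  refine Finset.prod_congr rfl fun i hi => ?_
  have him := Finset.mem_range.mp hi
  have h1 : p * s * p ^ i * (q * p ^ (m - 1 - i)) = 1 := by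
    calc _ = q * s * (p ^ i * p ^ (m - 1 - i) * p) := by ring
      _ = _ := by
        rw [← pow_add, ← pow_succ, show i + (m - 1 - i) + 1 = m by omega, hs]
  linear_combination h1

theorem prod_pow_range_sq (p : K) (m : ℕ) :
    (∏ i ∈ Finset.range m, p ^ i) ^ 2 * p ^ m = p ^ (m * m) := by
  induction m with
  | zero => simp
  | succ m ih =>
    rw [Finset.prod_range_succ, mul_pow, show (m + 1) * (m + 1) = m * m + 2 * m + 1 by ring]
    linear_combination (exp := 1) p ^ (2 * m) * p * ih

theorem wpRatio_eq {q p u : K} (k : ℕ) :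
    wpRatio q p u k = qPoch (u * q) p k / ∏ i ∈ Finset.range k, (u - p ^ (i + 1)) := by
  rw [wpRatio, Finset.prod_div_distrib, qPoch]

theorem wpRatio_one {q p : K} (k : ℕ) : wpRatio q p 1 k = qPoch q p k / qPoch p p k := by
  rw [wpRatio_eq, one_mul, qPoch, qPoch]
  simp only [pow_succ']

/-- Watson's transformation, with the terminating parameter `s q = p^{-m}`. -/
theorem sum_wpTerm {q p : K} (hq : q ≠ 0) (hp0 : p ≠ 0) (hp : ∀ i, 1 - p * p ^ i ≠ 0)
    (ha : ∀ i, 1 - q * p ^ i ≠ 0) {b₀ b₁ c₀ c₁ : K} (hb : ∀ i, b₁ - q * b₀ * p ^ (i + 1) ≠ 0)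
    (hc : ∀ i, c₁ - q * c₀ * p ^ (i + 1) ≠ 0) {m : ℕ} {s v w : K} (hs : q * s * p ^ m = 1)
    (hv0 : v ≠ 0) (hw0 : w ≠ 0) (hs' : ∀ i < m, s - p ^ (i + 1) ≠ 0)
    (hv : ∀ i < m, v - p ^ (i + 1) ≠ 0) (hw : ∀ i < m, w - p ^ (i + 1) ≠ 0) :
    ∑ k ∈ Finset.range (m + 1), wpTerm q p b₀ b₁ c₀ c₁ s v w k =
      (1 - q * p ^ m) / (1 - q) * (q ^ m)⁻¹ * (qPoch (p * s) p m * qPoch (p / s) p m) *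
        balSum q p b₀ b₁ c₀ c₁ m s v w := by
  have hs0 : s ≠ 0 := by rintro rfl; simp at hs
  have ha' : ∀ i, 1 - q * p * p ^ i ≠ 0 := fun i => by
    have := ha (i + 1); rwa [pow_succ', ← mul_assoc] at this
  have h1q : 1 - q ≠ 0 := by simpa using ha 0
  have hP : ∀ k, qPoch p p k ≠ 0 := fun k => qPoch_ne_zero fun i _ => hp i
  have hQ : ∀ k, qPoch (q * p) p k ≠ 0 := fun k => qPoch_ne_zero fun i _ => ha' i
  have hτ : ∀ k, (∏ i ∈ Finset.range k, p ^ i) ≠ 0 := fun k =>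
    Finset.prod_ne_zero_iff.mpr fun i _ => pow_ne_zero _ hp0
  have hD : ∀ {u : K}, (∀ i < m, u - p ^ (i + 1) ≠ 0) → ∀ k ≤ m,
      (∏ i ∈ Finset.range k, (u - p ^ (i + 1))) ≠ 0 := fun h k hk =>
    Finset.prod_ne_zero_iff.mpr fun i hi => h i ((Finset.mem_range.mp hi).trans_le hk)
  set z := p / (q * (v * w)) with hz
  have hz' : q * (v * w) * z = p := by rw [hz]; field_simp
  -- The parameters $vq$ and $wq$ enter through Bailey's lemma. The terminating one, $sq=p^{-m}$,
  -- comes from the kernel $1/((p)_{m-r}(qp)_{m+r})$.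
  have hB := bailey_lemma (d := v * q) (e := w * q) (z := z) hp ha
    (by rw [← hz']; ring) (baileyPair hp ha hb hc) m
  have hL : ∀ k ∈ Finset.range (m + 1),
      qPoch (v * q) p k * qPoch (w * q) p k * qPoch z p (m - k) * z ^ k / qPoch p p (m - k) *
        (balWeight q p b₀ b₁ c₀ c₁ k / qPoch p p k) =
      (qPoch p p m * ((-(q ^ 2 * (s * (v * w)))) ^ m * ∏ i ∈ Finset.range m, p ^ i))⁻¹ *
        (p ^ k * balWeight q p b₀ b₁ c₀ c₁ k / qPoch p p k *
        (qPoch (s * q) p k * qPoch (v * q) p k * qPoch (w * q) p k) *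
        (∏ i ∈ Finset.Ico k m, (1 - q ^ 2 * (s * v * w) * p ^ i))) := by
    intro k hk
    have hkm : k ≤ m := by have := Finset.mem_range.mp hk; omega
    have e1 := qPoch_sub_mul hs hkm
    have e2 := qPoch_reverse hs hkm hz' hp0
    rw [mul_assoc s v w]
    have t1 := hτ k
    have t2 := hτ m
    have n1 := hP m
    have n2 := hP (m - k)
    have n3 : (-(q ^ 2 * (s * (v * w)))) ^ m ≠ 0 := pow_ne_zero _ (by simp [*])
    have n4 : (-(s * q)) ^ k ≠ 0 := pow_ne_zero _ (by simp [*])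
    rw [← mul_assoc, ← eq_div_iff t2, ← eq_div_iff n3] at e2
    have e3 : qPoch (s * q) p k = qPoch p p m * ((-(s * q)) ^ k * ∏ i ∈ Finset.range k, p ^ i) /
      qPoch p p (m - k) := by rw [e1]; field_simp
    have e4 : (-(q ^ 2 * (s * (v * w)))) ^ k * z ^ k = (-(s * q)) ^ k * p ^ k := by
      rw [← mul_pow, ← mul_pow, ← hz']; ring
    rw [e2, e3]
    generalize ∏ i ∈ Finset.range k, p ^ i = τ at *
    generalize (-(q ^ 2 * (s * (v * w)))) ^ k = x₁ at *
    generalize (-(s * q)) ^ k = x₂ at *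
    generalize z ^ k = x₃ at *
    generalize p ^ k = x₄ at *
    generalize (-(q ^ 2 * (s * (v * w)))) ^ m = x₅ at *
    generalize ∏ i ∈ Finset.Ico k m, (1 - q ^ 2 * (s * (v * w)) * p ^ i) = I at *
    rw [mul_div_assoc x₄]
    generalize balWeight q p b₀ b₁ c₀ c₁ k / qPoch p p k = β
    generalize ∏ i ∈ Finset.range m, p ^ i = τ' at *
    generalize qPoch p p m = P at *
    generalize qPoch p p (m - k) = P' at *
    generalize qPoch (v * q) p k = A₂
    generalize qPoch (w * q) p k = A₃
    field_simp
    linear_combination (A₂ * A₃ * I * β) * e4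
  have hR : ∀ r ∈ Finset.range (m + 1),
      baileyAlpha q p b₀ b₁ c₀ c₁ r * (qPoch (v * q) p r * qPoch (w * q) p r * z ^ r *
        (qPoch (v * q * p ^ r * z) p (m - r) * qPoch (w * q * p ^ r * z) p (m - r)) /
          (qPoch p p (m - r) * qPoch (q * p) p (m + r))) =
      qPoch (p / v) p m * qPoch (p / w) p m / (qPoch p p m * qPoch (q * p) p m) *
        wpTerm q p b₀ b₁ c₀ c₁ s v w r := by
    intro r hr
    have hrm : r ≤ m := by have := Finset.mem_range.mp hr; omega
    have e1 := qPoch_sub_mul hs hrm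
    have e2 : qPoch (v * q * p ^ r * z) p (m - r) = qPoch (p / w) p m / qPoch (p / w) p r := by
      have h0 : qPoch (p / w) p r ≠ 0 := by
        rw [qPoch_div_eq hw0]
        exact div_ne_zero (hD hw r hrm) (pow_ne_zero _ hw0)
      rw [eq_div_iff h0, mul_comm, show v * q * p ^ r * z = p / w * p ^ r by rw [hz]; field_simp,
        ← qPoch_add, Nat.add_sub_cancel' hrm]
    have e3 : qPoch (w * q * p ^ r * z) p (m - r) = qPoch (p / v) p m / qPoch (p / v) p r := by
      have h0 : qPoch (p / v) p r ≠ 0 := by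
        rw [qPoch_div_eq hv0]
        exact div_ne_zero (hD hv r hrm) (pow_ne_zero _ hv0)
      rw [eq_div_iff h0, mul_comm, show w * q * p ^ r * z = p / v * p ^ r by rw [hz]; field_simp,
        ← qPoch_add, Nat.add_sub_cancel' hrm]
    -- Here $qp\cdot p^m=p/s$, which supplies the well-poised partner of $sq$.
    have e4 : qPoch (q * p) p (m + r) = qPoch (q * p) p m * qPoch (p / s) p r := by
      rw [qPoch_add]
      congr 2
      rw [eq_div_iff hs0]
      linear_combination p * hs
    have e5 : ∏ i ∈ Finset.range r, -(q * p ^ (i + 1)) =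
        (-(q * p)) ^ r * ∏ i ∈ Finset.range r, p ^ i := by
      rw [← Finset.card_range r, ← Finset.prod_const, Finset.card_range,
        ← Finset.prod_mul_distrib]
      exact Finset.prod_congr rfl fun i _ => by ring
    have e6 : (-(q * p)) ^ r * (v ^ r * w ^ r * s ^ r * z ^ r) =
        (-(s * q)) ^ r * (p ^ 2 / q) ^ r := by
      simp only [← mul_pow]
      congr 1
      rw [hz]
      field_simp
    have t1 := hτ r
    have n1 := hP m
    have n2 := hP (m - r)
    have n4 : (-(s * q)) ^ r ≠ 0 := pow_ne_zero _ (by simp [*])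
    have e7 : qPoch p p (m - r) = qPoch p p m * ((-(s * q)) ^ r * ∏ i ∈ Finset.range r, p ^ i) /
      qPoch (s * q) p r := by
        rw [e1, mul_div_cancel_right₀]
        intro h
        rw [h, mul_zero] at e1
        exact mul_ne_zero n1 (mul_ne_zero n4 t1) e1
    unfold wpTerm baileyAlpha
    rw [e2, e3, e4, e5, e7, wpRatio_one, wpRatio_eq, wpRatio_eq, wpRatio_eq, qPoch_div_eq hv0 r,
      qPoch_div_eq hw0 r, qPoch_div_eq hs0 r]
    have d1 := hD hs' r hrm
    have d2 := hD hv r hrm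
    have d3 := hD hw r hrm
    have n5 := hQ m
    have n6 : v ^ r ≠ 0 := pow_ne_zero _ hv0
    have n7 : w ^ r ≠ 0 := pow_ne_zero _ hw0
    have n8 : s ^ r ≠ 0 := pow_ne_zero _ hs0
    generalize qPoch q p r / qPoch p p r = Z
    generalize (1 - q * p ^ (2 * r)) / (1 - q) = Z'
    generalize ∏ i ∈ Finset.range r, p ^ i = τ at *
    generalize (-(q * p)) ^ r = x₁ at *
    generalize (p ^ 2 / q) ^ r = x₂ at *
    generalize z ^ r = x₃ at *
    generalize (-(s * q)) ^ r = x₄ at *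
    generalize v ^ r = x₅ at *
    generalize w ^ r = x₆ at *
    generalize s ^ r = x₇ at *
    generalize ∏ i ∈ Finset.range r, (s - p ^ (i + 1)) = D₁ at *
    generalize ∏ i ∈ Finset.range r, (v - p ^ (i + 1)) = D₂ at *
    generalize ∏ i ∈ Finset.range r, (w - p ^ (i + 1)) = D₃ at *
    generalize qPoch (s * q) p r = A₁ at *
    generalize qPoch (v * q) p r = A₂ at *
    generalize qPoch (w * q) p r = A₃ at *
    generalize qPoch p p m = P at *
    generalize qPoch (q * p) p m = Q at *
    generalize qPoch (p / v) p m = V at *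
    generalize qPoch (p / w) p m = W at *
    generalize wpWeight q p b₀ b₁ c₀ c₁ r = B at *
    rcases eq_or_ne A₁ 0 with hA | hA
    · simp [hA]
    · field_simp
      linear_combination (Z' * Z * B * A₂ * A₃ * W * V) * e6
  rw [Finset.sum_congr rfl hL, Finset.sum_congr rfl hR, ← Finset.mul_sum, ← Finset.mul_sum] at hB
  rw [balSum, ← Finset.sum_div]
  generalize ∑ k ∈ Finset.range (m + 1), wpTerm q p b₀ b₁ c₀ c₁ s v w k = S at *
  generalize ∑ k ∈ Finset.range (m + 1), p ^ k * balWeight q p b₀ b₁ c₀ c₁ k / qPoch p p k *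
        (qPoch (s * q) p k * qPoch (v * q) p k * qPoch (w * q) p k) *
        (∏ i ∈ Finset.Ico k m, (1 - q ^ 2 * (s * v * w) * p ^ i)) = T at *
  have e1 := qPoch_self_shift hs
  have e2 : qPoch (q * p) p m * (1 - q) = qPoch q p m * (1 - q * p ^ m) := by
    rw [← qPoch_succ, add_comm, qPoch_add]
    simp [qPoch_succ, qPoch_zero, mul_comm]
  have e3 := prod_pow_range_sq p m
  have e4 : p ^ (m * m) * (q ^ m * s ^ m) = 1 := by
    rw [pow_mul, ← mul_pow, ← mul_pow, mul_comm, hs, one_pow]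
  rw [← e1, qPoch_div_eq hs0]
  rw [qPoch_div_eq hv0, qPoch_div_eq hw0] at hB
  have d1 := hD hs' m le_rfl
  have d2 := hD hv m le_rfl
  have d3 := hD hw m le_rfl
  have n1 := hP m
  have n2 := hQ m
  have t1 := hτ m
  have n3 : q ^ m ≠ 0 := pow_ne_zero _ hq
  have n4 : s ^ m ≠ 0 := pow_ne_zero _ hs0
  have n5 : v ^ m ≠ 0 := pow_ne_zero _ hv0
  have n6 : w ^ m ≠ 0 := pow_ne_zero _ hw0
  have e5 : (-(q ^ 2 * (s * (v * w)))) ^ m * (-(p * s)) ^ m =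
      (q ^ m) ^ 2 * (s ^ m) ^ 2 * v ^ m * w ^ m * p ^ m := by
    rw [pow_right_comm q, pow_right_comm s, ← mul_pow, ← mul_pow, ← mul_pow, ← mul_pow, ← mul_pow]
    congr 1
    ring
  have n7 : (-(q ^ 2 * (s * (v * w)))) ^ m ≠ 0 := pow_ne_zero _ (by simp [*])
  rw [← eq_div_iff h1q] at e2
  rw [e2] at hB n2
  generalize qPoch p p m = P at *
  generalize qPoch q p m = Q at *
  generalize (-(q ^ 2 * (s * (v * w)))) ^ m = Y at *
  generalize (-(p * s)) ^ m = X at *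
  generalize hN : 1 - q * p ^ m = N at *
  generalize p ^ m = x at *
  generalize p ^ (m * m) = y at *
  generalize ∏ i ∈ Finset.range m, p ^ i = τ at *
  generalize ∏ i ∈ Finset.range m, (s - p ^ (i + 1)) = D₁ at *
  generalize ∏ i ∈ Finset.range m, (v - p ^ (i + 1)) = D₂ at *
  generalize ∏ i ∈ Finset.range m, (w - p ^ (i + 1)) = D₃ at *
  generalize q ^ m = q' at *
  generalize s ^ m = s' at *
  generalize v ^ m = v' at *
  generalize w ^ m = w' at *
  have hQ0 : Q ≠ 0 := by rintro rfl; simp at n2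
  have hN0 : N ≠ 0 := by rintro rfl; simp at n2
  -- All powers of $p$ produced by the reversals cancel because $p^{m^2}(qs)^m=1$.
  have key : Y * X * τ ^ 2 = q' * s' * v' * w' := by
    linear_combination τ ^ 2 * e5 + q' ^ 2 * s' ^ 2 * v' * w' * e3 + q' * s' * v' * w' * e4
  have hS : S = T * (v' * w' * Q * N / (1 - q)) / (Y * τ * D₂ * D₃) := by
    field_simp at hB ⊢
    linear_combination -hB
  rw [hS]
  field_simp
  linear_combination -T * key

end Watson

/-! ### Residues at a valuation and cyclotomic places. -/

section Residue

variable {K Γ : Type*} [Field K] [LinearOrderedCommGroupWithZero Γ] {v : Valuation K Γ}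

/-- `x` is integral at `v` with residue `y`. -/
def Res (v : Valuation K Γ) (x : K) (y : IsLocalRing.ResidueField v.valuationSubring) : Prop :=
  ∃ h : x ∈ v.valuationSubring, IsLocalRing.residue v.valuationSubring ⟨x, h⟩ = y

namespace Res

variable {x x' : K} {y y' : IsLocalRing.ResidueField v.valuationSubring}

theorem of_le (h : v x ≤ 1) : ∃ y, Res v x y := ⟨_, h, rfl⟩

theorem le_one (h : Res v x y) : v x ≤ 1 := h.1

theorem unique (h : Res v x y) (h' : Res v x y') : y = y' := by
  obtain ⟨_, rfl⟩ := h
  obtain ⟨_, rfl⟩ := h'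
  rfl

theorem zero : Res v 0 0 := ⟨zero_mem _, map_zero (IsLocalRing.residue v.valuationSubring)⟩

theorem one : Res v 1 1 := ⟨one_mem _, map_one (IsLocalRing.residue v.valuationSubring)⟩

theorem add (h : Res v x y) (h' : Res v x' y') : Res v (x + x') (y + y') := by
  obtain ⟨h, rfl⟩ := h
  obtain ⟨h', rfl⟩ := h'
  exact ⟨add_mem h h', map_add (IsLocalRing.residue v.valuationSubring) ⟨x, h⟩ ⟨x', h'⟩⟩

theorem mul (h : Res v x y) (h' : Res v x' y') : Res v (x * x') (y * y') := by
  obtain ⟨h, rfl⟩ := h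
  obtain ⟨h', rfl⟩ := h'
  exact ⟨mul_mem h h', map_mul (IsLocalRing.residue v.valuationSubring) ⟨x, h⟩ ⟨x', h'⟩⟩

theorem neg (h : Res v x y) : Res v (-x) (-y) := by
  obtain ⟨h, rfl⟩ := h
  exact ⟨neg_mem h, map_neg (IsLocalRing.residue v.valuationSubring) ⟨x, h⟩⟩

theorem sub (h : Res v x y) (h' : Res v x' y') : Res v (x - x') (y - y') := by
  rw [sub_eq_add_neg, sub_eq_add_neg]
  exact h.add h'.neg

theorem pow (h : Res v x y) (k : ℕ) : Res v (x ^ k) (y ^ k) := by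
  obtain ⟨h, rfl⟩ := h
  exact ⟨pow_mem h k, map_pow (IsLocalRing.residue v.valuationSubring) ⟨x, h⟩ k⟩

theorem natCast (k : ℕ) : Res v (k : K) k :=
  ⟨natCast_mem _ k, map_natCast (IsLocalRing.residue v.valuationSubring) k⟩

theorem sum {ι : Type*} {s : Finset ι} {f : ι → K}
    {g : ι → IsLocalRing.ResidueField v.valuationSubring} (h : ∀ i ∈ s, Res v (f i) (g i)) :
    Res v (∑ i ∈ s, f i) (∑ i ∈ s, g i) := by
  classical
  induction s using Finset.induction_on with
  | empty => simpa using zero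
  | insert a s ha ih =>
    rw [Finset.sum_insert ha, Finset.sum_insert ha]
    exact (h a (Finset.mem_insert_self a s)).add
      (ih fun i hi => h i (Finset.mem_insert_of_mem hi))

theorem prod {ι : Type*} {s : Finset ι} {f : ι → K}
    {g : ι → IsLocalRing.ResidueField v.valuationSubring} (h : ∀ i ∈ s, Res v (f i) (g i)) :
    Res v (∏ i ∈ s, f i) (∏ i ∈ s, g i) := by
  classical
  induction s using Finset.induction_on with
  | empty => simpa using one
  | insert a s ha ih =>
    rw [Finset.prod_insert ha, Finset.prod_insert ha]
    exact (h a (Finset.mem_insert_self a s)).mul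
      (ih fun i hi => h i (Finset.mem_insert_of_mem hi))

theorem zero_iff : Res v x 0 ↔ v x < 1 := by
  constructor
  · rintro ⟨h, h0⟩
    rw [IsLocalRing.residue_eq_zero_iff] at h0
    exact (Valuation.mem_maximalIdeal_iff K v).mp h0
  · intro h
    refine ⟨h.le, ?_⟩
    rw [IsLocalRing.residue_eq_zero_iff]
    exact (Valuation.mem_maximalIdeal_iff K v).mpr h

theorem eq_one (h : Res v x y) (hy : y ≠ 0) : v x = 1 := by
  refine le_antisymm h.le_one (not_lt.mp fun h1 => hy ?_)
  exact h.unique (zero_iff.mpr h1)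

theorem ne_zero (h : Res v x y) (hx : v x = 1) : y ≠ 0 := by
  rintro rfl
  exact absurd hx (zero_iff.mp h).ne

theorem inv (h : Res v x y) (hy : y ≠ 0) : Res v x⁻¹ y⁻¹ := by
  have hx := h.eq_one hy
  have hx0 : x ≠ 0 := by rintro rfl; simp at hx
  obtain ⟨z, hz⟩ := of_le (v := v) (x := x⁻¹) (by rw [map_inv₀, hx, inv_one])
  have h1 := h.mul hz
  rw [mul_inv_cancel₀ hx0] at h1
  rwa [inv_eq_of_mul_eq_one_right (h1.unique one)]

theorem div (h : Res v x y) (h' : Res v x' y') (hy : y' ≠ 0) : Res v (x / x') (y / y') := by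
  rw [div_eq_mul_inv, div_eq_mul_inv]
  exact h.mul (h'.inv hy)

end Res

/-- `v` is a discrete place with uniformiser `1 - q ^ d` at which `q` reduces to a primitive root
of unity `ζ` of odd order `d`, and with residue characteristic zero. -/
structure CyclotomicPlace (v : Valuation K Γ) (q : K) (d : ℕ)
    (ζ : IsLocalRing.ResidueField v.valuationSubring) : Prop where
  odd : Odd d
  one_lt : 1 < d
  res : Res v q ζ
  prim : IsPrimitiveRoot ζ d
  natCast : ∀ k : ℕ, k ≠ 0 → v (k : K) = 1
  mul : ∀ j : ℕ, j ≠ 0 → v (1 - q ^ (d * j)) = v (1 - q ^ d)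
  ne_zero : 1 - q ^ d ≠ 0
  discrete : ∀ x, v x < 1 → v x ≤ v (1 - q ^ d)

namespace CyclotomicPlace

variable {q : K} {d : ℕ} {ζ : IsLocalRing.ResidueField v.valuationSubring}

theorem natCast_ne (h : CyclotomicPlace v q d ζ) {k : ℕ} (hk : k ≠ 0) :
    (k : IsLocalRing.ResidueField v.valuationSubring) ≠ 0 :=
  (Res.natCast k).ne_zero (h.natCast k hk)

theorem charZero (h : CyclotomicPlace v q d ζ) :
    CharZero (IsLocalRing.ResidueField v.valuationSubring) :=
  charZero_of_inj_zero fun k hk => by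
    by_contra h0
    exact h.natCast_ne h0 hk

theorem charZero' (h : CyclotomicPlace v q d ζ) : CharZero K :=
  charZero_of_inj_zero fun k hk => by
    by_contra h0
    have := h.natCast k h0
    simp [hk] at this

theorem zeta_ne (h : CyclotomicPlace v q d ζ) : ζ ≠ 0 := h.prim.ne_zero (by have := h.one_lt; omega)

theorem val_q (h : CyclotomicPlace v q d ζ) : v q = 1 := h.res.eq_one h.zeta_ne

theorem q_ne (h : CyclotomicPlace v q d ζ) : q ≠ 0 := by
  have := h.val_q
  rintro rfl
  simp at this

theorem res_one_sub (h : CyclotomicPlace v q d ζ) (j : ℕ) : Res v (1 - q ^ j) (1 - ζ ^ j) :=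
  Res.one.sub (h.res.pow j)

theorem val_le (h : CyclotomicPlace v q d ζ) (j : ℕ) : v (1 - q ^ j) ≤ 1 := (h.res_one_sub j).le_one

theorem val_lt (h : CyclotomicPlace v q d ζ) {j : ℕ} (hj : d ∣ j) : v (1 - q ^ j) < 1 := by
  have := h.res_one_sub j
  rw [(h.prim.pow_eq_one_iff_dvd j).mpr hj, sub_self] at this
  exact Res.zero_iff.mp this

theorem one_sub_ne (h : CyclotomicPlace v q d ζ) {j : ℕ} (hj : ¬ d ∣ j) : 1 - ζ ^ j ≠ 0 :=
  fun h0 => hj ((h.prim.pow_eq_one_iff_dvd j).mp (sub_eq_zero.mp h0).symm)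

theorem val_eq_one (h : CyclotomicPlace v q d ζ) {j : ℕ} (hj : ¬ d ∣ j) : v (1 - q ^ j) = 1 :=
  (h.res_one_sub j).eq_one (h.one_sub_ne hj)

theorem val_dvd (h : CyclotomicPlace v q d ζ) {j : ℕ} (hj : d ∣ j) (h0 : j ≠ 0) :
    v (1 - q ^ j) = v (1 - q ^ d) := by
  obtain ⟨k, rfl⟩ := hj
  exact h.mul k (by rintro rfl; simp at h0)

theorem val_ne (h : CyclotomicPlace v q d ζ) {j : ℕ} (h0 : j ≠ 0) : v (1 - q ^ j) ≠ 0 := by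
  by_cases hj : d ∣ j
  · rw [h.val_dvd hj h0]
    exact (Valuation.ne_zero_iff v).mpr h.ne_zero
  · rw [h.val_eq_one hj]
    exact one_ne_zero

theorem one_sub_ne_zero (h : CyclotomicPlace v q d ζ) {j : ℕ} (h0 : j ≠ 0) : 1 - q ^ j ≠ 0 :=
  (Valuation.ne_zero_iff v).mp (h.val_ne h0)

theorem val_congr (h : CyclotomicPlace v q d ζ) {i j : ℕ} (hi : i ≠ 0) (hj : j ≠ 0)
    (hij : d ∣ i ↔ d ∣ j) : v (1 - q ^ i) = v (1 - q ^ j) := by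
  by_cases h1 : d ∣ i
  · rw [h.val_dvd h1 hi, h.val_dvd (hij.mp h1) hj]
  · rw [h.val_eq_one h1, h.val_eq_one (mt hij.mpr h1)]

theorem le_val (h : CyclotomicPlace v q d ζ) {j : ℕ} (hj : j ≠ 0) :
    v (1 - q ^ d) ≤ v (1 - q ^ j) := by
  by_cases h1 : d ∣ j
  · rw [h.val_dvd h1 hj]
  · rw [h.val_eq_one h1]
    exact h.val_le d

/-- As $d$ is odd and the residue characteristic is zero, $-1$ is not a power of $\zeta$. -/
theorem one_add_ne (h : CyclotomicPlace v q d ζ) (j : ℕ) : 1 + ζ ^ j ≠ 0 := by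
  have := h.charZero
  intro h0
  have h1 : ζ ^ j = -1 := by linear_combination h0
  have h2 : (ζ ^ j) ^ d = -1 := by rw [h1, h.odd.neg_one_pow]
  rw [← pow_mul, mul_comm, pow_mul, h.prim.pow_eq_one, one_pow] at h2
  have : (2 : IsLocalRing.ResidueField v.valuationSubring) = 0 := by linear_combination h2
  exact two_ne_zero this

end CyclotomicPlace

end Residue

/-! ### A sum over roots of unity. -/

section RootsOfUnity

/-- Expresses $1/(1-\zeta)$ as a polynomial in $\zeta$, so that orthogonality of characters applies
to products of such inverses. -/
theorem sum_inv_one_sub_root {L : Type*} [Field L] {ζ : L} {n : ℕ} (h : ζ ^ n = 1) (h1 : ζ ≠ 1) :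
    (1 - ζ) * ∑ k ∈ Finset.range n, (k : L) * ζ ^ k = -n := by
  have key : ∀ m, (1 - ζ) * ∑ k ∈ Finset.range m, (k : L) * ζ ^ k =
      (∑ k ∈ Finset.range m, ζ ^ k) - 1 - ((m : L) - 1) * ζ ^ m := by
    intro m
    induction m with
    | zero => simp
    | succ m ih =>
      rw [Finset.sum_range_succ, Finset.sum_range_succ, mul_add, ih]
      push_cast
      ring
  have h2 : ∑ k ∈ Finset.range n, ζ ^ k = 0 := by
    have := geom_sum_mul ζ n
    rw [h, sub_self] at this
    exact (mul_eq_zero.mp this).resolve_right (sub_ne_zero.mpr h1)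
  rw [key, h2, h]
  ring

/-- Write $y/(1-y)^2=-1/((1-y)(1-y^{-1}))=-S(y)S(y^{-1})/n^2$ with $S(y)=\sum_k ky^k$ for each
$y=\zeta^j\ne1$. Parseval's identity turns the sum over all $j$ into $n\sum k^2$. -/
theorem sum_root_div_sq {L : Type*} [Field L] [CharZero L] {ζ : L} {n : ℕ}
    (hζ : IsPrimitiveRoot ζ n) (hn : 0 < n) :
    ∑ j ∈ Finset.range n, ζ ^ j / (1 - ζ ^ j) ^ 2 = -((n : L) ^ 2 - 1) / 12 := by
  have hn0 : (n : L) ≠ 0 := by exact_mod_cast hn.ne'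
  have hz0 : ζ ≠ 0 := hζ.ne_zero hn.ne'
  set S : L → L := fun x => ∑ k ∈ Finset.range n, (k : L) * x ^ k with hS
  have hone : ∀ j, (ζ ^ j) ^ n = 1 := fun j => by
    rw [← pow_mul, mul_comm, pow_mul, hζ.pow_eq_one, one_pow]
  -- The term $j=0$ is $1/0=0$ on the left; the correction removes its contribution to the Parseval
  -- sum.
  have h1 : ∀ j ∈ Finset.range n, ζ ^ j / (1 - ζ ^ j) ^ 2 =
      -(1 / (n : L) ^ 2) * (S (ζ ^ j) * S ((ζ ^ j)⁻¹)) + if j = 0 then S 1 ^ 2 / n ^ 2 else 0 := by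
    intro j hj
    rcases eq_or_ne j 0 with rfl | hj0
    · simp
      ring
    · have hne : ζ ^ j ≠ 1 := hζ.pow_ne_one_of_pos_of_lt hj0 (Finset.mem_range.mp hj)
      have e1 := sum_inv_one_sub_root (hone j) hne
      have e2 := sum_inv_one_sub_root (ζ := (ζ ^ j)⁻¹) (n := n) (by rw [inv_pow, hone, inv_one])
        (by rwa [ne_eq, inv_eq_one])
      have hy0 : ζ ^ j ≠ 0 := pow_ne_zero _ hz0
      rw [if_neg hj0, add_zero]
      change (1 - ζ ^ j) * S (ζ ^ j) = _ at e1
      change (1 - (ζ ^ j)⁻¹) * S ((ζ ^ j)⁻¹) = _ at e2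
      have hne' : 1 - ζ ^ j ≠ 0 := sub_ne_zero.mpr hne.symm
      have hm : (1 - ζ ^ j) * (1 - (ζ ^ j)⁻¹) * (S (ζ ^ j) * S ((ζ ^ j)⁻¹)) = (n : L) ^ 2 := by
        linear_combination (1 - (ζ ^ j)⁻¹) * S ((ζ ^ j)⁻¹) * e1 - n * e2
      generalize S (ζ ^ j) * S ((ζ ^ j)⁻¹) = T at *
      generalize ζ ^ j = y at *
      field_simp at hm ⊢
      linear_combination -hm
  have h2 : ∑ j ∈ Finset.range n, S (ζ ^ j) * S ((ζ ^ j)⁻¹) =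
      n * ∑ k ∈ Finset.range n, (k : L) ^ 2 := by
    simp only [hS, Finset.sum_mul_sum]
    rw [Finset.sum_comm]
    rw [Finset.mul_sum]
    refine Finset.sum_congr rfl fun k hk => ?_
    rw [Finset.sum_comm, Finset.sum_eq_single k]
    · have : ∀ j ∈ Finset.range n, (k : L) * (ζ ^ j) ^ k * ((k : L) * (ζ ^ j)⁻¹ ^ k) = (k : L) ^ 2 :=
        fun j _ => by
          rw [inv_pow]
          field_simp
      rw [Finset.sum_congr rfl this, Finset.sum_const, Finset.card_range, nsmul_eq_mul]
    · intro l hl hlk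
      set ω := ζ ^ k * (ζ ^ l)⁻¹ with hω
      have hω1 : ω ≠ 1 := by
        intro h
        rw [hω, mul_inv_eq_one₀ (pow_ne_zero _ hz0)] at h
        exact hlk (hζ.pow_inj (Finset.mem_range.mp hk) (Finset.mem_range.mp hl) h).symm
      have hωn : ω ^ n = 1 := by rw [hω, mul_pow, inv_pow, hone, hone, inv_one, mul_one]
      have : ∀ j ∈ Finset.range n, (k : L) * (ζ ^ j) ^ k * ((l : L) * (ζ ^ j)⁻¹ ^ l) =
          k * l * ω ^ j := fun j _ => by
        rw [hω, mul_pow, inv_pow, inv_pow, ← pow_mul, ← pow_mul, ← pow_mul, ← pow_mul,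
          mul_comm j k, mul_comm j l]
        ring
      rw [Finset.sum_congr rfl this, ← Finset.mul_sum]
      have := geom_sum_mul ω n
      rw [hωn, sub_self] at this
      rw [(mul_eq_zero.mp this).resolve_right (sub_ne_zero.mpr hω1), mul_zero]
    · intro h; exact absurd hk h
  have h3 : ∀ m : ℕ, ∑ k ∈ Finset.range m, (k : L) ^ 2 = (m : L) * (m - 1) * (2 * m - 1) / 6 := by
    intro m
    induction m with
    | zero => simp
    | succ m ih => rw [Finset.sum_range_succ, ih]; push_cast; ring
  have h4 : ∀ m : ℕ, ∑ k ∈ Finset.range m, (k : L) = (m : L) * (m - 1) / 2 := by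
    intro m
    induction m with
    | zero => simp
    | succ m ih => rw [Finset.sum_range_succ, ih]; push_cast; ring
  have h5 : S 1 = (n : L) * (n - 1) / 2 := by simp [hS, h4]
  rw [Finset.sum_congr rfl h1, Finset.sum_add_distrib, ← Finset.mul_sum, h2, h3,
    Finset.sum_ite_eq' (Finset.range n) 0, if_pos (Finset.mem_range.mpr hn), h5]
  field_simp
  ring

end RootsOfUnity

/-! ### Antisymmetry of the series when $qp^r=1$. -/

section Reflection

variable {F : Type*} [Field F]

/-- Meant for $x=p^i$, $y=p^{r-1-i}$ with $qp^r=1$: then $qx$ is inverse to $py$, and $qy$ to $px$,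
so numerators cancel denominators crosswise. The next lemma is the same for a projective pair. -/
theorem shifted_ratio_mul_reflect {q p x y : F} (h : q * x * (p * y) = 1) (hx : 1 - p * x ≠ 0)
    (hy : 1 - p * y ≠ 0) :
    (1 - q * x) / (1 - p * x) * ((1 - q * y) / (1 - p * y)) = q / p := by
  have hp : p ≠ 0 := by rintro rfl; simp at h
  have hpx : p * x ≠ 0 := by
    intro h0; rw [show q * x * (p * y) = q * y * (p * x) by ring, h0] at h; simp at h
  have e1 : (1 - q * y) * (p * x) = -(1 - p * x) := by linear_combination -h
  have e2 : (1 - p * y) * (q * x) = -(1 - q * x) := by linear_combination -h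
  rw [div_mul_div_comm, div_eq_div_iff (mul_ne_zero hx hy) hp]
  refine mul_right_cancel₀ hpx ?_
  linear_combination (1 - q * x) * p * e1 - (1 - p * x) * p * e2

theorem pair_ratio_mul_reflect {q p x y b₀ b₁ : F} (h : q * x * (p * y) = 1)
    (hx : b₁ - q * b₀ * (p * x) ≠ 0) (hy : b₁ - q * b₀ * (p * y) ≠ 0) :
    (b₀ - b₁ * x) / (b₁ - q * b₀ * (p * x)) * ((b₀ - b₁ * y) / (b₁ - q * b₀ * (p * y))) =
      1 / (q * p) := by
  have hx0 : x ≠ 0 := by rintro rfl; simp at h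
  have hqp : q * p ≠ 0 := by
    intro h0; rw [show q * x * (p * y) = q * p * (x * y) by ring, h0] at h; simp at h
  have e1 : (b₀ - b₁ * y) * (q * p * x) = -(b₁ - q * b₀ * (p * x)) := by
    linear_combination -b₁ * h
  have e2 : (b₁ - q * b₀ * (p * y)) * x = -(b₀ - b₁ * x) := by linear_combination -b₀ * h
  rw [div_mul_div_comm, div_eq_div_iff (mul_ne_zero hx hy) hqp]
  refine mul_right_cancel₀ hx0 ?_
  linear_combination (b₀ - b₁ * x) * e1 - (b₁ - q * b₀ * (p * x)) * e2

theorem prod_pair_reflect {q p : F} {r : ℕ} (hr : q * p ^ r = 1) (b₀ b₁ : F) :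
    (∏ i ∈ Finset.range r, (b₁ - q * b₀ * p ^ (i + 1))) *
        ((-1) ^ r * ∏ i ∈ Finset.range r, p ^ i) =
      ∏ i ∈ Finset.range r, (b₀ - b₁ * p ^ i) := by
  have h : (-1 : F) ^ r * ∏ i ∈ Finset.range r, p ^ i =
      ∏ i ∈ Finset.range r, (-1 * p ^ i) := by
    rw [Finset.prod_mul_distrib, Finset.prod_const, Finset.card_range]
  rw [h, ← Finset.prod_range_reflect, ← Finset.prod_mul_distrib]
  refine Finset.prod_congr rfl fun i hi => ?_
  have him := Finset.mem_range.mp hi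
  have h1 : q * (p ^ (r - 1 - i + 1) * p ^ i) = 1 := by
    rw [← pow_add, show r - 1 - i + 1 + i = r by omega, hr]
  linear_combination b₀ * h1

/-- The part of `wpTerm` at `u = v = w = 1` that is a product of consecutive ratios. -/
def wpCore (q p b₀ b₁ c₀ c₁ : F) (k : ℕ) : F :=
  (p ^ 2 / q) ^ k * wpWeight q p b₀ b₁ c₀ c₁ k * wpRatio q p 1 k ^ 4

theorem wpTerm_one (q p b₀ b₁ c₀ c₁ : F) (k : ℕ) :
    wpTerm q p b₀ b₁ c₀ c₁ 1 1 1 k =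
      (1 - q * p ^ (2 * k)) / (1 - q) * wpCore q p b₀ b₁ c₀ c₁ k := by
  unfold wpTerm wpCore
  ring

theorem wpCore_succ (q p b₀ b₁ c₀ c₁ : F) (k : ℕ) :
    wpCore q p b₀ b₁ c₀ c₁ (k + 1) = wpCore q p b₀ b₁ c₀ c₁ k *
      (p ^ 2 / q * ((b₀ - b₁ * p ^ k) / (b₁ - q * b₀ * (p * p ^ k)) *
        ((c₀ - c₁ * p ^ k) / (c₁ - q * c₀ * (p * p ^ k)))) *
          ((1 - q * p ^ k) / (1 - p * p ^ k)) ^ 4) := by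
  simp only [wpCore, wpWeight_succ, wpRatio, Finset.prod_range_succ, pow_succ' p k, one_mul]
  rw [mul_div_mul_comm]
  ring

variable {q p b₀ b₁ c₀ c₁ : F} {r : ℕ}

theorem wpCore_self (hr : q * p ^ r = 1) (hp0 : p ≠ 0) (hp : ∀ i < r, 1 - p * p ^ i ≠ 0)
    (hb : ∀ i, b₁ - q * b₀ * p ^ (i + 1) ≠ 0) (hc : ∀ i, c₁ - q * c₀ * p ^ (i + 1) ≠ 0) :
    wpCore q p b₀ b₁ c₀ c₁ r = q := by
  have hq0 : q ≠ 0 := by rintro rfl; simp at hr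
  have e1 := prod_pair_reflect hr b₀ b₁
  have e2 := prod_pair_reflect hr c₀ c₁
  have e3 := qPoch_self_shift (s := 1) (q := q) (p := p) (m := r) (by rw [mul_one, hr])
  rw [mul_one] at e3
  have hP := qPoch_ne_zero hp
  have hτ : (∏ i ∈ Finset.range r, p ^ i) ≠ 0 :=
    Finset.prod_ne_zero_iff.mpr fun i _ => pow_ne_zero _ hp0
  have n1 : (-p) ^ r ≠ 0 := pow_ne_zero _ (neg_ne_zero.mpr hp0)
  have hQ : qPoch q p r ≠ 0 := by
    intro h0; rw [h0, zero_mul] at e3; exact hP e3.symm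
  have d1 : (∏ i ∈ Finset.range r, (b₁ - q * b₀ * p ^ (i + 1))) ≠ 0 :=
    Finset.prod_ne_zero_iff.mpr fun i _ => hb i
  have d2 : (∏ i ∈ Finset.range r, (c₁ - q * c₀ * p ^ (i + 1))) ≠ 0 :=
    Finset.prod_ne_zero_iff.mpr fun i _ => hc i
  have hW : wpWeight q p b₀ b₁ c₀ c₁ r = (∏ i ∈ Finset.range r, p ^ i) ^ 2 := by
    rw [wpWeight, Finset.prod_div_distrib, Finset.prod_mul_distrib, Finset.prod_mul_distrib,
      ← e1, ← e2, div_eq_iff (mul_ne_zero d1 d2)]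
    have : ((-1 : F) ^ r) ^ 2 = 1 := by rw [← pow_mul, mul_comm, pow_mul]; simp
    linear_combination (∏ i ∈ Finset.range r, (b₁ - q * b₀ * p ^ (i + 1))) *
      (∏ i ∈ Finset.range r, (c₁ - q * c₀ * p ^ (i + 1))) *
      (∏ i ∈ Finset.range r, p ^ i) ^ 2 * this
  have e4 := prod_pow_range_sq p r
  have e5 : p ^ (r * r) * q ^ r = 1 := by rw [pow_mul, ← mul_pow, mul_comm, hr, one_pow]
  have e6 : ((-p) ^ r) ^ 2 = (p ^ r) ^ 2 := by rw [pow_right_comm, neg_sq, pow_right_comm]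
  rw [wpCore, hW, wpRatio_one, ← e3, div_pow (p ^ 2), pow_right_comm p 2 r]
  generalize (∏ i ∈ Finset.range r, p ^ i) = τ at *
  generalize (-p) ^ r = X at *
  have n2 : q ^ r ≠ 0 := pow_ne_zero _ hq0
  have n3 : p ^ r ≠ 0 := pow_ne_zero _ hp0
  generalize p ^ r = x at *
  generalize q ^ r = y at *
  generalize p ^ (r * r) = z at *
  have h1 : X ^ 4 = x ^ 4 := by linear_combination (X ^ 2 + x ^ 2) * e6
  have h2 : (X * τ) ^ 4 = x ^ 4 * τ ^ 4 := by rw [mul_pow, h1]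
  rw [div_pow, mul_pow, h2]
  field_simp
  linear_combination (-q * x * y) * e4 - x * q * e5 - hr

/-- Induction from the end $k=0$, where `wpCore_self` gives the value $q$. The step ratios at $k$
and at $r-1-k$ multiply to $p^{-2}$. -/
theorem wpCore_reflect (hr : q * p ^ r = 1) (hp0 : p ≠ 0) (hp : ∀ i < r, 1 - p * p ^ i ≠ 0)
    (hb : ∀ i, b₁ - q * b₀ * p ^ (i + 1) ≠ 0) (hc : ∀ i, c₁ - q * c₀ * p ^ (i + 1) ≠ 0)
    {k : ℕ} (hk : k ≤ r) :
    wpCore q p b₀ b₁ c₀ c₁ (r - k) = q * p ^ (2 * k) * wpCore q p b₀ b₁ c₀ c₁ k := by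
  have hq0 : q ≠ 0 := by rintro rfl; simp at hr
  induction k with
  | zero =>
    rw [Nat.sub_zero, wpCore_self hr hp0 hp hb hc]
    simp [wpCore, wpWeight, wpRatio]
  | succ k ih =>
    have ih := ih (by omega)
    have hxy : q * p ^ k * (p * p ^ (r - (k + 1))) = 1 := by
      rw [← hr]
      conv_rhs => rw [show r = k + 1 + (r - (k + 1)) by omega]
      ring
    have e1 := shifted_ratio_mul_reflect hxy (hp k (by omega)) (hp _ (by omega))
    have e2 := pair_ratio_mul_reflect (b₀ := b₀) (b₁ := b₁) hxy
      (by rw [← pow_succ']; exact hb k) (by rw [← pow_succ']; exact hb _)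
    have e3 := pair_ratio_mul_reflect (b₀ := c₀) (b₁ := c₁) hxy
      (by rw [← pow_succ']; exact hc k) (by rw [← pow_succ']; exact hc _)
    rw [show r - k = r - (k + 1) + 1 by omega, wpCore_succ] at ih
    rw [wpCore_succ, show 2 * (k + 1) = 2 * k + 2 by ring, pow_add]
    generalize (1 - q * p ^ k) / (1 - p * p ^ k) = A₁ at *
    generalize (1 - q * p ^ (r - (k + 1))) / (1 - p * p ^ (r - (k + 1))) = A₂ at *
    generalize (b₀ - b₁ * p ^ k) / (b₁ - q * b₀ * (p * p ^ k)) = B₁ at *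
    generalize (b₀ - b₁ * p ^ (r - (k + 1))) / (b₁ - q * b₀ * (p * p ^ (r - (k + 1)))) = B₂ at *
    generalize (c₀ - c₁ * p ^ k) / (c₁ - q * c₀ * (p * p ^ k)) = C₁ at *
    generalize (c₀ - c₁ * p ^ (r - (k + 1))) / (c₁ - q * c₀ * (p * p ^ (r - (k + 1)))) = C₂ at *
    generalize wpCore q p b₀ b₁ c₀ c₁ (r - (k + 1)) = T at *
    generalize wpCore q p b₀ b₁ c₀ c₁ k = T' at *
    have hm : p ^ 2 / q * (B₁ * C₁) * A₁ ^ 4 * (p ^ 2 / q * (B₂ * C₂) * A₂ ^ 4) * p ^ 2 = 1 := by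
      calc _ = (p ^ 2 / q) ^ 2 * (B₁ * B₂) * (C₁ * C₂) * (A₁ * A₂) ^ 4 * p ^ 2 := by ring
        _ = 1 := by
          rw [e1, e2, e3]
          field_simp
    linear_combination (p ^ 2 / q * (B₁ * C₁) * A₁ ^ 4 * p ^ 2) * ih - T * hm

/-- The factor $qp^{2k}$ of `wpCore_reflect` is cancelled by the very-well-poised factor, since
$1-qp^{2(r-k)}=-(1-qp^{2k})/(qp^{2k})$. This is the source of the minus sign. -/
theorem wpTerm_reflect (hr : q * p ^ r = 1) (hp0 : p ≠ 0) (hp : ∀ i < r, 1 - p * p ^ i ≠ 0)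
    (hb : ∀ i, b₁ - q * b₀ * p ^ (i + 1) ≠ 0) (hc : ∀ i, c₁ - q * c₀ * p ^ (i + 1) ≠ 0)
    {k : ℕ} (hk : k ≤ r) :
    wpTerm q p b₀ b₁ c₀ c₁ 1 1 1 (r - k) = -wpTerm q p b₀ b₁ c₀ c₁ 1 1 1 k := by
  rw [wpTerm_one, wpTerm_one, wpCore_reflect hr hp0 hp hb hc hk]
  have h : q * (p ^ (r - k) * p ^ k) = 1 := by rw [← pow_add, Nat.sub_add_cancel hk, hr]
  rw [pow_mul' p 2, pow_mul' p 2]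
  generalize p ^ (r - k) = x at *
  generalize p ^ k = y at *
  linear_combination (-(wpCore q p b₀ b₁ c₀ c₁ k) / (1 - q)) * (q * (x * y) + 1) * h

/-- The logarithmic derivative of `wpRatio` at `u = 1`, up to sign. -/
def wpSlope (q p : F) (k : ℕ) : F :=
  ∑ i ∈ Finset.range k, (1 - q * p ^ i * p ^ (i + 1)) / ((1 - q * p ^ i) * (1 - p ^ (i + 1)))

theorem slope_term_reflect {q p x y : F} (h : q * x * (p * y) = 1) :
    (1 - q * y * (p * y)) / ((1 - q * y) * (1 - p * y)) =
      -((1 - q * x * (p * x)) / ((1 - q * x) * (1 - p * x))) := by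
  have hpx : p * x ≠ 0 := by
    intro h0; rw [show q * x * (p * y) = q * y * (p * x) by ring, h0] at h; simp at h
  have hqx : q * x ≠ 0 := left_ne_zero_of_mul_eq_one h
  have e1 : (1 - q * y) = -(1 - p * x) / (p * x) := by
    rw [eq_div_iff hpx]; linear_combination -h
  have e2 : (1 - p * y) = -(1 - q * x) / (q * x) := by
    rw [eq_div_iff hqx]; linear_combination -h
  have e3 : (1 - q * y * (p * y)) = -(1 - q * x * (p * x)) / (q * x * (p * x)) := by
    rw [eq_div_iff (mul_ne_zero hqx hpx)]
    linear_combination -(q * x * (p * y) + 1) * h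
  rw [e1, e2, e3, div_mul_div_comm, mul_comm (p * x), div_div_div_cancel_right₀
    (mul_ne_zero hqx hpx), neg_mul_neg, neg_div, mul_comm (1 - p * x)]

/-- The summands are odd under $i\mapsto r-1-i$, so the slope at $r-k$ is the slope at $k$ plus the
full sum; taking $k=r$ shows that twice the full sum is zero. -/
theorem wpSlope_reflect [CharZero F] (hr : q * p ^ r = 1) {k : ℕ} (hk : k ≤ r) :
    wpSlope q p (r - k) = wpSlope q p k := by
  set θ : ℕ → F := fun i =>
    (1 - q * p ^ i * p ^ (i + 1)) / ((1 - q * p ^ i) * (1 - p ^ (i + 1))) with hθ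
  have h1 : ∀ i < r, θ (r - 1 - i) = -θ i := by
    intro i hi
    simp only [hθ, pow_succ']
    apply slope_term_reflect
    rw [← hr]
    conv_rhs => rw [show r = i + 1 + (r - 1 - i) by omega]
    ring
  have h2 : ∀ k ≤ r, wpSlope q p (r - k) = wpSlope q p r + wpSlope q p k := by
    intro k hk
    induction k with
    | zero => simp [wpSlope]
    | succ k ih =>
      have e1 : wpSlope q p (r - k) = wpSlope q p (r - (k + 1)) + θ (r - 1 - k) := by
        rw [show r - k = r - 1 - k + 1 by omega, show r - (k + 1) = r - 1 - k by omega]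
        exact Finset.sum_range_succ _ _
      have e2 : wpSlope q p (k + 1) = wpSlope q p k + θ k := Finset.sum_range_succ _ _
      rw [h1 k (by omega), ih (by omega)] at e1
      rw [e2]
      linear_combination -e1
  have h3 := h2 r le_rfl
  have h4 : wpSlope q p 0 = 0 := by simp [wpSlope]
  rw [Nat.sub_self, h4, ← two_mul, eq_comm, mul_eq_zero] at h3
  rw [h2 k hk, h3.resolve_left two_ne_zero, zero_add]

end Reflection

/-! ### Residues of the factors of the series. -/

section Residues

variable {K Γ : Type*} [Field K] [LinearOrderedCommGroupWithZero Γ] {v : Valuation K Γ}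

/-- The pair `(b₀, b₁)` is integral and all factors that it contributes to a well-poised series
with base `q ^ 4` are units at `v`. -/
structure UnitPair (v : Valuation K Γ) (q b₀ b₁ : K) : Prop where
  le_left : v b₀ ≤ 1
  le_right : v b₁ ≤ 1
  num : ∀ i, v (b₀ - b₁ * (q ^ 4) ^ i) = 1
  den : ∀ i, v (b₁ - q * b₀ * (q ^ 4) ^ (i + 1)) = 1

variable {q : K} {d : ℕ} {ζ : IsLocalRing.ResidueField v.valuationSubring}

theorem UnitPair.ne_zero {b₀ b₁ : K} (hb : UnitPair v q b₀ b₁) (i : ℕ) :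
    b₁ - q * b₀ * (q ^ 4) ^ (i + 1) ≠ 0 := by
  intro h
  have := hb.den i
  simp [h] at this

theorem UnitPair.exists_res (h : CyclotomicPlace v q d ζ) {b₀ b₁ : K} (hb : UnitPair v q b₀ b₁) :
    ∃ β₀ β₁, Res v b₀ β₀ ∧ Res v b₁ β₁ ∧ ∀ i, β₁ - ζ * β₀ * (ζ ^ 4) ^ (i + 1) ≠ 0 := by
  obtain ⟨β₀, h₀⟩ := Res.of_le hb.le_left
  obtain ⟨β₁, h₁⟩ := Res.of_le hb.le_right
  exact ⟨β₀, β₁, h₀, h₁, fun i =>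
    (h₁.sub ((h.res.mul h₀).mul ((h.res.pow 4).pow _))).ne_zero (hb.den i)⟩

namespace CyclotomicPlace

theorem one_sub_base_ne (h : CyclotomicPlace v q d ζ) {i : ℕ} (hi : i + 1 < d) :
    1 - (ζ ^ 4) ^ (i + 1) ≠ 0 := by
  rw [← pow_mul]
  refine h.one_sub_ne fun hd => ?_
  have hc : Nat.Coprime d 4 := by
    rw [show (4 : ℕ) = 2 ^ 2 by norm_num]
    exact (Nat.coprime_two_right.mpr h.odd).pow_right 2
  exact Nat.not_dvd_of_pos_of_lt (Nat.succ_pos i) hi (hc.dvd_of_dvd_mul_left hd)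

theorem res_wpRatio (h : CyclotomicPlace v q d ζ) {u : K} (hu : Res v u 1) {k : ℕ} (hk : k < d) :
    Res v (wpRatio q (q ^ 4) u k) (wpRatio ζ (ζ ^ 4) 1 k) := by
  refine Res.prod fun i hi => ?_
  have hi := Finset.mem_range.mp hi
  have hp := h.res.pow 4
  exact (Res.one.sub ((hu.mul h.res).mul (hp.pow i))).div (hu.sub (hp.pow (i + 1)))
    (h.one_sub_base_ne (by omega))

theorem res_wpWeight (h : CyclotomicPlace v q d ζ) {b₀ b₁ c₀ c₁ : K}
    {β₀ β₁ γ₀ γ₁ : IsLocalRing.ResidueField v.valuationSubring}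
    (hb₀ : Res v b₀ β₀) (hb₁ : Res v b₁ β₁) (hc₀ : Res v c₀ γ₀) (hc₁ : Res v c₁ γ₁)
    (hb : ∀ i, β₁ - ζ * β₀ * (ζ ^ 4) ^ (i + 1) ≠ 0)
    (hc : ∀ i, γ₁ - ζ * γ₀ * (ζ ^ 4) ^ (i + 1) ≠ 0) (k : ℕ) :
    Res v (wpWeight q (q ^ 4) b₀ b₁ c₀ c₁ k) (wpWeight ζ (ζ ^ 4) β₀ β₁ γ₀ γ₁ k) := by
  refine Res.prod fun i _ => ?_
  have hp := h.res.pow 4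
  exact ((hb₀.sub (hb₁.mul (hp.pow i))).mul (hc₀.sub (hc₁.mul (hp.pow i)))).div
    ((hb₁.sub ((h.res.mul hb₀).mul (hp.pow _))).mul (hc₁.sub ((h.res.mul hc₀).mul (hp.pow _))))
    (mul_ne_zero (hb i) (hc i))

theorem res_vwp (h : CyclotomicPlace v q d ζ) (k : ℕ) :
    Res v ((1 - q * (q ^ 4) ^ (2 * k)) / (1 - q)) ((1 - ζ * (ζ ^ 4) ^ (2 * k)) / (1 - ζ)) := by
  refine (Res.one.sub (h.res.mul ((h.res.pow 4).pow _))).div (Res.one.sub h.res) ?_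
  have := h.one_sub_ne (j := 1) (by rw [Nat.dvd_one]; exact h.one_lt.ne')
  rwa [pow_one] at this

end CyclotomicPlace

end Residues

/-! ### Third differences of the series, and a calculus of difference quotients. -/

section Differences

variable {K Γ : Type*} [Field K] [LinearOrderedCommGroupWithZero Γ] {v : Valuation K Γ}
variable {q : K} {d : ℕ} {ζ : IsLocalRing.ResidueField v.valuationSubring}

namespace CyclotomicPlace

/-- Terms are odd and slopes even under $k\mapsto r-k$. The exponent $e=3$ serves the third
difference at $\Phi_n$, and $e=0$ the vanishing modulo a general $\Phi_d$. -/
theorem sum_wpTerm_slope (h : CyclotomicPlace v q d ζ)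
    {β₀ β₁ γ₀ γ₁ : IsLocalRing.ResidueField v.valuationSubring}
    (hb : ∀ i, β₁ - ζ * β₀ * (ζ ^ 4) ^ (i + 1) ≠ 0)
    (hc : ∀ i, γ₁ - ζ * γ₀ * (ζ ^ 4) ^ (i + 1) ≠ 0) {r : ℕ} (hr : d ∣ 4 * r + 1) (hrd : r < d)
    (e : ℕ) :
    ∑ k ∈ Finset.range (r + 1), wpTerm ζ (ζ ^ 4) β₀ β₁ γ₀ γ₁ 1 1 1 k * wpSlope ζ (ζ ^ 4) k ^ e =
      0 := by
  have := h.charZero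
  have hr' : ζ * (ζ ^ 4) ^ r = 1 := by
    rw [← pow_mul, ← pow_succ', (h.prim.pow_eq_one_iff_dvd _).mpr hr]
  have h1 : ∀ k ∈ Finset.range (r + 1),
      wpTerm ζ (ζ ^ 4) β₀ β₁ γ₀ γ₁ 1 1 1 (r + 1 - 1 - k) * wpSlope ζ (ζ ^ 4) (r + 1 - 1 - k) ^ e =
        -(wpTerm ζ (ζ ^ 4) β₀ β₁ γ₀ γ₁ 1 1 1 k * wpSlope ζ (ζ ^ 4) k ^ e) := by
    intro k hk
    have hk : k ≤ r := by have := Finset.mem_range.mp hk; omega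
    rw [Nat.add_sub_cancel, wpTerm_reflect hr' (pow_ne_zero _ h.zeta_ne)
      (fun i hi => by rw [← pow_succ']; exact h.one_sub_base_ne (by omega)) hb hc hk,
      wpSlope_reflect hr' hk, neg_mul]
  have h2 := Finset.sum_range_reflect (fun k => wpTerm ζ (ζ ^ 4) β₀ β₁ γ₀ γ₁ 1 1 1 k *
    wpSlope ζ (ζ ^ 4) k ^ e) (r + 1)
  rw [Finset.sum_congr rfl h1, Finset.sum_neg_distrib] at h2
  exact neg_eq_self.mp h2

/-- The difference quotient in $u$ reduces to the derivative at $u=1$. The bound on $k$ says that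
$4i+1<d$ for all $i<k$, so the factors $1-\zeta^{4i+1}$ in the slope do not vanish. -/
theorem res_wpRatio_diff (h : CyclotomicPlace v q d ζ) {s : K} (hs : Res v s 1) (hs1 : s - 1 ≠ 0)
    {k : ℕ} (hk : 4 * k < d + 3) :
    Res v ((wpRatio q (q ^ 4) s k - wpRatio q (q ^ 4) 1 k) / (s - 1))
      (-(wpRatio ζ (ζ ^ 4) 1 k * wpSlope ζ (ζ ^ 4) k)) := by
  induction k with
  | zero => simpa [wpRatio, wpSlope] using Res.zero
  | succ k ih =>
    have hp := h.res.pow 4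
    have hB := hp.pow (k + 1)
    have hA := h.res.mul (hp.pow k)
    have hd := h.one_lt
    have nB := h.one_sub_base_ne (i := k) (by omega)
    have nA : 1 - ζ * (ζ ^ 4) ^ k ≠ 0 := by
      rw [← pow_mul, ← pow_succ']
      exact h.one_sub_ne fun hd => Nat.not_dvd_of_pos_of_lt (Nat.succ_pos _) (by omega) hd
    have r1 := Res.one.sub hB
    have r2 := hs.sub hB
    have n1 : 1 - (q ^ 4) ^ (k + 1) ≠ 0 := by
      intro h0; have := r1.eq_one nB; simp [h0] at this
    have n2 : s - (q ^ 4) ^ (k + 1) ≠ 0 := by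
      intro h0; have := r2.eq_one nB; simp [h0] at this
    have e1 : (wpRatio q (q ^ 4) s (k + 1) - wpRatio q (q ^ 4) 1 (k + 1)) / (s - 1) =
        (wpRatio q (q ^ 4) s k - wpRatio q (q ^ 4) 1 k) / (s - 1) *
          ((1 - s * (q * (q ^ 4) ^ k)) / (s - (q ^ 4) ^ (k + 1))) -
        wpRatio q (q ^ 4) 1 k * ((1 - q * (q ^ 4) ^ k * (q ^ 4) ^ (k + 1)) /
          ((s - (q ^ 4) ^ (k + 1)) * (1 - (q ^ 4) ^ (k + 1)))) := by
      have e2 : ∀ u, wpRatio q (q ^ 4) u (k + 1) = wpRatio q (q ^ 4) u k *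
        ((1 - u * q * (q ^ 4) ^ k) / (u - (q ^ 4) ^ (k + 1))) := fun u =>
          Finset.prod_range_succ _ _
      rw [e2, e2]
      generalize wpRatio q (q ^ 4) s k = X
      generalize wpRatio q (q ^ 4) 1 k = Y
      generalize (q ^ 4) ^ (k + 1) = B at *
      generalize (q ^ 4) ^ k = A at *
      field_simp
      ring
    have e3 : -(wpRatio ζ (ζ ^ 4) 1 (k + 1) * wpSlope ζ (ζ ^ 4) (k + 1)) =
        -(wpRatio ζ (ζ ^ 4) 1 k * wpSlope ζ (ζ ^ 4) k) *
          ((1 - 1 * (ζ * (ζ ^ 4) ^ k)) / (1 - (ζ ^ 4) ^ (k + 1))) -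
        wpRatio ζ (ζ ^ 4) 1 k * ((1 - ζ * (ζ ^ 4) ^ k * (ζ ^ 4) ^ (k + 1)) /
          ((1 - (ζ ^ 4) ^ (k + 1)) * (1 - (ζ ^ 4) ^ (k + 1)))) := by
      rw [wpSlope, Finset.sum_range_succ, ← wpSlope, wpRatio, Finset.prod_range_succ, ← wpRatio]
      generalize wpSlope ζ (ζ ^ 4) k = X
      generalize wpRatio ζ (ζ ^ 4) 1 k = Y
      rw [one_mul]
      generalize (ζ ^ 4) ^ (k + 1) = B at *
      generalize ζ * (ζ ^ 4) ^ k = A at *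
      field_simp
      ring
    rw [e1, e3]
    exact ((ih (by omega)).mul ((Res.one.sub (hs.mul hA)).div r2 nB)).sub
      ((h.res_wpRatio Res.one (by omega)).mul ((Res.one.sub (hA.mul hB)).div (r2.mul r1)
        (mul_ne_zero nB nB)))

/-- Since $u,v,w$ enter through a product of one function $\rho$, the alternating combination is a
multiple of $(\rho(s)-\rho(1))^3$. After division by $(s-1)^3$ the sum has residue zero by
`sum_wpTerm_slope`, which discreteness turns into one more order. -/
theorem val_third_diff_wpTerm (h : CyclotomicPlace v q d ζ) {b₀ b₁ c₀ c₁ : K}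
    (hb : UnitPair v q b₀ b₁) (hc : UnitPair v q c₀ c₁) {s : K} (hs : Res v s 1)
    (hs1 : s - 1 ≠ 0) {m : ℕ} (hm : 4 * m + 1 = d) :
    v (∑ k ∈ Finset.range (m + 1), (wpTerm q (q ^ 4) b₀ b₁ c₀ c₁ s s s k -
      3 * wpTerm q (q ^ 4) b₀ b₁ c₀ c₁ s s 1 k + 3 * wpTerm q (q ^ 4) b₀ b₁ c₀ c₁ s 1 1 k -
      wpTerm q (q ^ 4) b₀ b₁ c₀ c₁ 1 1 1 k)) ≤ v (s - 1) ^ 3 * v (1 - q ^ d) := by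
  obtain ⟨β₀, β₁, hb₀, hb₁, hbn⟩ := hb.exists_res h
  obtain ⟨γ₀, γ₁, hc₀, hc₁, hcn⟩ := hc.exists_res h
  have e1 : ∀ k, wpTerm q (q ^ 4) b₀ b₁ c₀ c₁ s s s k -
      3 * wpTerm q (q ^ 4) b₀ b₁ c₀ c₁ s s 1 k + 3 * wpTerm q (q ^ 4) b₀ b₁ c₀ c₁ s 1 1 k -
      wpTerm q (q ^ 4) b₀ b₁ c₀ c₁ 1 1 1 k = (s - 1) ^ 3 *
        ((1 - q * (q ^ 4) ^ (2 * k)) / (1 - q) *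
          ((((q ^ 4) ^ 2 / q)) ^ k * wpWeight q (q ^ 4) b₀ b₁ c₀ c₁ k) * wpRatio q (q ^ 4) 1 k *
          ((wpRatio q (q ^ 4) s k - wpRatio q (q ^ 4) 1 k) / (s - 1)) ^ 3) := by
    intro k
    unfold wpTerm
    rw [div_pow]
    field_simp
    ring
  rw [Finset.sum_congr rfl fun k _ => e1 k, ← Finset.mul_sum, map_mul, map_pow]
  gcongr
  refine h.discrete _ (Res.zero_iff.mp ?_)
  have h0 := h.sum_wpTerm_slope hbn hcn (r := m) (by rw [hm]) (by omega) 3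
  rw [← neg_eq_zero, ← Finset.sum_neg_distrib] at h0
  rw [← h0]
  refine Res.sum fun k hk => ?_
  have hk := Finset.mem_range.mp hk
  have hd := h.one_lt
  have hr := h.res_wpRatio Res.one (k := k) (by omega)
  have := (((h.res_vwp k).mul (((((h.res.pow 4).pow 2).div h.res h.zeta_ne).pow k).mul
    (h.res_wpWeight hb₀ hb₁ hc₀ hc₁ hbn hcn k))).mul hr).mul
      ((h.res_wpRatio_diff hs hs1 (k := k) (by omega)).pow 3)
  convert this using 1
  unfold wpTerm
  ring

end CyclotomicPlace

/-- The sequence `x` and its first `j` difference quotients with step `ε` are integral. -/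
def DiffIntegral (v : Valuation K Γ) (ε : K) : ℕ → (ℕ → K) → Prop
  | 0, x => ∀ i, v (x i) ≤ 1
  | j + 1, x => (∀ i, v (x i) ≤ 1) ∧ DiffIntegral v ε j fun i => (x (i + 1) - x i) / ε

namespace DiffIntegral

variable {ε : K} {j : ℕ} {x y : ℕ → K}

theorem le_one (h : DiffIntegral v ε j x) (i : ℕ) : v (x i) ≤ 1 := by
  cases j with
  | zero => exact h i
  | succ j => exact h.1 i

theorem of_succ (h : DiffIntegral v ε (j + 1) x) : DiffIntegral v ε j x := by
  induction j generalizing x with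
  | zero => exact h.1
  | succ j ih => exact ⟨h.1, ih h.2⟩

theorem shift (h : DiffIntegral v ε j x) : DiffIntegral v ε j fun i => x (i + 1) := by
  induction j generalizing x with
  | zero => exact fun i => h (i + 1)
  | succ j ih => exact ⟨fun i => h.1 (i + 1), ih h.2⟩

theorem add (hx : DiffIntegral v ε j x) (hy : DiffIntegral v ε j y) :
    DiffIntegral v ε j fun i => x i + y i := by
  induction j generalizing x y with
  | zero => exact fun i => v.map_add_le (hx i) (hy i)
  | succ j ih =>
    refine ⟨fun i => v.map_add_le (hx.1 i) (hy.1 i), ?_⟩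
    convert ih hx.2 hy.2 using 2
    ring

/-- Discrete Leibniz rule: $\Delta(xy)_i=\Delta x_i\,y_{i+1}+x_i\,\Delta y_i$. -/
theorem mul (hx : DiffIntegral v ε j x) (hy : DiffIntegral v ε j y) :
    DiffIntegral v ε j fun i => x i * y i := by
  have hxy : ∀ i, v (x i * y i) ≤ 1 := fun i => by
    rw [map_mul]; exact mul_le_one' (hx.le_one i) (hy.le_one i)
  induction j generalizing x y with
  | zero => exact hxy
  | succ j ih =>
    refine ⟨hxy, ?_⟩
    have h1 := ih hx.2 hy.of_succ.shift fun i => by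
      rw [map_mul]; exact mul_le_one' (hx.2.le_one i) (hy.le_one (i + 1))
    have h2 := ih hx.of_succ hy.2 fun i => by
      rw [map_mul]; exact mul_le_one' (hx.le_one i) (hy.2.le_one i)
    convert h1.add h2 using 2
    ring

/-- The difference quotient of $cg^i$ is again geometric with ratio $g$ and constant
$c(g-1)/\varepsilon$. -/
theorem geom {c g : K} (hc : v c ≤ 1) (hg : v g ≤ 1) (hgε : v ((g - 1) / ε) ≤ 1) :
    DiffIntegral v ε j fun i => c * g ^ i := by
  have h1 : ∀ c : K, v c ≤ 1 → ∀ i, v (c * g ^ i) ≤ 1 := fun c hc i => by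
    rw [map_mul, map_pow]; exact mul_le_one' hc (pow_le_one' hg i)
  induction j generalizing c with
  | zero => exact h1 c hc
  | succ j ih =>
    refine ⟨h1 c hc, ?_⟩
    convert ih (c := c * ((g - 1) / ε)) (by rw [map_mul]; exact mul_le_one' hc hgε) using 2
    ring

theorem const {c : K} (hc : v c ≤ 1) : DiffIntegral v ε j fun _ => c := by
  simpa using geom (v := v) (ε := ε) (j := j) (g := 1) hc (by simp) (by simp)

theorem sum {ι : Type*} {s : Finset ι} {f : ι → ℕ → K}
    (h : ∀ a ∈ s, DiffIntegral v ε j (f a)) : DiffIntegral v ε j fun i => ∑ a ∈ s, f a i := by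
  classical
  induction s using Finset.induction_on with
  | empty => simpa using const (v := v) (ε := ε) (j := j) (c := 0) (by simp)
  | insert a s ha ih =>
    simp only [Finset.sum_insert ha]
    exact (h a (Finset.mem_insert_self a s)).add
      (ih fun i hi => h i (Finset.mem_insert_of_mem hi))

theorem prod {ι : Type*} {s : Finset ι} {f : ι → ℕ → K}
    (h : ∀ a ∈ s, DiffIntegral v ε j (f a)) : DiffIntegral v ε j fun i => ∏ a ∈ s, f a i := by
  classical
  induction s using Finset.induction_on with
  | empty => simpa using const (v := v) (ε := ε) (j := j) (c := 1) (by simp)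
  | insert a s ha ih =>
    simp only [Finset.prod_insert ha]
    exact (h a (Finset.mem_insert_self a s)).mul
      (ih fun i hi => h i (Finset.mem_insert_of_mem hi))

theorem third_diff (h : DiffIntegral v ε 3 x) (hε : ε ≠ 0) :
    v (x 3 - 3 * x 2 + 3 * x 1 - x 0) ≤ v ε ^ 3 := by
  have h3 := h.2.2.2 0
  have e : x 3 - 3 * x 2 + 3 * x 1 - x 0 = ε ^ 3 *
      ((((x (0 + 1 + 1 + 1) - x (0 + 1 + 1)) / ε - (x (0 + 1 + 1) - x (0 + 1)) / ε) / ε -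
        ((x (0 + 1 + 1) - x (0 + 1)) / ε - (x (0 + 1) - x 0) / ε) / ε) / ε) := by
    simp only [zero_add, Nat.reduceAdd]
    field_simp
    ring
  rw [e, map_mul, map_pow]
  exact mul_le_of_le_one_right' h3

end DiffIntegral

end Differences

/-! ### The balanced sum and its prefactor. -/

section Balanced

variable {K Γ : Type*} [Field K] [LinearOrderedCommGroupWithZero Γ] {v : Valuation K Γ}

/-- A sequence with integral difference quotients interpolating the values of `balSum` at
`(1, 1, 1)`, `(s, 1, 1)`, `(s, s, 1)` and `(s, s, s)`. -/
def balSeq (q p b₀ b₁ c₀ c₁ : K) (m : ℕ) (s : K) (i : ℕ) : K :=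
  ∑ k ∈ Finset.range (m + 1), p ^ k * balWeight q p b₀ b₁ c₀ c₁ k / qPoch p p k *
    (∏ l ∈ Finset.range k, (1 - q * p ^ l) ^ 3 * ((1 - s * q * p ^ l) / (1 - q * p ^ l)) ^ i) *
    (∏ l ∈ Finset.Ico k m, (1 + -(q ^ 2 * p ^ l) * s ^ i)) *
    ∏ l ∈ Finset.range m, ((1 - p ^ (l + 1)) ^ 3)⁻¹ * ((1 - p ^ (l + 1)) / (s - p ^ (l + 1))) ^ i

/-- For use when $i$ of $u,w,t$ equal $s$ and the others equal $1$: replacing a $1$ by $s$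
multiplies each factor by a fixed ratio, so each is geometric in $i$. -/
theorem balSum_eq_balSeq {q p b₀ b₁ c₀ c₁ s u w t : K} {m i : ℕ} (h1 : u * w * t = s ^ i)
    (h2 : ∀ l < m, (1 - u * q * p ^ l) * (1 - w * q * p ^ l) * (1 - t * q * p ^ l) =
      (1 - q * p ^ l) ^ 3 * ((1 - s * q * p ^ l) / (1 - q * p ^ l)) ^ i)
    (h3 : ∀ l < m, ((u - p ^ (l + 1)) * (w - p ^ (l + 1)) * (t - p ^ (l + 1)))⁻¹ =
      ((1 - p ^ (l + 1)) ^ 3)⁻¹ * ((1 - p ^ (l + 1)) / (s - p ^ (l + 1))) ^ i) :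
    balSum q p b₀ b₁ c₀ c₁ m u w t = balSeq q p b₀ b₁ c₀ c₁ m s i := by
  refine Finset.sum_congr rfl fun k hk => ?_
  have hk : k ≤ m := by have := Finset.mem_range.mp hk; omega
  rw [div_eq_mul_inv, h1]
  simp only [qPoch, ← Finset.prod_mul_distrib]
  rw [← Finset.prod_inv_distrib]
  congr 1
  · congr 1
    · congr 1
      exact Finset.prod_congr rfl fun l hl => h2 l ((Finset.mem_range.mp hl).trans_le hk)
    · exact Finset.prod_congr rfl fun l _ => by ring
  · exact Finset.prod_congr rfl fun l hl => h3 l (Finset.mem_range.mp hl)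

theorem val_prod_le_one {ι : Type*} {s : Finset ι} {f : ι → K} (h : ∀ i ∈ s, v (f i) ≤ 1) :
    v (∏ i ∈ s, f i) ≤ 1 := by
  rw [map_prod]
  exact Finset.prod_le_one' h

theorem val_prod_eq_one {ι : Type*} {s : Finset ι} {f : ι → K} (h : ∀ i ∈ s, v (f i) = 1) :
    v (∏ i ∈ s, f i) = 1 := by
  rw [map_prod]
  exact Finset.prod_eq_one h

theorem val_natCast_le (k : ℕ) : v (k : K) ≤ 1 := (Res.natCast k).le_one

variable {q : K} {d : ℕ} {ζ : IsLocalRing.ResidueField v.valuationSubring}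

theorem val_balWeight_le (hq : v q = 1) {b₀ b₁ c₀ c₁ : K}
    (hb : UnitPair v q b₀ b₁) (hc : UnitPair v q c₀ c₁) (k : ℕ) :
    v (balWeight q (q ^ 4) b₀ b₁ c₀ c₁ k) ≤ 1 := by
  refine val_prod_le_one fun i _ => ?_
  rw [map_div₀, map_mul v (b₁ - _), hb.den, hc.den, one_mul, div_one]
  refine v.map_sub_le ?_ ?_
  · rw [map_mul]
    exact mul_le_one' hb.le_right hc.le_right
  · simp only [map_mul, map_pow, hq, one_pow, one_mul, mul_one]
    exact mul_le_one' hb.le_left hc.le_left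

theorem val_wpWeight (hb : UnitPair v q b₀ b₁) (hc : UnitPair v q c₀ c₁) (k : ℕ) :
    v (wpWeight q (q ^ 4) b₀ b₁ c₀ c₁ k) = 1 := by
  refine val_prod_eq_one fun i _ => ?_
  rw [map_div₀, map_mul, map_mul, hb.den, hc.den, hb.num, hc.num, one_mul, div_one]

theorem val_prod_one_sub {δ : K} (hδ : v δ ≤ 1) {y : ℕ → K} {m : ℕ} (hy : ∀ i < m, v (y i) ≤ 1) :
    v (∏ i ∈ Finset.range m, (1 - δ * y i) - (1 - δ * ∑ i ∈ Finset.range m, y i)) ≤ v δ ^ 2 := by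
  induction m with
  | zero => simp
  | succ m ih =>
    have ih := ih fun i hi => hy i (by omega)
    have hS : v (∑ i ∈ Finset.range m, y i) ≤ 1 :=
      v.map_sum_le fun i hi => hy i (by have := Finset.mem_range.mp hi; omega)
    rw [Finset.prod_range_succ, Finset.sum_range_succ]
    have hym := hy m (by omega)
    have h1 : v (1 - δ * y m) ≤ 1 := v.map_sub_le (by simp) (by
      rw [map_mul]; exact mul_le_one' hδ hym)
    generalize ∏ i ∈ Finset.range m, (1 - δ * y i) = P at *
    generalize ∑ i ∈ Finset.range m, y i = S at *
    rw [show P * (1 - δ * y m) - (1 - δ * (S + y m)) =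
      (P - (1 - δ * S)) * (1 - δ * y m) + δ ^ 2 * (S * y m) by ring]
    refine v.map_add_le ?_ ?_
    · rw [map_mul]
      exact (mul_le_of_le_one_right' h1).trans ih
    · rw [map_mul, map_mul, map_pow]
      exact mul_le_of_le_one_right' (mul_le_one' hS hym)

theorem sum_Icc_one (f : ℕ → K) (m : ℕ) :
    ∑ k ∈ Finset.Icc 1 m, f k = ∑ k ∈ Finset.range m, f (k + 1) := by
  induction m with
  | zero => simp
  | succ m ih => rw [Finset.sum_Icc_succ_top (by omega), ih, Finset.sum_range_succ]

/-- The exponents $4k+2$ and $4k+4$ together are $2,4,\dots,4m$, one from each pair of opposite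
nonzero classes modulo $4m+1$. Since $y/(1-y)^2$ is invariant under $y\mapsto y^{-1}$, this is half
of `sum_root_div_sq` applied to $\zeta^2$. -/
theorem sum_root_half {L : Type*} [Field L] [CharZero L] {ζ : L} {m : ℕ}
    (hζ : IsPrimitiveRoot ζ (4 * m + 1)) :
    (((4 * m + 1 : ℕ) : L) ^ 2 - 1) / 24 +
      (∑ k ∈ Finset.range m, ζ ^ (4 * k + 2) / (1 - ζ ^ (4 * k + 2)) ^ 2 +
        ∑ k ∈ Finset.range m, ζ ^ (4 * k + 4) / (1 - ζ ^ (4 * k + 4)) ^ 2) = 0 := by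
  have hz0 : ζ ≠ 0 := hζ.ne_zero (by omega)
  have hζ2 : IsPrimitiveRoot (ζ ^ 2) (4 * m + 1) :=
    hζ.pow_of_coprime 2 (by rw [Nat.coprime_two_left]; exact ⟨2 * m, by ring⟩)
  have h1 := sum_root_div_sq hζ2 (by omega)
  set a : ℕ → L := fun j => ζ ^ (2 * j) / (1 - ζ ^ (2 * j)) ^ 2 with ha
  have h2 : ∑ j ∈ Finset.range (4 * m + 1), a j = -(((4 * m + 1 : ℕ) : L) ^ 2 - 1) / 12 := by
    rw [← h1]
    exact Finset.sum_congr rfl fun j _ => by simp only [ha, pow_mul]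
  have h3 : ∀ j ≤ 4 * m + 1, a (4 * m + 1 - j) = a j := by
    intro j hj
    have e : ζ ^ (2 * (4 * m + 1 - j)) * ζ ^ (2 * j) = 1 := by
      rw [← pow_add, show 2 * (4 * m + 1 - j) + 2 * j = (4 * m + 1) * 2 by omega, pow_mul,
        hζ.pow_eq_one, one_pow]
    simp only [ha]
    have hy : ζ ^ (2 * j) ≠ 0 := pow_ne_zero _ hz0
    generalize ζ ^ (2 * j) = y at *
    rw [eq_inv_of_mul_eq_one_left e]
    by_cases h1y : y = 1
    · simp [h1y]
    · have n1 : 1 - y ≠ 0 := sub_ne_zero.mpr (Ne.symm h1y)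
      have n2 : y - 1 ≠ 0 := sub_ne_zero.mpr h1y
      have n3 : 1 - y⁻¹ ≠ 0 := by
        intro h0; apply n2; field_simp at h0; simpa using h0
      rw [div_eq_div_iff (pow_ne_zero _ n3) (pow_ne_zero _ n1)]
      field_simp
      ring
  have h4 : ∑ j ∈ Finset.range (4 * m + 1), a j = 2 * ∑ j ∈ Finset.range (2 * m), a (j + 1) := by
    rw [Finset.sum_range_succ', show 4 * m = 2 * m + 2 * m by ring, Finset.sum_range_add,
      ← Finset.sum_range_reflect (fun j => a (2 * m + j + 1))]
    have : ∀ j ∈ Finset.range (2 * m), a (2 * m + (2 * m - 1 - j) + 1) = a (j + 1) := by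
      intro j hj
      have := Finset.mem_range.mp hj
      rw [← h3 (j + 1) (by omega)]
      congr 1
      omega
    rw [Finset.sum_congr rfl this, show a 0 = 0 by simp [ha]]
    ring
  have h5 : ∀ M, ∑ j ∈ Finset.range (2 * M), a (j + 1) =
      ∑ k ∈ Finset.range M, ζ ^ (4 * k + 2) / (1 - ζ ^ (4 * k + 2)) ^ 2 +
        ∑ k ∈ Finset.range M, ζ ^ (4 * k + 4) / (1 - ζ ^ (4 * k + 4)) ^ 2 := by
    intro M
    induction M with
    | zero => simp
    | succ M ih =>
      rw [show 2 * (M + 1) = 2 * M + 1 + 1 by ring, Finset.sum_range_succ, Finset.sum_range_succ,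
        ih, Finset.sum_range_succ, Finset.sum_range_succ]
      simp only [ha, show 2 * (2 * M + 1) = 4 * M + 2 by ring,
        show 2 * (2 * M + 1 + 1) = 4 * M + 4 by ring]
      ring
  rw [h4, h5] at h2
  linear_combination h2 / 2

namespace CyclotomicPlace

/-- Pairing factors, $(1-Ys)(1-Y/s)=(1-Y)^2\bigl(1-\delta Y/(1-Y)^2\bigr)$ with
$\delta=s+s^{-1}-2=(1-q^d)^2/q^d$. To third order only the linear term in $\delta$ survives, and its
coefficient is traded for $B$ by `sum_root_half`. -/
theorem val_prefactor (h : CyclotomicPlace v q d ζ) {m : ℕ} (hm : 4 * m + 1 = d) {s : K}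
    (hs : q ^ d * s = 1) :
    v (qPoch (q ^ 4 * s) (q ^ 4) m * qPoch (q ^ 4 / s) (q ^ 4) m -
      qPoch (q ^ 4) (q ^ 4) m ^ 2 * (1 + qInt q d ^ 2 * swisherB q d)) ≤ v (1 - q ^ d) ^ 3 := by
  have := h.charZero
  have := h.charZero'
  have hd := h.one_lt
  have hs0 : s ≠ 0 := right_ne_zero_of_mul_eq_one hs
  have hqd : q ^ d ≠ 0 := left_ne_zero_of_mul_eq_one hs
  have hs' : s = (q ^ d)⁻¹ := eq_inv_of_mul_eq_one_right hs
  have hvqd : v (q ^ d) = 1 := by rw [map_pow, h.val_q, one_pow]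
  have hD : ∀ i < m, 1 - ζ ^ (4 * i + 4) ≠ 0 := fun i hi => by
    have := h.one_sub_base_ne (i := i) (by omega)
    rwa [← pow_mul, show 4 * (i + 1) = 4 * i + 4 by ring] at this
  have hE : ∀ i < m, 1 - ζ ^ (4 * i + 2) ≠ 0 := fun i hi => by
    refine h.one_sub_ne fun h0 => ?_
    have h1 : d ∣ 2 * i + 1 := (Nat.coprime_two_right.mpr h.odd).dvd_of_dvd_mul_left
      (by rwa [show 2 * (2 * i + 1) = 4 * i + 2 by ring])
    exact Nat.not_dvd_of_pos_of_lt (by omega) (by omega) h1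
  have hvD : ∀ i < m, v (1 - q ^ (4 * i + 4)) = 1 := fun i hi =>
    (h.res_one_sub _).eq_one (hD i hi)
  have hDK : ∀ i < m, 1 - q ^ (4 * i + 4) ≠ 0 := fun i hi h0 => by
    have := hvD i hi; simp [h0] at this
  set t := 1 - q ^ d with ht
  set δ := t ^ 2 / q ^ d with hδ
  have hvt : v t ≤ 1 := h.val_le d
  have hvδ : v δ = v t ^ 2 := by rw [hδ, map_div₀, hvqd, div_one, map_pow]
  set y : ℕ → K := fun i => q ^ (4 * i + 4) / (1 - q ^ (4 * i + 4)) ^ 2 with hy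
  have hvy : ∀ i < m, v (y i) ≤ 1 := fun i hi => by
    rw [hy, map_div₀, map_pow v (1 - _), hvD i hi, map_pow, h.val_q]; simp
  have e1 : qPoch (q ^ 4 * s) (q ^ 4) m * qPoch (q ^ 4 / s) (q ^ 4) m =
      qPoch (q ^ 4) (q ^ 4) m ^ 2 * ∏ i ∈ Finset.range m, (1 - δ * y i) := by
    simp only [qPoch, ← Finset.prod_pow, ← Finset.prod_mul_distrib]
    refine Finset.prod_congr rfl fun i hi => ?_
    have n1 := hDK i (Finset.mem_range.mp hi)
    have e2 : q ^ 4 * (q ^ 4) ^ i = q ^ (4 * i + 4) := by ring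
    simp only [hy, hδ, ht, hs']
    rw [mul_right_comm, e2, div_inv_eq_mul, mul_right_comm, e2]
    generalize q ^ (4 * i + 4) = Y at *
    generalize q ^ d = Q at *
    field_simp
    ring
  set E : K := ((d : K) ^ 2 - 1) / 24 +
    ∑ k ∈ Finset.range m, q ^ (4 * k + 2) / (1 - q ^ (4 * k + 2)) ^ 2 with hEdef
  have e2 : qInt q d ^ 2 * swisherB q d = t ^ 2 * E := by
    have hq1 : 1 - q ≠ 0 := by simpa using h.one_sub_ne_zero one_ne_zero
    have hmd : (d - 1) / 4 = m := by omega
    rw [swisherB, hmd, sum_Icc_one, hEdef, qInt, mul_add, mul_add, Finset.mul_sum,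
      Finset.mul_sum]
    congr 1
    · rw [ht]; field_simp
    · refine Finset.sum_congr rfl fun k hk => ?_
      have n1 : 1 - q ^ (4 * k + 2) ≠ 0 := h.one_sub_ne_zero (by omega)
      rw [show 4 * (k + 1) - 2 = 4 * k + 2 by omega, ht, qInt]
      field_simp
  -- The exponents $4i+4$ come from the prefactor and $4k+2$ from $B$; together their residues make
  -- up `sum_root_half`.
  have hYE : v (E + ∑ i ∈ Finset.range m, y i) ≤ v t := by
    refine h.discrete _ (Res.zero_iff.mp ?_)
    have h0 := sum_root_half (m := m) (by rw [hm]; exact h.prim)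
    rw [← add_assoc] at h0
    rw [← h0, hm]
    have h24 : ((24 : ℕ) : IsLocalRing.ResidueField v.valuationSubring) ≠ 0 := by norm_num
    refine ((((Res.natCast d).pow 2).sub Res.one).div (Res.natCast 24) h24).add
      (Res.sum fun k hk => ?_) |>.add (Res.sum fun k hk => ?_)
    · exact (h.res.pow _).div ((h.res_one_sub _).pow 2)
        (pow_ne_zero _ (hE k (Finset.mem_range.mp hk)))
    · exact (h.res.pow _).div ((h.res_one_sub _).pow 2)
        (pow_ne_zero _ (hD k (Finset.mem_range.mp hk)))
  have hvY : v (∑ i ∈ Finset.range m, y i) ≤ 1 :=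
    v.map_sum_le fun i hi => hvy i (Finset.mem_range.mp hi)
  have hP : v (qPoch (q ^ 4) (q ^ 4) m) ≤ 1 := val_prod_le_one fun i _ => by
    rw [← pow_mul, ← pow_add]; exact h.val_le _
  have hprod := val_prod_one_sub (hvδ ▸ pow_le_one' hvt 2) hvy
  rw [e1, e2, ← mul_sub, map_mul, map_pow]
  refine (mul_le_of_le_one_left' (pow_le_one' hP 2)).trans ?_
  generalize ∏ i ∈ Finset.range m, (1 - δ * y i) = R at *
  generalize ∑ i ∈ Finset.range m, y i = Y at *
  have e3 : R - (1 + t ^ 2 * E) = (R - (1 - δ * Y)) - (t ^ 2 * (E + Y) + t ^ 3 / q ^ d * Y) := by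
    have : δ = t ^ 2 + t ^ 3 / q ^ d := by
      rw [hδ, ht]; field_simp; ring
    rw [this]; ring
  rw [e3]
  refine v.map_sub_le ?_ (v.map_add_le ?_ ?_)
  · refine hprod.trans ?_
    rw [hvδ, ← pow_mul]
    exact pow_le_pow_right_of_le_one' hvt (by norm_num)
  · rw [map_mul, map_pow, pow_succ (v t) 2]
    gcongr
  · rw [map_mul, map_div₀, hvqd, div_one, map_pow]
    exact mul_le_of_le_one_right' hvY

end CyclotomicPlace

end Balanced

/-! ### The congruence modulo the fourth power of $\Phi_n$. -/

section Full

variable {K Γ : Type*} [Field K] [LinearOrderedCommGroupWithZero Γ] {v : Valuation K Γ}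
variable {q : K} {d : ℕ} {ζ : IsLocalRing.ResidueField v.valuationSubring}

/-- The balanced sum on the right-hand side of the congruences. -/
def balClosed (q b₀ b₁ c₀ c₁ : K) (m : ℕ) : K :=
  ∑ k ∈ Finset.range (m + 1), qPoch q (q ^ 4) k ^ 3 /
    (qPoch (q ^ 4) (q ^ 4) k * qPoch (q ^ 2) (q ^ 4) k) *
      (balWeight q (q ^ 4) b₀ b₁ c₀ c₁ k * (q ^ 4) ^ k)

theorem qPoch_mul_balClosed {b₀ b₁ c₀ c₁ : K} {m : ℕ}
    (hp : ∀ i < m, 1 - q ^ 4 * (q ^ 4) ^ i ≠ 0) (h2 : ∀ i < m, 1 - q ^ 2 * (q ^ 4) ^ i ≠ 0) :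
    qPoch (q ^ 2) (q ^ 4) m / qPoch (q ^ 4) (q ^ 4) m * balClosed q b₀ b₁ c₀ c₁ m =
      qPoch (q ^ 4) (q ^ 4) m ^ 2 * balSum q (q ^ 4) b₀ b₁ c₀ c₁ m 1 1 1 := by
  have e1 : ∏ i ∈ Finset.range m, (1 - (q ^ 4) ^ (i + 1)) = qPoch (q ^ 4) (q ^ 4) m := by
    simp only [qPoch, pow_succ']
  have n1 := qPoch_ne_zero hp
  rw [balClosed, balSum, Finset.mul_sum, Finset.mul_sum, e1]
  refine Finset.sum_congr rfl fun k hk => ?_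
  have hk : k ≤ m := by have := Finset.mem_range.mp hk; omega
  have n2 := qPoch_ne_zero (a := q ^ 2) (p := q ^ 4) (k := k) fun i hi => h2 i (hi.trans_le hk)
  have e2 : qPoch (q ^ 2) (q ^ 4) m = qPoch (q ^ 2) (q ^ 4) k *
      ∏ i ∈ Finset.Ico k m, (1 - q ^ 2 * (q ^ 4) ^ i) := by
    simp only [qPoch, ← Finset.prod_range_mul_prod_Ico _ hk]
  simp only [one_mul, mul_one]
  rw [e2, mul_comm ((q ^ 4) ^ k), div_mul_eq_div_div]
  generalize ∏ i ∈ Finset.Ico k m, (1 - q ^ 2 * (q ^ 4) ^ i) = I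
  generalize qPoch (q ^ 2) (q ^ 4) k = Q at *
  generalize qPoch (q ^ 4) (q ^ 4) m = P at *
  generalize qPoch q (q ^ 4) k = A
  generalize qPoch (q ^ 4) (q ^ 4) k = D
  field_simp

/-- Every factor is constant, geometric with ratio congruent to $1$ modulo $s-1$, or a constant plus
a multiple of $s^i$. All denominators are units because $4m+1=d$ keeps their exponents away from
multiples of $d$. -/
theorem DiffIntegral.balSeq (h : CyclotomicPlace v q d ζ) {b₀ b₁ c₀ c₁ : K}
    (hb : UnitPair v q b₀ b₁) (hc : UnitPair v q c₀ c₁) {m : ℕ} (hm : 4 * m + 1 = d)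
    {s : K} (hs : Res v s 1) (hs1 : s - 1 ≠ 0) :
    DiffIntegral v (s - 1) 3 (balSeq q (q ^ 4) b₀ b₁ c₀ c₁ m s) := by
  have hd := h.one_lt
  have hA : ∀ l < m, v (1 - q * (q ^ 4) ^ l) = 1 := fun l hl => by
    rw [← pow_mul, ← pow_succ']
    exact h.val_eq_one fun h0 => Nat.not_dvd_of_pos_of_lt (Nat.succ_pos _) (by omega) h0
  have hB : ∀ l < m, v (1 - (q ^ 4) ^ (l + 1)) = 1 := fun l hl =>
    (Res.one.sub ((h.res.pow 4).pow (l + 1))).eq_one (h.one_sub_base_ne (by omega))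
  have hsB : ∀ l < m, v (s - (q ^ 4) ^ (l + 1)) = 1 := fun l hl =>
    (hs.sub ((h.res.pow 4).pow (l + 1))).eq_one (h.one_sub_base_ne (by omega))
  have ne : ∀ x : K, v x = 1 → x ≠ 0 := fun x hx h0 => by simp [h0] at hx
  have hvs : v s = 1 := hs.eq_one one_ne_zero
  have hvε : v (s - 1) ≠ 0 := (Valuation.ne_zero_iff v).mpr hs1
  refine DiffIntegral.sum fun k hk => ?_
  have hk : k ≤ m := by have := Finset.mem_range.mp hk; omega
  refine ((DiffIntegral.const ?_).mul (DiffIntegral.prod fun l hl => ?_)).mul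
    (DiffIntegral.prod fun l hl => ?_) |>.mul (DiffIntegral.prod fun l hl => ?_)
  · have : v (qPoch (q ^ 4) (q ^ 4) k) = 1 := val_prod_eq_one fun l hl => by
      rw [← pow_succ']; exact hB l ((Finset.mem_range.mp hl).trans_le hk)
    rw [map_div₀, this, div_one, map_mul, map_pow, map_pow, h.val_q]
    simpa using val_balWeight_le h.val_q hb hc k
  · have hl := (Finset.mem_range.mp hl).trans_le hk
    have n1 := ne _ (hA l hl)
    refine DiffIntegral.geom ?_ ?_ ?_
    · rw [map_pow, hA l hl, one_pow]
    · rw [map_div₀, hA l hl, div_one]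
      exact (Res.one.sub ((hs.mul h.res).mul ((h.res.pow 4).pow l))).le_one
    · rw [show ((1 - s * q * (q ^ 4) ^ l) / (1 - q * (q ^ 4) ^ l) - 1) / (s - 1) =
        -(q * (q ^ 4) ^ l) / (1 - q * (q ^ 4) ^ l) by field_simp; ring, map_div₀, hA l hl, div_one]
      exact (h.res.mul ((h.res.pow 4).pow l)).neg.le_one
  · refine (DiffIntegral.const (by simp)).add (DiffIntegral.geom ?_ hvs.le ?_)
    · exact ((h.res.pow 2).mul ((h.res.pow 4).pow l)).neg.le_one
    · rw [div_self hs1, map_one]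
  · have hl := Finset.mem_range.mp hl
    have n1 := ne _ (hsB l hl)
    refine DiffIntegral.geom ?_ ?_ ?_
    · rw [map_inv₀, map_pow, hB l hl]; simp
    · rw [map_div₀, hB l hl, hsB l hl, div_one]
    · rw [show ((1 - (q ^ 4) ^ (l + 1)) / (s - (q ^ 4) ^ (l + 1)) - 1) / (s - 1) =
        -1 / (s - (q ^ 4) ^ (l + 1)) by field_simp; ring, map_div₀, hsB l hl]
      simp

theorem CyclotomicPlace.val_sum_sub_closed (h : CyclotomicPlace v q d ζ) {b₀ b₁ c₀ c₁ : K}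
    (hb : UnitPair v q b₀ b₁) (hc : UnitPair v q c₀ c₁) {m : ℕ} (hm : 4 * m + 1 = d) :
    v (∑ k ∈ Finset.range (m + 1), wpTerm q (q ^ 4) b₀ b₁ c₀ c₁ 1 1 1 k -
      swisherClosed q d * balClosed q b₀ b₁ c₀ c₁ m) ≤ v (1 - q ^ d) ^ 4 := by
  have hd := h.one_lt
  have hq0 := h.q_ne
  have hqd : q ^ d ≠ 0 := pow_ne_zero _ hq0
  set s : K := (q ^ d)⁻¹ with hsdef
  have hqs : q ^ d * s = 1 := mul_inv_cancel₀ hqd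
  have hs0 : s ≠ 0 := inv_ne_zero hqd
  have hs : Res v s 1 := by
    have := (h.res.pow d).inv (by rw [h.prim.pow_eq_one]; exact one_ne_zero)
    rwa [h.prim.pow_eq_one, inv_one] at this
  have hvε : v (s - 1) = v (1 - q ^ d) := by
    rw [show s - 1 = (1 - q ^ d) / q ^ d by rw [hsdef]; field_simp, map_div₀, map_pow v q, h.val_q,
      one_pow, div_one]
  have hs1 : s - 1 ≠ 0 := by
    rw [← Valuation.ne_zero_iff v, hvε]; exact h.val_ne (by omega)
  have hqsp : q * s * (q ^ 4) ^ m = 1 := by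
    rw [← hqs, ← hm]; ring
  have hp : ∀ i, 1 - q ^ 4 * (q ^ 4) ^ i ≠ 0 := fun i => by
    rw [← pow_mul, ← pow_add]; exact h.one_sub_ne_zero (by omega)
  have h2 : ∀ i, 1 - q ^ 2 * (q ^ 4) ^ i ≠ 0 := fun i => by
    rw [← pow_mul, ← pow_add]; exact h.one_sub_ne_zero (by omega)
  have ha : ∀ i, 1 - q * (q ^ 4) ^ i ≠ 0 := fun i => by
    rw [← pow_mul, ← pow_succ']; exact h.one_sub_ne_zero (by omega)
  have hsB : ∀ l < m, s - (q ^ 4) ^ (l + 1) ≠ 0 := fun l hl h0 => by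
    have := (hs.sub ((h.res.pow 4).pow (l + 1))).eq_one (h.one_sub_base_ne (by omega))
    simp [h0] at this
  have h1B : ∀ l < m, 1 - (q ^ 4) ^ (l + 1) ≠ 0 := fun l _ => by
    rw [pow_succ']; exact hp l
  -- The first parameter stays at $s$, which terminates the series; the other two range over $1$ and
  -- $s$ with the same prefactor throughout.
  have W : ∀ {y z : K}, y ≠ 0 → z ≠ 0 → (∀ l < m, y - (q ^ 4) ^ (l + 1) ≠ 0) →
      (∀ l < m, z - (q ^ 4) ^ (l + 1) ≠ 0) → _ := fun hy hz hy' hz' =>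
    sum_wpTerm hq0 (pow_ne_zero 4 hq0) hp ha hb.ne_zero hc.ne_zero hqsp hy hz hsB hy' hz'
  have w1 := W one_ne_zero one_ne_zero h1B h1B
  have w2 := W hs0 one_ne_zero hsB h1B
  have w3 := W hs0 hs0 hsB hsB
  have hX := (DiffIntegral.balSeq h hb hc hm hs hs1)
  have x0 : balSum q (q ^ 4) b₀ b₁ c₀ c₁ m 1 1 1 = balSeq q (q ^ 4) b₀ b₁ c₀ c₁ m s 0 :=
    balSum_eq_balSeq (by ring) (fun l _ => by ring) (fun l _ => by rw [pow_zero, mul_one]; ring)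
  have x1 : balSum q (q ^ 4) b₀ b₁ c₀ c₁ m s 1 1 = balSeq q (q ^ 4) b₀ b₁ c₀ c₁ m s 1 :=
    balSum_eq_balSeq (by ring) (fun l _ => by have := ha l; field_simp)
      (fun l hl => by have := hsB l hl; have := h1B l hl; field_simp)
  have x2 : balSum q (q ^ 4) b₀ b₁ c₀ c₁ m s s 1 = balSeq q (q ^ 4) b₀ b₁ c₀ c₁ m s 2 :=
    balSum_eq_balSeq (by ring) (fun l _ => by have := ha l; field_simp)
      (fun l hl => by have := hsB l hl; have := h1B l hl; field_simp)
  have x3 : balSum q (q ^ 4) b₀ b₁ c₀ c₁ m s s s = balSeq q (q ^ 4) b₀ b₁ c₀ c₁ m s 3 :=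
    balSum_eq_balSeq (by ring) (fun l _ => by have := ha l; field_simp)
      (fun l hl => by have := hsB l hl; have := h1B l hl; field_simp)
  have hT := h.val_third_diff_wpTerm hb hc hs hs1 hm
  have hX3 := hX.third_diff hs1
  have hX0 := hX.le_one 0
  have hpre := h.val_prefactor hm hqs
  have hcl := qPoch_mul_balClosed (q := q) (b₀ := b₀) (b₁ := b₁) (c₀ := c₀) (c₁ := c₁) (m := m)
    (fun i _ => hp i) (fun i _ => h2 i)
  rw [x0] at hcl
  rw [x1] at w1
  rw [x2] at w2
  rw [x3] at w3
  simp only [Finset.sum_sub_distrib, Finset.sum_add_distrib, ← Finset.mul_sum] at hT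
  rw [w1, w2, w3, hvε] at hT
  rw [hvε] at hX3
  have hclosed : swisherClosed q d * balClosed q b₀ b₁ c₀ c₁ m =
      (1 - q * (q ^ 4) ^ m) / (1 - q) * (q ^ m)⁻¹ *
        (qPoch (q ^ 4) (q ^ 4) m ^ 2 * (1 + qInt q d ^ 2 * swisherB q d)) *
          balSeq q (q ^ 4) b₀ b₁ c₀ c₁ m s 0 := by
    have e1 : q ^ ((1 - (d : ℤ)) / 4) = (q ^ m)⁻¹ := by
      rw [show (1 - (d : ℤ)) / 4 = -(m : ℤ) by omega, zpow_neg, zpow_natCast]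
    have e2 : qInt q d = (1 - q * (q ^ 4) ^ m) / (1 - q) := by
      rw [qInt, ← hm, ← pow_mul, ← pow_succ']
    rw [swisherClosed, show (d - 1) / 4 = m by omega, e1, ← e2]
    linear_combination (qInt q d * (q ^ m)⁻¹ * (1 + qInt q d ^ 2 * swisherB q d)) * hcl
  rw [hclosed]
  set N : K := (1 - q * (q ^ 4) ^ m) / (1 - q) * (q ^ m)⁻¹ with hN
  have hvN : v N = v (1 - q ^ d) := by
    have h1 : v (1 - q) = 1 := by
      have := h.val_eq_one (j := 1) (by rw [Nat.dvd_one]; omega)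
      rwa [pow_one] at this
    rw [hN, map_mul, map_div₀, h1, map_inv₀, map_pow, h.val_q, ← pow_mul, ← pow_succ', hm]
    simp
  have hvs1 : v (qPoch (q ^ 4 * s) (q ^ 4) m * qPoch (q ^ 4 / s) (q ^ 4) m) ≤ 1 := by
    rw [map_mul]
    have hvs := hs.eq_one one_ne_zero
    refine mul_le_one' (val_prod_le_one fun i _ => v.map_sub_le (by simp) ?_)
      (val_prod_le_one fun i _ => v.map_sub_le (by simp) ?_) <;>
    simp [hvs, h.val_q]
  generalize balSeq q (q ^ 4) b₀ b₁ c₀ c₁ m s 0 = X₀ at *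
  generalize balSeq q (q ^ 4) b₀ b₁ c₀ c₁ m s 1 = X₁ at *
  generalize balSeq q (q ^ 4) b₀ b₁ c₀ c₁ m s 2 = X₂ at *
  generalize balSeq q (q ^ 4) b₀ b₁ c₀ c₁ m s 3 = X₃ at *
  generalize qPoch (q ^ 4 * s) (q ^ 4) m * qPoch (q ^ 4 / s) (q ^ 4) m = R at *
  generalize ∑ k ∈ Finset.range (m + 1), wpTerm q (q ^ 4) b₀ b₁ c₀ c₁ 1 1 1 k = S at *
  generalize qPoch (q ^ 4) (q ^ 4) m ^ 2 * (1 + qInt q d ^ 2 * swisherB q d) = R' at *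
  -- Three errors of order four: the balanced third difference and the prefactor error, each of
  -- order three times $N$, and the third difference of the series.
  have e : S - N * R' * X₀ = N * R * (X₃ - 3 * X₂ + 3 * X₁ - X₀) + N * (R - R') * X₀ -
    (N * R * X₃ - 3 * (N * R * X₂) + 3 * (N * R * X₁) - S) := by ring
  rw [e]
  refine v.map_sub_le (v.map_add_le ?_ ?_) ?_
  · rw [map_mul, map_mul, hvN, pow_succ' _ 3]
    gcongr
    exact mul_le_of_le_one_right' hvs1
  · rw [map_mul, map_mul, hvN, pow_succ' _ 3]
    exact (mul_le_of_le_one_right' hX0).trans (by gcongr)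
  · rwa [pow_succ _ 3]

end Full

/-! ### Divisibility of both sides by $\Phi_d$ for $d\mid n$, and the tail. -/

section Divisors

variable {K Γ : Type*} [Field K] [LinearOrderedCommGroupWithZero Γ] {v : Valuation K Γ}
variable {q : K} {d : ℕ} {ζ : IsLocalRing.ResidueField v.valuationSubring}

theorem val_qPoch (a k : ℕ) :
    v (qPoch (q ^ a) (q ^ 4) k) = ∏ i ∈ Finset.range k, v (1 - q ^ (a + 4 * i)) := by
  rw [qPoch, map_prod]
  simp only [← pow_mul, ← pow_add]

namespace CyclotomicPlace

theorem coprime_four (h : CyclotomicPlace v q d ζ) : Nat.Coprime d 4 := by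
  rw [show (4 : ℕ) = 2 ^ 2 by norm_num]
  exact (Nat.coprime_two_right.mpr h.odd).pow_right 2

theorem exists_dvd_progression (h : CyclotomicPlace v q d ζ) (a : ℕ) :
    ∃ i < d, d ∣ a + 4 * i := by
  obtain ⟨t, ht⟩ := Nat.exists_mul_mod_eq_one_of_coprime h.coprime_four.symm h.one_lt
  have hd := h.one_lt
  refine ⟨(t * ((d - 1) * a)) % d, Nat.mod_lt _ (by omega), ?_⟩
  have h1 : 4 * t ≡ 1 [MOD d] := by rw [Nat.ModEq, ht.2, Nat.mod_eq_of_lt hd]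
  have h2 : a + 4 * ((t * ((d - 1) * a)) % d) ≡ a + 1 * ((d - 1) * a) [MOD d] := by
    refine Nat.ModEq.add_left _ (((Nat.mod_modEq _ _).mul_left 4).trans ?_)
    rw [← mul_assoc]
    exact h1.mul_right _
  rw [← Nat.modEq_zero_iff_dvd]
  refine h2.trans ((Nat.modEq_zero_iff_dvd).mpr ⟨a, ?_⟩)
  obtain ⟨e, rfl⟩ := Nat.exists_eq_add_of_le' hd.le
  rw [Nat.add_sub_cancel]
  ring

/-- Any $d$ consecutive terms of a progression of step $4$ contain a multiple of $d$; for
$4,8,12,\dots$ it comes last in each block. Hence the product on the left collects at least as many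
factors $\Phi_d$. -/
theorem prod_val_progression_le (h : CyclotomicPlace v q d ζ) {a : ℕ} (ha : a ≠ 0) (k : ℕ) :
    ∏ i ∈ Finset.range k, v (1 - q ^ (a + 4 * i)) ≤
      ∏ i ∈ Finset.range k, v (1 - q ^ (4 + 4 * i)) := by
  have hd := h.one_lt
  have hdiv : ∀ i, d ∣ 4 + 4 * i ↔ d ∣ i + 1 := fun i => by
    rw [show 4 + 4 * i = 4 * (i + 1) by ring]
    exact h.coprime_four.dvd_mul_left
  have hone : ∀ i < d - 1, v (1 - q ^ (4 + 4 * i)) = 1 := fun i hi =>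
    h.val_eq_one fun h0 => Nat.not_dvd_of_pos_of_lt (Nat.succ_pos i) (by omega) ((hdiv i).mp h0)
  induction k using Nat.strong_induction_on with
  | _ k ih =>
    rcases lt_or_ge k d with hk | hk
    · rw [Finset.prod_eq_one fun i hi => hone i (by have := Finset.mem_range.mp hi; omega)]
      exact Finset.prod_le_one' fun i _ => h.val_le _
    · obtain ⟨l, rfl⟩ := Nat.exists_eq_add_of_le hk
      have hshift : ∀ b ≠ 0, ∏ i ∈ Finset.range l, v (1 - q ^ (b + 4 * (d + i))) =
          ∏ i ∈ Finset.range l, v (1 - q ^ (b + 4 * i)) := fun b hb =>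
        Finset.prod_congr rfl fun i _ => h.val_congr (by omega) (by omega) (by
          rw [show b + 4 * (d + i) = b + 4 * i + d * 4 by ring]
          exact (Nat.dvd_add_iff_left (Dvd.intro 4 rfl)).symm)
      rw [Finset.prod_range_add, Finset.prod_range_add, hshift a ha, hshift 4 (by norm_num)]
      refine mul_le_mul' ?_ (ih l (by omega))
      obtain ⟨i, hi, hid⟩ := h.exists_dvd_progression a
      rw [← Finset.mul_prod_erase _ _ (Finset.mem_range.mpr hi), h.val_dvd hid (by omega)]
      refine (mul_le_of_le_one_right' (Finset.prod_le_one' fun i _ => h.val_le _)).trans_eq ?_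
      obtain ⟨e, he⟩ := Nat.exists_eq_add_of_le' hd.le
      rw [he, Finset.prod_range_succ,
        Finset.prod_eq_one fun i hi => hone i (by have := Finset.mem_range.mp hi; omega), one_mul,
        h.val_dvd (j := 4 + 4 * e) ((hdiv e).mpr he.dvd) (by omega), ← he]

theorem val_wpRatio_le (h : CyclotomicPlace v q d ζ) (k : ℕ) :
    v (wpRatio q (q ^ 4) 1 k) ≤ 1 := by
  have h1 := val_qPoch (v := v) (q := q) 1 k
  rw [pow_one] at h1
  rw [wpRatio_one, map_div₀, h1, val_qPoch]
  refine div_le_one_of_le₀ (h.prod_val_progression_le one_ne_zero k) zero_le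

theorem val_wpCore (h : CyclotomicPlace v q d ζ) {b₀ b₁ c₀ c₁ : K}
    (hb : UnitPair v q b₀ b₁) (hc : UnitPair v q c₀ c₁) (k : ℕ) :
    v (wpCore q (q ^ 4) b₀ b₁ c₀ c₁ k) = v (wpRatio q (q ^ 4) 1 k) ^ 4 := by
  rw [wpCore, map_mul, map_mul, val_wpWeight hb hc, mul_one]
  simp [h.val_q]

/-- Within a block the step ratios have residues depending only on $j$, by $\zeta^d=1$, and their
denominators are units while $j+1<d$. So the residues of a block are those of the initial block
scaled by the residue $c$ of the core at $dN$. -/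
theorem res_wpTerm_add (h : CyclotomicPlace v q d ζ) {b₀ b₁ c₀ c₁ : K}
    (hb : UnitPair v q b₀ b₁) (hc : UnitPair v q c₀ c₁)
    {β₀ β₁ γ₀ γ₁ : IsLocalRing.ResidueField v.valuationSubring}
    (hb₀ : Res v b₀ β₀) (hb₁ : Res v b₁ β₁) (hc₀ : Res v c₀ γ₀) (hc₁ : Res v c₁ γ₁)
    (hbn : ∀ i, β₁ - ζ * β₀ * (ζ ^ 4) ^ (i + 1) ≠ 0)
    (hcn : ∀ i, γ₁ - ζ * γ₀ * (ζ ^ 4) ^ (i + 1) ≠ 0) (N : ℕ) :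
    ∃ c, ∀ j < d, Res v (wpTerm q (q ^ 4) b₀ b₁ c₀ c₁ 1 1 1 (d * N + j))
      (c * wpTerm ζ (ζ ^ 4) β₀ β₁ γ₀ γ₁ 1 1 1 j) := by
  obtain ⟨c, hcore⟩ := Res.of_le (v := v) (x := wpCore q (q ^ 4) b₀ b₁ c₀ c₁ (d * N))
    (by rw [h.val_wpCore hb hc]; exact pow_le_one' (h.val_wpRatio_le _) 4)
  have hpow : ∀ j e, Res v ((q ^ 4) ^ (e * (d * N + j))) ((ζ ^ 4) ^ (e * j)) := fun j e => by
    have := (h.res.pow 4).pow (e * (d * N + j))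
    have e1 : (ζ ^ 4) ^ (e * (d * N + j)) = (ζ ^ 4) ^ (e * j) := by
      rw [← pow_mul, show 4 * (e * (d * N + j)) = d * (4 * e * N) + 4 * (e * j) by ring, pow_add,
        pow_mul ζ d, h.prim.pow_eq_one, one_pow, one_mul, pow_mul]
    rwa [e1] at this
  have hpow' : ∀ j, Res v ((q ^ 4) ^ (d * N + j)) ((ζ ^ 4) ^ j) := fun j => by
    simpa using hpow j 1
  have hp := h.res.pow 4
  refine ⟨c, fun j hj => ?_⟩
  have hind : Res v (wpCore q (q ^ 4) b₀ b₁ c₀ c₁ (d * N + j))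
      (c * wpCore ζ (ζ ^ 4) β₀ β₁ γ₀ γ₁ j) := by
    induction j with
    | zero => simpa [wpCore, wpWeight, wpRatio] using hcore
    | succ j ih =>
      rw [← add_assoc, wpCore_succ, wpCore_succ, ← mul_assoc c]
      refine (ih (by omega)).mul ((((hp.pow 2).div h.res h.zeta_ne).mul
        (((hb₀.sub (hb₁.mul (hpow' j))).div (hb₁.sub ((h.res.mul hb₀).mul (hp.mul (hpow' j)))) ?_).mul
        ((hc₀.sub (hc₁.mul (hpow' j))).div (hc₁.sub ((h.res.mul hc₀).mul (hp.mul (hpow' j)))) ?_))).mul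
        (((Res.one.sub (h.res.mul (hpow' j))).div (Res.one.sub (hp.mul (hpow' j))) ?_).pow 4))
      · rw [← pow_succ']; exact hbn j
      · rw [← pow_succ']; exact hcn j
      · rw [← pow_succ']; exact h.one_sub_base_ne hj
  have hz1 : 1 - ζ ≠ 0 := by
    have := h.one_sub_ne (j := 1) (by rw [Nat.dvd_one]; exact h.one_lt.ne')
    rwa [pow_one] at this
  rw [wpTerm_one, wpTerm_one, mul_left_comm]
  exact ((Res.one.sub (h.res.mul (hpow j 2))).div (Res.one.sub h.res) hz1).mul hind

theorem val_sum_wpTerm_lt (h : CyclotomicPlace v q d ζ) {b₀ b₁ c₀ c₁ : K}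
    (hb : UnitPair v q b₀ b₁) (hc : UnitPair v q c₀ c₁) (N : ℕ) :
    v (∑ k ∈ Finset.range (d * N), wpTerm q (q ^ 4) b₀ b₁ c₀ c₁ 1 1 1 k) < 1 ∧
    ∀ r < d, d ∣ 4 * r + 1 →
      v (∑ k ∈ Finset.range (d * N + (r + 1)), wpTerm q (q ^ 4) b₀ b₁ c₀ c₁ 1 1 1 k) < 1 := by
  obtain ⟨β₀, β₁, hb₀, hb₁, hbn⟩ := hb.exists_res h
  obtain ⟨γ₀, γ₁, hc₀, hc₁, hcn⟩ := hc.exists_res h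
  have hadd := h.res_wpTerm_add hb hc hb₀ hb₁ hc₀ hc₁ hbn hcn
  have hpart : ∀ r < d, d ∣ 4 * r + 1 →
      ∑ j ∈ Finset.range (r + 1), wpTerm ζ (ζ ^ 4) β₀ β₁ γ₀ γ₁ 1 1 1 j = 0 := fun r hr hdr => by
    simpa using h.sum_wpTerm_slope hbn hcn hdr hr 0
  have hblock : ∑ j ∈ Finset.range d, wpTerm ζ (ζ ^ 4) β₀ β₁ γ₀ γ₁ 1 1 1 j = 0 := by
    obtain ⟨r, hr, hdr⟩ := h.exists_dvd_progression 1
    rw [add_comm] at hdr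
    rw [← hpart r hr hdr]
    symm
    -- For $r<j<d$ the factor $1-\zeta^{4r+1}=0$ kills the term, so a full block equals the
    -- antisymmetric part $0\le j\le r$.
    refine Finset.sum_subset (Finset.range_subset_range.mpr hr) fun j _ hj => ?_
    have hj : r < j := by simpa using hj
    have : wpRatio ζ (ζ ^ 4) 1 j = 0 := by
      refine Finset.prod_eq_zero (Finset.mem_range.mpr hj) ?_
      rw [one_mul, ← pow_mul, ← pow_succ', (h.prim.pow_eq_one_iff_dvd _).mpr hdr]
      simp
    simp [wpTerm, this]
  have hfull : ∀ N, Res v (∑ k ∈ Finset.range (d * N), wpTerm q (q ^ 4) b₀ b₁ c₀ c₁ 1 1 1 k)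
      0 := by
    intro N
    induction N with
    | zero => simpa using Res.zero
    | succ N ih =>
      obtain ⟨c, hcN⟩ := hadd N
      rw [mul_add, mul_one, Finset.sum_range_add]
      have := ih.add (Res.sum fun j hj => hcN j (Finset.mem_range.mp hj))
      rwa [← Finset.mul_sum, hblock, mul_zero, add_zero] at this
  refine ⟨Res.zero_iff.mp (hfull N), fun r hr hdr => Res.zero_iff.mp ?_⟩
  obtain ⟨c, hcN⟩ := hadd N
  rw [Finset.sum_range_add]
  have := (hfull N).add (Res.sum fun j hj => hcN j
    (lt_of_lt_of_le (Finset.mem_range.mp hj) (Nat.succ_le_of_lt hr)))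
  rwa [← Finset.mul_sum, hpart r hr hdr, mul_zero, add_zero] at this

/-- Past $m$ the numerator contains $1-q^{4m+1}=1-q^d$ to the fourth power, and for $k<d$ no
denominator vanishes at the place. -/
theorem val_wpTerm_tail (h : CyclotomicPlace v q d ζ) {b₀ b₁ c₀ c₁ : K}
    (hb : UnitPair v q b₀ b₁) (hc : UnitPair v q c₀ c₁) {m k : ℕ} (hm : 4 * m + 1 = d)
    (hmk : m < k) (hk : k < d) :
    v (wpTerm q (q ^ 4) b₀ b₁ c₀ c₁ 1 1 1 k) ≤ v (1 - q ^ d) ^ 4 := by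
  rw [wpTerm_one, map_mul, h.val_wpCore hb hc]
  refine (mul_le_of_le_one_left' (h.res_vwp k).le_one).trans ?_
  gcongr
  rw [wpRatio, map_prod, ← Finset.mul_prod_erase _ _ (Finset.mem_range.mpr hmk)]
  have h1 : ∀ i < k, v (1 - (q ^ 4) ^ (i + 1)) = 1 := fun i hi =>
    (Res.one.sub ((h.res.pow 4).pow (i + 1))).eq_one (h.one_sub_base_ne (by omega))
  refine (mul_le_of_le_one_right' (Finset.prod_le_one' fun i hi => ?_)).trans_eq ?_
  · rw [map_div₀, h1 i (Finset.mem_range.mp (Finset.mem_of_mem_erase hi)), div_one, one_mul,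
      ← pow_mul, ← pow_succ']
    exact h.val_le _
  · rw [map_div₀, h1 m hmk, div_one, one_mul, ← pow_mul, ← pow_succ', hm]

/-- Reflection $i\mapsto4m+1-i$ preserves divisibility by $d$ and exchanges the classes
$1\leftrightarrow0$ and $2\leftrightarrow3$ modulo $4$. It equates $(q^4;q^4)_m$ with $(q;q^4)_m$ in
valuation and brings the remaining quotients into the form of `prod_val_progression_le`. -/
theorem val_coeff_le (h : CyclotomicPlace v q d ζ) {m k : ℕ} (hm : d ∣ 4 * m + 1) (hk : k ≤ m) :
    v (qPoch (q ^ 2) (q ^ 4) m / qPoch (q ^ 4) (q ^ 4) m * (qPoch q (q ^ 4) k ^ 3 /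
      (qPoch (q ^ 4) (q ^ 4) k * qPoch (q ^ 2) (q ^ 4) k))) ≤ 1 := by
  have hrefl : ∀ i < 4 * m + 1, i ≠ 0 → v (1 - q ^ (4 * m + 1 - i)) = v (1 - q ^ i) :=
    fun i hi hi0 => h.val_congr (by omega) hi0 (Nat.dvd_sub_iff_right hi.le hm)
  have h1 : ∀ k, v (qPoch q (q ^ 4) k) = ∏ i ∈ Finset.range k, v (1 - q ^ (1 + 4 * i)) :=
    fun k => by simpa using val_qPoch (v := v) (q := q) 1 k
  have hne : ∀ a ≠ 0, ∀ k, ∏ i ∈ Finset.range k, v (1 - q ^ (a + 4 * i)) ≠ 0 := fun a ha k =>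
    Finset.prod_ne_zero_iff.mpr fun i _ => h.val_ne (by omega)
  have e1 : v (qPoch (q ^ 4) (q ^ 4) m) = v (qPoch q (q ^ 4) m) := by
    rw [val_qPoch, h1, ← Finset.prod_range_reflect]
    refine Finset.prod_congr rfl fun i hi => ?_
    have := Finset.mem_range.mp hi
    rw [← hrefl (1 + 4 * i) (by omega) (by omega)]
    congr 3
    omega
  have e2 : ∏ i ∈ Finset.Ico k m, v (1 - q ^ (2 + 4 * i)) ≤
      ∏ i ∈ Finset.Ico k m, v (1 - q ^ (1 + 4 * i)) := by
    have := h.prod_val_progression_le (a := 3) (by norm_num) (m - k)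
    rw [Finset.prod_Ico_eq_prod_range, Finset.prod_Ico_eq_prod_range,
      ← Finset.prod_range_reflect, ← Finset.prod_range_reflect (fun i => v (1 - q ^ (1 + _)))]
    convert this using 1
    · refine Finset.prod_congr rfl fun i hi => ?_
      have := Finset.mem_range.mp hi
      rw [← hrefl (3 + 4 * i) (by omega) (by omega)]
      congr 3
      omega
    · refine Finset.prod_congr rfl fun i hi => ?_
      have := Finset.mem_range.mp hi
      rw [← hrefl (4 + 4 * i) (by omega) (by omega)]
      congr 3
      omega
  have e3 := h.prod_val_progression_le one_ne_zero k
  rw [map_mul, map_div₀, map_div₀, e1, map_mul, map_pow, h1, h1, val_qPoch, val_qPoch, val_qPoch,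
    ← Finset.prod_range_mul_prod_Ico _ hk, ← Finset.prod_range_mul_prod_Ico _ hk]
  have n1 := hne 1 one_ne_zero k
  have n2 := hne 2 two_ne_zero k
  have n4 := hne 4 four_ne_zero k
  have n5 : ∏ i ∈ Finset.Ico k m, v (1 - q ^ (1 + 4 * i)) ≠ 0 :=
    Finset.prod_ne_zero_iff.mpr fun i _ => h.val_ne (by omega)
  have e4 : ∏ i ∈ Finset.range k, v (1 - q ^ (1 + 4 * i)) ≤ 1 :=
    Finset.prod_le_one' fun i _ => h.val_le _
  generalize ∏ i ∈ Finset.range k, v (1 - q ^ (1 + 4 * i)) = A at *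
  generalize ∏ i ∈ Finset.range k, v (1 - q ^ (2 + 4 * i)) = B at *
  generalize ∏ i ∈ Finset.range k, v (1 - q ^ (4 + 4 * i)) = C at *
  generalize ∏ i ∈ Finset.Ico k m, v (1 - q ^ (1 + 4 * i)) = D at *
  generalize ∏ i ∈ Finset.Ico k m, v (1 - q ^ (2 + 4 * i)) = E at *
  have e5 : B * E / (A * D) * (A ^ 3 / (C * B)) = (E / D) * (A / C) * A := by
    field_simp
  rw [e5]
  exact mul_le_one' (mul_le_one' (div_le_one_of_le₀ e2 zero_le) (div_le_one_of_le₀ e3 zero_le)) e4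

theorem val_closed_lt (h : CyclotomicPlace v q d ζ) {b₀ b₁ c₀ c₁ : K}
    (hb : UnitPair v q b₀ b₁) (hc : UnitPair v q c₀ c₁) {m n : ℕ} (hm : 4 * m + 1 = n)
    (hdn : d ∣ n) : v (swisherClosed q n * balClosed q b₀ b₁ c₀ c₁ m) < 1 := by
  have hd := h.one_lt
  have hv1 : v (1 - q) = 1 := by
    have := h.val_eq_one (j := 1) (by rw [Nat.dvd_one]; omega)
    rwa [pow_one] at this
  have hint : ∀ j, v (qInt q j) = v (1 - q ^ j) := fun j => by
    rw [qInt, map_div₀, hv1, div_one]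
  have hn0 : n ≠ 0 := by omega
  have hB : v (1 + qInt q n ^ 2 * swisherB q n) ≤ 1 := by
    refine v.map_add_le (by simp) ?_
    rw [swisherB, mul_add, Finset.mul_sum]
    refine v.map_add_le ?_ (v.map_sum_le fun k hk => ?_)
    · have h24 : v (24 : K) = 1 := by exact_mod_cast h.natCast 24 (by norm_num)
      rw [map_mul, map_pow, hint, map_div₀, h24, div_one, map_mul, map_pow v (1 - q), hv1, one_pow,
        mul_one]
      exact mul_le_one' (pow_le_one' (h.val_le n) 2)
        (v.map_sub_le (by rw [map_pow]; exact pow_le_one' (val_natCast_le n) 2) (by simp))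
    -- The denominator $[4k-2]^2$ may be divisible by $\Phi_d^2$; the factor $[n]^2$ compensates.
    · have hk1 := (Finset.mem_Icc.mp hk).1
      have hj : 4 * k - 2 ≠ 0 := by omega
      rw [map_mul, map_div₀, map_pow, map_pow, map_pow, hint, hint, h.val_q, one_pow, mul_one_div,
        ← div_pow, h.val_dvd hdn hn0]
      exact pow_le_one' (div_le_one_of_le₀ (h.le_val hj) zero_le) 2
  have hS : v (qPoch (q ^ 2) (q ^ 4) m / qPoch (q ^ 4) (q ^ 4) m *
      balClosed q b₀ b₁ c₀ c₁ m) ≤ 1 := by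
    rw [balClosed, Finset.mul_sum]
    refine v.map_sum_le fun k hk => ?_
    have hk : k ≤ m := by have := Finset.mem_range.mp hk; omega
    rw [← mul_assoc, map_mul]
    refine mul_le_one' (h.val_coeff_le (by rwa [hm]) hk) ?_
    rw [map_mul, map_pow, map_pow, h.val_q]
    simpa using val_balWeight_le h.val_q hb hc k
  have e : swisherClosed q n * balClosed q b₀ b₁ c₀ c₁ m =
      qInt q n * (q ^ ((1 - (n : ℤ)) / 4) * (1 + qInt q n ^ 2 * swisherB q n) *
        (qPoch (q ^ 2) (q ^ 4) m / qPoch (q ^ 4) (q ^ 4) m * balClosed q b₀ b₁ c₀ c₁ m)) := by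
    rw [swisherClosed, show (n - 1) / 4 = m by omega]
    ring
  rw [e, map_mul, map_mul, map_mul, hint, map_zpow₀, h.val_q, one_zpow, one_mul]
  exact (mul_le_of_le_one_right' (mul_le_one' hB hS)).trans_lt (h.val_lt hdn)

end CyclotomicPlace

end Divisors

/-! ### The five choices of $(b,c)$. -/

section Specializations

variable {K : Type*} [Field K] {q : K}

theorem wpTerm_eq_mul (b₀ b₁ c₀ c₁ : K) (k : ℕ) :
    wpTerm q (q ^ 4) b₀ b₁ c₀ c₁ 1 1 1 k =
      qInt q (8 * k + 1) * wpCore q (q ^ 4) b₀ b₁ c₀ c₁ k := by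
  rw [wpTerm_one, qInt]
  congr 3
  ring

/-- At $b=c=-q$ the base doubles: $(q;q^4)_k(-q;q^4)_k=(q^2;q^8)_k$, and likewise for the
denominators. This and the following evaluations compare ratios of consecutive terms. -/
theorem wpCore_negq_negq (hq : q ≠ 0) (h1 : ∀ i, 1 - q ^ 4 * (q ^ 4) ^ i ≠ 0)
    (h2 : ∀ i, 1 + q ^ 4 * (q ^ 4) ^ i ≠ 0) (k : ℕ) :
    wpCore q (q ^ 4) 1 (-q) 1 (-q) k = qPoch q (q ^ 4) k ^ 2 * qPoch (q ^ 2) (q ^ 8) k ^ 2 /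
      (qPoch (q ^ 4) (q ^ 4) k ^ 2 * qPoch (q ^ 8) (q ^ 8) k ^ 2) * q ^ (5 * k) := by
  induction k with
  | zero => simp [wpCore, wpWeight, wpRatio, qPoch]
  | succ k ih =>
    have h1 := h1 k
    have h2 := h2 k
    rw [wpCore_succ, ih]
    simp only [qPoch_succ, show 5 * (k + 1) = 5 * k + 5 by ring, pow_add q (5 * k)]
    have e8 : (q ^ 8) ^ k = ((q ^ 4) ^ k) ^ 2 := by ring
    rw [e8]
    generalize (q ^ 4) ^ k = x at *
    have e1 : 1 - q ^ 8 * x ^ 2 = (1 - q ^ 4 * x) * (1 + q ^ 4 * x) := by ring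
    have e2 : -q - q * 1 * (q ^ 4 * x) = -q * (1 + q ^ 4 * x) := by ring
    have e3 : 1 - q ^ 2 * x ^ 2 = (1 - q * x) * (1 + q * x) := by ring
    rw [e1, e2, e3]
    generalize 1 - q ^ 4 * x = D₁ at *
    generalize 1 + q ^ 4 * x = D₂ at *
    field_simp
    ring

/-- The pair $(0,1)$ is $c=\infty$: its numerators become monomials, which produce the quadratic
exponent. For $(1,0)$, that is $c=0$, the denominators do so and the exponent turns negative. -/
theorem wpCore_negq_infty (hq : q ≠ 0) (h1 : ∀ i, 1 - q ^ 4 * (q ^ 4) ^ i ≠ 0)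
    (h2 : ∀ i, 1 + q ^ 4 * (q ^ 4) ^ i ≠ 0) (k : ℕ) :
    wpCore q (q ^ 4) 1 (-q) 0 1 k = qPoch q (q ^ 4) k ^ 3 * qPoch (q ^ 2) (q ^ 8) k /
      (qPoch (q ^ 4) (q ^ 4) k ^ 3 * qPoch (q ^ 8) (q ^ 8) k) * q ^ (2 * k ^ 2 + 4 * k) := by
  induction k with
  | zero => simp [wpCore, wpWeight, wpRatio, qPoch]
  | succ k ih =>
    have h1 := h1 k
    have h2 := h2 k
    rw [wpCore_succ, ih]
    have e0 : q ^ (2 * (k + 1) ^ 2 + 4 * (k + 1)) =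
      q ^ (2 * k ^ 2 + 4 * k) * (q ^ 6 * (q ^ 4) ^ k) := by ring
    have e8 : (q ^ 8) ^ k = ((q ^ 4) ^ k) ^ 2 := by ring
    simp only [qPoch_succ, e0, e8]
    generalize (q ^ 4) ^ k = x at *
    have e1 : 1 - q ^ 8 * x ^ 2 = (1 - q ^ 4 * x) * (1 + q ^ 4 * x) := by ring
    have e2 : -q - q * 1 * (q ^ 4 * x) = -q * (1 + q ^ 4 * x) := by ring
    have e3 : 1 - q ^ 2 * x ^ 2 = (1 - q * x) * (1 + q * x) := by ring
    have e4 : 1 - q * 0 * (q ^ 4 * x) = 1 := by ring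
    rw [e1, e2, e3, e4]
    generalize 1 - q ^ 4 * x = D₁ at *
    generalize 1 + q ^ 4 * x = D₂ at *
    field_simp
    ring

theorem wpCore_negq_zero (hq : q ≠ 0) (h1 : ∀ i, 1 - q ^ 4 * (q ^ 4) ^ i ≠ 0)
    (h2 : ∀ i, 1 + q ^ 4 * (q ^ 4) ^ i ≠ 0) (k : ℕ) :
    wpCore q (q ^ 4) 1 (-q) 1 0 k = qPoch q (q ^ 4) k ^ 3 * qPoch (q ^ 2) (q ^ 8) k /
      (qPoch (q ^ 4) (q ^ 4) k ^ 3 * qPoch (q ^ 8) (q ^ 8) k) *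
        q ^ (3 * (k : ℤ) - 2 * (k : ℤ) ^ 2) := by
  induction k with
  | zero => simp [wpCore, wpWeight, wpRatio, qPoch]
  | succ k ih =>
    have h1 := h1 k
    have h2 := h2 k
    rw [wpCore_succ, ih]
    have e0 : q ^ (3 * ((k + 1 : ℕ) : ℤ) - 2 * ((k + 1 : ℕ) : ℤ) ^ 2) =
        q ^ (3 * (k : ℤ) - 2 * (k : ℤ) ^ 2) * (q * ((q ^ 4) ^ k)⁻¹) := by
      rw [← pow_mul, ← zpow_natCast q (4 * k), ← zpow_neg, ← zpow_one_add₀ hq, ← zpow_add₀ hq]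
      congr 1
      push_cast
      ring
    have e8 : (q ^ 8) ^ k = ((q ^ 4) ^ k) ^ 2 := by ring
    have hx : (q ^ 4) ^ k ≠ 0 := pow_ne_zero _ (pow_ne_zero _ hq)
    simp only [qPoch_succ, e0, e8]
    generalize (q ^ 4) ^ k = x at *
    have e1 : 1 - q ^ 8 * x ^ 2 = (1 - q ^ 4 * x) * (1 + q ^ 4 * x) := by ring
    have e2 : -q - q * 1 * (q ^ 4 * x) = -q * (1 + q ^ 4 * x) := by ring
    have e3 : 1 - q ^ 2 * x ^ 2 = (1 - q * x) * (1 + q * x) := by ring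
    have e4 : 0 - q * 1 * (q ^ 4 * x) = -(q ^ 5 * x) := by ring
    rw [e1, e2, e3, e4]
    generalize 1 - q ^ 4 * x = D₁ at *
    generalize 1 + q ^ 4 * x = D₂ at *
    field_simp
    ring

theorem wpCore_infty_infty (hq : q ≠ 0) (h1 : ∀ i, 1 - q ^ 4 * (q ^ 4) ^ i ≠ 0) (k : ℕ) :
    wpCore q (q ^ 4) 0 1 0 1 k = qPoch q (q ^ 4) k ^ 4 / qPoch (q ^ 4) (q ^ 4) k ^ 4 *
      q ^ (4 * k ^ 2 + 3 * k) := by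
  induction k with
  | zero => simp [wpCore, wpWeight, wpRatio, qPoch]
  | succ k ih =>
    have h1 := h1 k
    rw [wpCore_succ, ih]
    have e0 : q ^ (4 * (k + 1) ^ 2 + 3 * (k + 1)) =
      q ^ (4 * k ^ 2 + 3 * k) * (q ^ 7 * ((q ^ 4) ^ k) ^ 2) := by ring
    simp only [qPoch_succ, e0]
    generalize (q ^ 4) ^ k = x at *
    have e4 : 1 - q * 0 * (q ^ 4 * x) = 1 := by ring
    rw [e4]
    generalize 1 - q ^ 4 * x = D₁ at *
    field_simp
    ring

theorem wpCore_zero_zero (hq : q ≠ 0) (h1 : ∀ i, 1 - q ^ 4 * (q ^ 4) ^ i ≠ 0) (k : ℕ) :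
    wpCore q (q ^ 4) 1 0 1 0 k = qPoch q (q ^ 4) k ^ 4 / qPoch (q ^ 4) (q ^ 4) k ^ 4 *
      q ^ ((k : ℤ) - 4 * (k : ℤ) ^ 2) := by
  induction k with
  | zero => simp [wpCore, wpWeight, wpRatio, qPoch]
  | succ k ih =>
    have h1 := h1 k
    rw [wpCore_succ, ih]
    have e0 : q ^ (((k + 1 : ℕ) : ℤ) - 4 * ((k + 1 : ℕ) : ℤ) ^ 2) =
        q ^ ((k : ℤ) - 4 * (k : ℤ) ^ 2) * (q ^ 3 * ((q ^ 4) ^ k) ^ 2)⁻¹ := by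
      rw [← pow_mul, ← pow_mul, ← pow_add, ← zpow_natCast q, ← zpow_neg, ← zpow_add₀ hq]
      congr 1
      push_cast
      ring
    have hx : (q ^ 4) ^ k ≠ 0 := pow_ne_zero _ (pow_ne_zero _ hq)
    simp only [qPoch_succ, e0]
    generalize (q ^ 4) ^ k = x at *
    have e4 : 0 - q * 1 * (q ^ 4 * x) = -(q ^ 5 * x) := by ring
    rw [e4]
    generalize 1 - q ^ 4 * x = D₁ at *
    field_simp
    ring

theorem balWeight_negq_negq (hq : q ≠ 0) (h2 : ∀ i, 1 + q ^ 4 * (q ^ 4) ^ i ≠ 0) (k : ℕ) :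
    balWeight q (q ^ 4) 1 (-q) 1 (-q) k * (q ^ 4) ^ k =
      qPoch (q ^ 3) (q ^ 4) k / qPoch (-q ^ 4) (q ^ 4) k ^ 2 * q ^ (4 * k) := by
  rw [pow_mul]
  congr 1
  induction k with
  | zero => simp [balWeight, qPoch]
  | succ k ih =>
    have h2 := h2 k
    rw [balWeight_succ, ih]
    simp only [qPoch_succ, pow_succ' (q ^ 4) k]
    generalize (q ^ 4) ^ k = x at *
    have e1 : -q - q * 1 * (q ^ 4 * x) = -q * (1 + q ^ 4 * x) := by ring
    have e2 : 1 - -q ^ 4 * x = 1 + q ^ 4 * x := by ring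
    rw [e1, e2]
    generalize 1 + q ^ 4 * x = D₂ at *
    field_simp

theorem balWeight_negq_infty (hq : q ≠ 0) (h2 : ∀ i, 1 + q ^ 4 * (q ^ 4) ^ i ≠ 0) (k : ℕ) :
    balWeight q (q ^ 4) 1 (-q) 0 1 k * (q ^ 4) ^ k =
      1 / qPoch (-q ^ 4) (q ^ 4) k * q ^ (4 * k) := by
  rw [pow_mul]
  congr 1
  induction k with
  | zero => simp [balWeight, qPoch]
  | succ k ih =>
    have h2 := h2 k
    rw [balWeight_succ, ih]
    simp only [qPoch_succ, pow_succ' (q ^ 4) k]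
    generalize (q ^ 4) ^ k = x at *
    have e1 : -q - q * 1 * (q ^ 4 * x) = -q * (1 + q ^ 4 * x) := by ring
    have e2 : 1 - -q ^ 4 * x = 1 + q ^ 4 * x := by ring
    rw [e1, e2]
    generalize 1 + q ^ 4 * x = D₂ at *
    field_simp
    ring

theorem balWeight_negq_zero (hq : q ≠ 0) (h2 : ∀ i, 1 + q ^ 4 * (q ^ 4) ^ i ≠ 0) (k : ℕ) :
    balWeight q (q ^ 4) 1 (-q) 1 0 k * (q ^ 4) ^ k =
      1 / qPoch (-q ^ 4) (q ^ 4) k * (-q) ^ (3 * k) := by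
  induction k with
  | zero => simp [balWeight, qPoch]
  | succ k ih =>
    have h2 := h2 k
    have hx : (q ^ 4) ^ k ≠ 0 := pow_ne_zero _ (pow_ne_zero _ hq)
    rw [balWeight_succ, pow_succ (q ^ 4) k, mul_mul_mul_comm, ih]
    simp only [qPoch_succ, show 3 * (k + 1) = 3 * k + 3 by ring, pow_add (-q) (3 * k)]
    generalize (q ^ 4) ^ k = x at *
    have e1 : -q - q * 1 * (x * q ^ 4) = -q * (1 + q ^ 4 * x) := by ring
    have e2 : 1 - -q ^ 4 * x = 1 + q ^ 4 * x := by ring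
    have e4 : 0 - q * 1 * (x * q ^ 4) = -(q ^ 5 * x) := by ring
    rw [e1, e2, e4]
    generalize 1 + q ^ 4 * x = D₂ at *
    field_simp
    ring

theorem balWeight_infty_infty (k : ℕ) :
    balWeight q (q ^ 4) 0 1 0 1 k * (q ^ 4) ^ k = q ^ (4 * k) := by
  simp [balWeight, pow_mul]

theorem balWeight_zero_zero (hq : q ≠ 0) (k : ℕ) :
    balWeight q (q ^ 4) 1 0 1 0 k * (q ^ 4) ^ k = (-q) ^ ((k : ℤ) - 2 * (k : ℤ) ^ 2) := by
  induction k with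
  | zero => simp [balWeight]
  | succ k ih =>
    have hx : (q ^ 4) ^ k ≠ 0 := pow_ne_zero _ (pow_ne_zero _ hq)
    have e0 : (-q) ^ (((k + 1 : ℕ) : ℤ) - 2 * ((k + 1 : ℕ) : ℤ) ^ 2) =
        (-q) ^ ((k : ℤ) - 2 * (k : ℤ) ^ 2) * (-q * (q ^ 4) ^ k)⁻¹ := by
      have e4 : (q ^ 4) ^ k = (-q) ^ (4 * k) := by rw [pow_mul, Even.neg_pow (by decide)]
      rw [e4, ← pow_succ', ← zpow_natCast (-q), ← zpow_neg, ← zpow_add₀ (neg_ne_zero.mpr hq)]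
      congr 1
      push_cast
      ring
    rw [balWeight_succ, pow_succ (q ^ 4) k, mul_mul_mul_comm, ih, e0]
    generalize (q ^ 4) ^ k = x at *
    have e4 : 0 - q * 1 * (x * q ^ 4) = -(q ^ 5 * x) := by ring
    rw [e4]
    field_simp
    ring

end Specializations

/-! ### Integrality of the parameter pairs. -/

section UnitPairs

variable {K Γ : Type*} [Field K] [LinearOrderedCommGroupWithZero Γ] {v : Valuation K Γ}
variable {q : K} {d : ℕ} {ζ : IsLocalRing.ResidueField v.valuationSubring}

namespace CyclotomicPlace

theorem val_one_add (h : CyclotomicPlace v q d ζ) (j : ℕ) : v (1 + q ^ j) = 1 :=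
  (Res.one.add (h.res.pow j)).eq_one (h.one_add_ne j)

theorem unitPair_negq (h : CyclotomicPlace v q d ζ) : UnitPair v q 1 (-q) where
  le_left := by simp
  le_right := by simp [h.val_q]
  num i := by
    rw [show 1 - -q * (q ^ 4) ^ i = 1 + q ^ (4 * i + 1) by ring]
    exact h.val_one_add _
  den i := by
    rw [show -q - q * 1 * (q ^ 4) ^ (i + 1) = -q * (1 + q ^ (4 * (i + 1))) by ring, map_mul,
      h.val_one_add, Valuation.map_neg, h.val_q, one_mul]

theorem unitPair_infty (h : CyclotomicPlace v q d ζ) : UnitPair v q 0 1 where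
  le_left := by simp
  le_right := by simp
  num i := by simp [h.val_q]
  den i := by simp

theorem unitPair_zero (h : CyclotomicPlace v q d ζ) : UnitPair v q 1 0 where
  le_left := by simp
  le_right := by simp
  num i := by simp
  den i := by simp [h.val_q]

end CyclotomicPlace

end UnitPairs

/-! ### The valuation of $\mathbb{Q}(q)$ at $\Phi_d$. -/

section RationalPlaces

open IsDedekindDomain WithZero

/-- The place of `ℚ(q)` given by the `d`-th cyclotomic polynomial. -/
noncomputable def cyclotomicPrime {d : ℕ} (hd : 0 < d) : HeightOneSpectrum ℚ[X] where
  asIdeal := Ideal.span {cyclotomic d ℚ}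
  isPrime := (Ideal.span_singleton_prime (cyclotomic_ne_zero d ℚ)).mpr
    (cyclotomic.irreducible_rat hd).prime
  ne_bot := by simpa [Ideal.span_singleton_eq_bot] using cyclotomic_ne_zero d ℚ

/-- The valuation of `ℚ(q)` attached to the `d`-th cyclotomic polynomial. -/
noncomputable def cyclotomicVal {d : ℕ} (hd : 0 < d) : Valuation (RatFunc ℚ) ℤᵐ⁰ :=
  (cyclotomicPrime hd).valuation (RatFunc ℚ)

variable {d : ℕ} (hd : 0 < d)

theorem cyclotomicVal_le_iff (f : ℚ[X]) (e : ℕ) :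
    cyclotomicVal hd (algebraMap ℚ[X] (RatFunc ℚ) f) ≤ exp (-(e : ℤ)) ↔
      cyclotomic d ℚ ^ e ∣ f := by
  rw [cyclotomicVal, HeightOneSpectrum.valuation_of_algebraMap,
    HeightOneSpectrum.intValuation_le_pow_iff_mem]
  change f ∈ Ideal.span {cyclotomic d ℚ} ^ e ↔ _
  rw [Ideal.span_singleton_pow, Ideal.mem_span_singleton]

theorem cyclotomicVal_le_one (f : ℚ[X]) :
    cyclotomicVal hd (algebraMap ℚ[X] (RatFunc ℚ) f) ≤ 1 :=
  HeightOneSpectrum.valuation_le_one _ _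

theorem lt_one_iff_le_exp (x : ℤᵐ⁰) : x < 1 ↔ x ≤ exp (-((1 : ℕ) : ℤ)) := by
  rw [← lt_mul_exp_iff_le (by simp), ← exp_add]
  simp

theorem cyclotomicVal_lt_one_iff (f : ℚ[X]) :
    cyclotomicVal hd (algebraMap ℚ[X] (RatFunc ℚ) f) < 1 ↔ cyclotomic d ℚ ∣ f := by
  rw [lt_one_iff_le_exp, cyclotomicVal_le_iff, pow_one]

theorem cyclotomic_dvd_X_pow_sub_one_iff {d : ℕ} (hd : 0 < d) {k : ℕ} (hk : 0 < k) :
    cyclotomic d ℚ ∣ X ^ k - 1 ↔ d ∣ k := by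
  constructor
  · intro h
    rw [← prod_cyclotomic_eq_X_pow_sub_one hk] at h
    have hp := (cyclotomic.irreducible_rat hd).prime
    obtain ⟨e, he, hde⟩ := (hp.dvd_finsetProd_iff _).mp h
    by_contra hdk
    have hne : d ≠ e := by rintro rfl; exact hdk (Nat.dvd_of_mem_divisors he)
    exact hp.not_isUnit ((cyclotomic.isCoprime_rat hne).isUnit_of_dvd' dvd_rfl hde)
  · intro h
    exact (cyclotomic.dvd_X_pow_sub_one d ℚ).trans (by
      obtain ⟨j, rfl⟩ := h
      rw [pow_mul]
      exact sub_one_dvd_pow_sub_one _ _)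

theorem algebraMap_one_sub_X_pow (k : ℕ) :
    algebraMap ℚ[X] (RatFunc ℚ) (X ^ k - 1) = -(1 - (RatFunc.X : RatFunc ℚ) ^ k) := by
  simp

/-- $\Phi_d$ divides $X^k-1$, and only once, since $X^k-1$ is separable in characteristic zero. -/
theorem cyclotomicVal_one_sub {k : ℕ} (hk : 0 < k) (hdk : d ∣ k) :
    cyclotomicVal hd (1 - (RatFunc.X : RatFunc ℚ) ^ k) = exp (-1) := by
  rw [← Valuation.map_neg, ← algebraMap_one_sub_X_pow]
  refine le_antisymm ?_ (not_lt.mp fun h => ?_)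
  · have := (cyclotomicVal_le_iff hd (X ^ k - 1) 1).mpr
      (by rw [pow_one]; exact (cyclotomic_dvd_X_pow_sub_one_iff hd hk).mpr hdk)
    simpa using this
  · have h2 : cyclotomic d ℚ ^ 2 ∣ X ^ k - 1 := by
      rw [← cyclotomicVal_le_iff hd, ← lt_mul_exp_iff_le (by simp), ← exp_add]
      simpa using h
    have hsep : (X ^ k - 1 : ℚ[X]).Separable :=
      X_pow_sub_one_separable_iff.mpr (by exact_mod_cast hk.ne')
    exact (cyclotomic.irreducible_rat hd).not_isUnit (hsep.squarefree _ (by rwa [← sq]))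

theorem exists_cyclotomicPlace (hodd : Odd d) (h1 : 1 < d) :
    ∃ ζ, CyclotomicPlace (cyclotomicVal hd) (RatFunc.X : RatFunc ℚ) d ζ := by
  have hX : cyclotomicVal hd (RatFunc.X : RatFunc ℚ) ≤ 1 := by
    rw [← RatFunc.algebraMap_X]; exact cyclotomicVal_le_one hd _
  obtain ⟨ζ, hζ⟩ := Res.of_le hX
  have hτ := cyclotomicVal_one_sub hd hd dvd_rfl
  refine ⟨ζ, hodd, h1, hζ, ?_, ?_, ?_, ?_, ?_⟩
  · have key : ∀ k, 0 < k → (ζ ^ k = 1 ↔ d ∣ k) := by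
      intro k hk
      rw [← cyclotomic_dvd_X_pow_sub_one_iff hd hk, ← cyclotomicVal_lt_one_iff hd,
        algebraMap_one_sub_X_pow, Valuation.map_neg, ← Res.zero_iff]
      have := Res.one.sub (hζ.pow k)
      constructor
      · intro h; rwa [h, sub_self] at this
      · intro h; exact (sub_eq_zero.mp (this.unique h)).symm
    refine IsPrimitiveRoot.iff_def ζ d |>.mpr ⟨(key d hd).mpr dvd_rfl, fun l hl => ?_⟩
    rcases Nat.eq_zero_or_pos l with rfl | hl0
    · exact dvd_zero d
    · exact (key l hl0).mp hl
  · intro k hk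
    have e : (k : RatFunc ℚ) = algebraMap ℚ[X] (RatFunc ℚ) (k : ℚ[X]) := by simp
    rw [e]
    refine le_antisymm (cyclotomicVal_le_one hd _) (not_lt.mp fun h => ?_)
    rw [cyclotomicVal_lt_one_iff] at h
    refine (cyclotomic.irreducible_rat hd).not_isUnit (isUnit_of_dvd_unit h ?_)
    rw [← C_eq_natCast, isUnit_C]
    exact (Nat.cast_ne_zero.mpr hk).isUnit
  · intro j hj
    rw [hτ, cyclotomicVal_one_sub hd (Nat.mul_pos hd (Nat.pos_of_ne_zero hj)) (dvd_mul_right d j)]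
  · rw [← Valuation.ne_zero_iff (cyclotomicVal hd), hτ]
    simp
  · intro x hx
    rw [hτ]
    simpa using (lt_one_iff_le_exp _).mp hx

theorem cyclotomic_pow_dvd_num {x : RatFunc ℚ} {e : ℕ}
    (hx : cyclotomicVal hd x ≤ exp (-(e : ℤ))) : cyclotomic d ℚ ^ e ∣ x.num := by
  rw [← cyclotomicVal_le_iff hd]
  have h : algebraMap ℚ[X] (RatFunc ℚ) x.num = x * algebraMap ℚ[X] (RatFunc ℚ) x.denom := by
    have h0 : algebraMap ℚ[X] (RatFunc ℚ) x.denom ≠ 0 := by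
      simpa using x.denom_ne_zero
    rw [← div_eq_iff h0, RatFunc.num_div_denom]
  rw [h, map_mul]
  exact (mul_le_of_le_one_right' (cyclotomicVal_le_one hd _)).trans hx

/-- $[n]$ already contains one $\Phi_n$, hence the fourth power; distinct cyclotomic polynomials are
coprime over $\mathbb{Q}$. -/
theorem qIntPoly_mul_dvd {n : ℕ} (hn : 1 < n) {N : ℚ[X]}
    (h1 : ∀ d, d ∣ n → d ≠ 1 → cyclotomic d ℚ ∣ N) (h4 : cyclotomic n ℚ ^ 4 ∣ N) :
    qIntPoly n * cyclotomic n ℚ ^ 3 ∣ N := by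
  have hmem : n ∈ n.divisors.erase 1 := by simp; omega
  rw [qIntPoly, ← prod_cyclotomic_eq_geom_sum (by omega) ℚ, ← Finset.prod_erase_mul _ _ hmem,
    mul_assoc, ← pow_succ']
  refine IsCoprime.mul_dvd ?_ (Finset.prod_dvd_of_coprime ?_ ?_) h4
  · exact IsCoprime.pow_right (IsCoprime.prod_left fun d hd =>
      cyclotomic.isCoprime_rat (Finset.ne_of_mem_erase hd))
  · intro a _ b _ hab
    exact cyclotomic.isCoprime_rat hab
  · intro d hd
    have hd' := Finset.mem_of_mem_erase hd
    exact h1 d (Nat.dvd_of_mem_divisors (Finset.mem_of_mem_erase hd')) (Finset.ne_of_mem_erase hd')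

end RationalPlaces

/-! ### From local estimates to the congruences. -/

section Main

theorem ratCongr_wpTerm {n m M : ℕ} (hm : 4 * m + 1 = n) (hM : M = m ∨ M = n - 1) (hn : 1 < n)
    {b₀ b₁ c₀ c₁ : RatFunc ℚ}
    (hb : ∀ {d : ℕ} (hd : 0 < d) (ζ), CyclotomicPlace (cyclotomicVal hd) RatFunc.X d ζ →
      UnitPair (cyclotomicVal hd) RatFunc.X b₀ b₁)
    (hc : ∀ {d : ℕ} (hd : 0 < d) (ζ), CyclotomicPlace (cyclotomicVal hd) RatFunc.X d ζ →
      UnitPair (cyclotomicVal hd) RatFunc.X c₀ c₁) :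
    RatCongr (qIntPoly n * cyclotomic n ℚ ^ 3)
      (∑ k ∈ Finset.range (M + 1),
        wpTerm (RatFunc.X : RatFunc ℚ) (RatFunc.X ^ 4) b₀ b₁ c₀ c₁ 1 1 1 k)
      (swisherClosed RatFunc.X n * balClosed RatFunc.X b₀ b₁ c₀ c₁ m) := by
  have hodd : Odd n := ⟨2 * m, by omega⟩
  refine qIntPoly_mul_dvd hn (fun d hdn hd1 => ?_) ?_
  · have hd : 0 < d := Nat.pos_of_dvd_of_pos hdn (by omega)
    obtain ⟨ζ, h⟩ := exists_cyclotomicPlace hd (hodd.of_dvd_nat hdn) (by omega)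
    rw [← pow_one (cyclotomic d ℚ)]
    refine cyclotomic_pow_dvd_num hd ((lt_one_iff_le_exp _).mp ?_)
    refine (Valuation.map_sub _ _ _).trans_lt
      (max_lt ?_ (h.val_closed_lt (hb hd ζ h) (hc hd ζ h) hm hdn))
    -- For $M=m$ the sum is full blocks plus a partial block ending at $r=m\bmod d$, where
    -- $d\mid4r+1$ because $d\mid4m+1$. For $M=n-1$ it consists of $n/d$ full blocks.
    rcases hM with rfl | rfl
    · have hr := Nat.mod_lt M hd
      have hMd := Nat.div_add_mod M d
      have := (h.val_sum_wpTerm_lt (hb hd ζ h) (hc hd ζ h) (M / d)).2 (M % d) hr (by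
        rw [← hm, ← hMd, show 4 * (d * (M / d) + M % d) + 1 = d * (4 * (M / d)) + (4 * (M % d) + 1)
          by ring] at hdn
        exact (Nat.dvd_add_right (dvd_mul_right d _)).mp hdn)
      rwa [← add_assoc, hMd] at this
    · have := (h.val_sum_wpTerm_lt (hb hd ζ h) (hc hd ζ h) (n / d)).1
      rwa [Nat.mul_div_cancel' hdn, ← Nat.sub_add_cancel hn.le] at this
  · have hn0 : 0 < n := by omega
    obtain ⟨ζ, h⟩ := exists_cyclotomicPlace hn0 hodd hn
    refine cyclotomic_pow_dvd_num hn0 ?_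
    have hτ : cyclotomicVal hn0 (1 - (RatFunc.X : RatFunc ℚ) ^ n) ^ 4 =
        WithZero.exp (-((4 : ℕ) : ℤ)) := by
      rw [cyclotomicVal_one_sub hn0 hn0 dvd_rfl, ← WithZero.exp_nsmul]
      simp
    have hfull := h.val_sum_sub_closed (hb hn0 ζ h) (hc hn0 ζ h) hm
    rw [hτ] at hfull
    rcases hM with rfl | rfl
    · exact hfull
    · rw [show n - 1 + 1 = (m + 1) + (n - 1 - m) by omega, Finset.sum_range_add, add_sub_right_comm]
      refine Valuation.map_add_le _ hfull (Valuation.map_sum_le _ fun k hk => ?_)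
      have := Finset.mem_range.mp hk
      rw [← hτ]
      exact h.val_wpTerm_tail (hb hn0 ζ h) (hc hn0 ζ h) hm (by omega) (by omega)

end Main

section Main

theorem one_sub_X_pow_ne_zero {j : ℕ} (hj : j ≠ 0) : 1 - (RatFunc.X : RatFunc ℚ) ^ j ≠ 0 := by
  rw [← neg_ne_zero, ← algebraMap_one_sub_X_pow]
  exact RatFunc.algebraMap_ne_zero (X_pow_sub_C_ne_zero (Nat.pos_of_ne_zero hj) 1)

theorem one_add_X_pow_ne_zero {j : ℕ} (hj : j ≠ 0) : 1 + (RatFunc.X : RatFunc ℚ) ^ j ≠ 0 := by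
  intro h
  apply one_sub_X_pow_ne_zero (mul_ne_zero two_ne_zero hj)
  linear_combination (1 - (RatFunc.X : RatFunc ℚ) ^ j) * h

/-- For $n=1$ there is no cyclotomic place with $d>1$ to use, but both sides are then equal. -/
theorem ratCongr_wpTerm_of_pos {n m M : ℕ} (hm : 4 * m + 1 = n) (hM : M = m ∨ M = n - 1)
    {b₀ b₁ c₀ c₁ : RatFunc ℚ}
    (hb : ∀ {d : ℕ} (hd : 0 < d) (ζ), CyclotomicPlace (cyclotomicVal hd) RatFunc.X d ζ →
      UnitPair (cyclotomicVal hd) RatFunc.X b₀ b₁)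
    (hc : ∀ {d : ℕ} (hd : 0 < d) (ζ), CyclotomicPlace (cyclotomicVal hd) RatFunc.X d ζ →
      UnitPair (cyclotomicVal hd) RatFunc.X c₀ c₁) :
    RatCongr (qIntPoly n * cyclotomic n ℚ ^ 3)
      (∑ k ∈ Finset.range (M + 1),
        wpTerm (RatFunc.X : RatFunc ℚ) (RatFunc.X ^ 4) b₀ b₁ c₀ c₁ 1 1 1 k)
      (swisherClosed RatFunc.X n * balClosed RatFunc.X b₀ b₁ c₀ c₁ m) := by
  rcases Nat.eq_zero_or_pos m with rfl | h0
  · obtain rfl : n = 1 := by omega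
    obtain rfl : M = 0 := by omega
    have hX : 1 - (RatFunc.X : RatFunc ℚ) ≠ 0 := by simpa using one_sub_X_pow_ne_zero one_ne_zero
    have e : ∑ k ∈ Finset.range (0 + 1),
        wpTerm (RatFunc.X : RatFunc ℚ) (RatFunc.X ^ 4) b₀ b₁ c₀ c₁ 1 1 1 k =
        swisherClosed RatFunc.X 1 * balClosed RatFunc.X b₀ b₁ c₀ c₁ 0 := by
      simp [wpTerm_eq_mul, wpCore, wpWeight, wpRatio, swisherClosed, swisherB, balClosed,
        balWeight, qPoch, qInt, hX]
    rw [RatCongr, e, sub_self, RatFunc.num_zero]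
    exact dvd_zero _
  · exact ratCongr_wpTerm hm hM (by omega) hb hc

end Main

theorem mainTheorem5 (n : ℕ) (hn : n ≡ 1 [MOD 4]) (M : ℕ)
    (hM : M = (n - 1) / 4 ∨ M = n - 1) :
    let q : RatFunc ℚ := RatFunc.X
    let P : ℚ[X] := qIntPoly n * cyclotomic n ℚ ^ 3
    RatCongr P
      (∑ k ∈ Finset.range (M + 1), qInt q (8 * k + 1) *
        (qPoch q (q ^ 4) k ^ 2 * qPoch (q ^ 2) (q ^ 8) k ^ 2 /
          (qPoch (q ^ 4) (q ^ 4) k ^ 2 * qPoch (q ^ 8) (q ^ 8) k ^ 2)) * q ^ (5 * k))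
      (swisherClosed q n * ∑ k ∈ Finset.range ((n - 1) / 4 + 1),
        qPoch (q ^ 3) (q ^ 4) k * qPoch q (q ^ 4) k ^ 3 /
          (qPoch (q ^ 4) (q ^ 4) k * qPoch (-q ^ 4) (q ^ 4) k ^ 2 * qPoch (q ^ 2) (q ^ 4) k) *
            q ^ (4 * k)) ∧
    RatCongr P
      (∑ k ∈ Finset.range (M + 1), qInt q (8 * k + 1) *
        (qPoch q (q ^ 4) k ^ 3 * qPoch (q ^ 2) (q ^ 8) k /
          (qPoch (q ^ 4) (q ^ 4) k ^ 3 * qPoch (q ^ 8) (q ^ 8) k)) * q ^ (2 * k ^ 2 + 4 * k))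
      (swisherClosed q n * ∑ k ∈ Finset.range ((n - 1) / 4 + 1),
        qPoch q (q ^ 4) k ^ 3 /
          (qPoch (q ^ 4) (q ^ 4) k * qPoch (-q ^ 4) (q ^ 4) k * qPoch (q ^ 2) (q ^ 4) k) *
            q ^ (4 * k)) ∧
    RatCongr P
      (∑ k ∈ Finset.range (M + 1), qInt q (8 * k + 1) *
        (qPoch q (q ^ 4) k ^ 3 * qPoch (q ^ 2) (q ^ 8) k /
          (qPoch (q ^ 4) (q ^ 4) k ^ 3 * qPoch (q ^ 8) (q ^ 8) k)) *
            q ^ (3 * (k : ℤ) - 2 * (k : ℤ) ^ 2))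
      (swisherClosed q n * ∑ k ∈ Finset.range ((n - 1) / 4 + 1),
        qPoch q (q ^ 4) k ^ 3 /
          (qPoch (q ^ 4) (q ^ 4) k * qPoch (-q ^ 4) (q ^ 4) k * qPoch (q ^ 2) (q ^ 4) k) *
            (-q) ^ (3 * k)) ∧
    RatCongr P
      (∑ k ∈ Finset.range (M + 1), qInt q (8 * k + 1) *
        (qPoch q (q ^ 4) k ^ 4 / qPoch (q ^ 4) (q ^ 4) k ^ 4) * q ^ (4 * k ^ 2 + 3 * k))
      (swisherClosed q n * ∑ k ∈ Finset.range ((n - 1) / 4 + 1),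
        qPoch q (q ^ 4) k ^ 3 / (qPoch (q ^ 4) (q ^ 4) k * qPoch (q ^ 2) (q ^ 4) k) *
          q ^ (4 * k)) ∧
    RatCongr P
      (∑ k ∈ Finset.range (M + 1), qInt q (8 * k + 1) *
        (qPoch q (q ^ 4) k ^ 4 / qPoch (q ^ 4) (q ^ 4) k ^ 4) *
          q ^ ((k : ℤ) - 4 * (k : ℤ) ^ 2))
      (swisherClosed q n * ∑ k ∈ Finset.range ((n - 1) / 4 + 1),
        qPoch q (q ^ 4) k ^ 3 / (qPoch (q ^ 4) (q ^ 4) k * qPoch (q ^ 2) (q ^ 4) k) *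
          (-q) ^ ((k : ℤ) - 2 * (k : ℤ) ^ 2)) := by
  intro q P
  obtain ⟨m, hm⟩ : ∃ m, 4 * m + 1 = n := ⟨n / 4, by
    have := hn.symm
    simp only [Nat.ModEq] at this
    omega⟩
  have hm' : (n - 1) / 4 = m := by omega
  rw [hm'] at hM ⊢
  have hq : q ≠ 0 := RatFunc.X_ne_zero
  have h1 : ∀ i, 1 - q ^ 4 * (q ^ 4) ^ i ≠ 0 := fun i => by
    rw [← pow_succ', ← pow_mul]
    exact one_sub_X_pow_ne_zero (by omega)
  have h2 : ∀ i, 1 + q ^ 4 * (q ^ 4) ^ i ≠ 0 := fun i => by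
    rw [← pow_succ', ← pow_mul]
    exact one_add_X_pow_ne_zero (by omega)
  -- In order, $(b,c)=(-q,-q),\ (-q,\infty),\ (-q,0),\ (\infty,\infty),\ (0,0)$.
  refine ⟨?_, ?_, ?_, ?_, ?_⟩
  · convert ratCongr_wpTerm_of_pos hm hM (fun _ _ h => h.unitPair_negq)
      (fun _ _ h => h.unitPair_negq) using 1
    · refine Finset.sum_congr rfl fun k _ => ?_
      rw [wpTerm_eq_mul, wpCore_negq_negq hq h1 h2, mul_assoc]
    · rw [balClosed]
      refine congrArg _ (Finset.sum_congr rfl fun k _ => ?_)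
      rw [balWeight_negq_negq hq h2, ← mul_assoc, div_mul_div_comm]
      congr 2 <;> ring
  · convert ratCongr_wpTerm_of_pos hm hM (fun _ _ h => h.unitPair_negq)
      (fun _ _ h => h.unitPair_infty) using 1
    · refine Finset.sum_congr rfl fun k _ => ?_
      rw [wpTerm_eq_mul, wpCore_negq_infty hq h1 h2, mul_assoc]
    · rw [balClosed]
      refine congrArg _ (Finset.sum_congr rfl fun k _ => ?_)
      rw [balWeight_negq_infty hq h2, ← mul_assoc, div_mul_div_comm]
      congr 2 <;> ring
  · convert ratCongr_wpTerm_of_pos hm hM (fun _ _ h => h.unitPair_negq)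
      (fun _ _ h => h.unitPair_zero) using 1
    · refine Finset.sum_congr rfl fun k _ => ?_
      rw [wpTerm_eq_mul, wpCore_negq_zero hq h1 h2, mul_assoc]
    · rw [balClosed]
      refine congrArg _ (Finset.sum_congr rfl fun k _ => ?_)
      rw [balWeight_negq_zero hq h2, ← mul_assoc, div_mul_div_comm]
      congr 2 <;> ring
  · convert ratCongr_wpTerm_of_pos hm hM (fun _ _ h => h.unitPair_infty)
      (fun _ _ h => h.unitPair_infty) using 1
    · refine Finset.sum_congr rfl fun k _ => ?_
      rw [wpTerm_eq_mul, wpCore_infty_infty hq h1, mul_assoc]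
    · rw [balClosed]
      refine congrArg _ (Finset.sum_congr rfl fun k _ => ?_)
      rw [balWeight_infty_infty]
  · convert ratCongr_wpTerm_of_pos hm hM (fun _ _ h => h.unitPair_zero)
      (fun _ _ h => h.unitPair_zero) using 1
    · refine Finset.sum_congr rfl fun k _ => ?_
      rw [wpTerm_eq_mul, wpCore_zero_zero hq h1, mul_assoc]
    · rw [balClosed]
      refine congrArg _ (Finset.sum_congr rfl fun k _ => ?_)
      rw [balWeight_zero_zero hq]
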